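/- **Setting.** Let $T=T_{(\pi,\lambda)}$ be an interval exchange transformation on $I=[0,|\lambda|)$ with irreducible $\pi=(\pi_0,\pi_1)$ on a $d$-letter alphabet $\mathcal A$, exchanged intervals $I_\alpha=[l_\alpha,r_\alpha)$, satisfying Keane's condition. Let $\mathcal R$ be Rauzy–Veech induction and $A^{(n)}(T)=A(T)A(\mathcal R T)\cdots A(\mathcal R^{n-1}T)$ the Kontsevich–Zorich cocycle, $A(T)=\mathrm{Id}+E_{\text{winner},\text{loser}}$. For an accelerating sequence $0=n_0<n_1<\dots$ put $T^{(k)}=\mathcal R^{n_k}T:I^{(k)}\to I^{(k)}$ with exchanged intervals $I^{(k)}_\alpha$, $Q(k,l)=A^{(n_l-n_k)}(\mathcal R^{n_k}T)^t$, $Q(k)=Q(0,k)$, $Z(k+1)=Q(k,k+1)$, $Q_\alpha(k)=\sum_\beta Q_{\alpha\beta}(k)$, and $$S(k)\psi(x)=\sum_{0\le i<Q_\alpha(k)}\psi(T^ix)\quad (x\in I^{(k)}_\alpha).$$ **FFDC.** Let $g\ge1$ with $\dim \Omega_\pi\mathbb R^{\mathcal A}=2g$, and $\lambda_1>\dots>\lambda_g>\lambda_{g+1}=0$.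 $T$ is *Oseledets generic* if there is a filtration $\{0\}=E_0\subset E_{-1}\subset\dots\subset E_{-g}\subset E_{g+1}\subset E_g\subset\dots\subset E_1=\mathbb R^{\mathcal A}$ with $\dim E_{-i}-\dim E_{-i+1}=\dim E_i-\dim E_{i+1}=1$ ($1\le i\le g$) such that, along some accelerating sequence, $\frac1k\log\|Q(k)h\|$ tends to $-\lambda_i$, $0$, $\lambda_i$ for $h$ in $E_{-i}\setminus E_{-i+1}$, $E_{g+1}\setminus E_{-g}$, $E_i\setminus E_{i+1}$ respectively. $T$ satisfies the *Full Filtration Diophantine Condition* (FFDC) if it satisfies Keane's condition, is Oseledets generic, and for every $\tau>0$ there is an accelerating sequence *admissible at level $\tau$*, that is: there are $C,\kappa\ge1$, $c>0$, $0<\delta<1$, natural numbers $(r_k)_{k\ge 0}$ with $r_0=0$ (put $r(k,l)=\sum_{k\le j<l}r_j$), and a filtration $\{0\}=U_1\subset U_2\subset\dots\subset U_{g+1}\subset U_{-g}\subset\dots\subset U_{-1}\subset U_0=\mathbb R^{\mathcal A}$ with $U_{g+1}\subset\Omega_\pi\mathbb R^{\mathcal A}$ and $E_j\oplus U_j=\mathbb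 R^{\mathcal A}$ for $-g\le j\le g+1$, such that, with $E^{(k)}_j=Q(k)E_j$, $U^{(k)}_j=Q(k)U_j$, and for all $0\le k<l$: * for each $k\ge1$ there is $0<p_k\le\min_\alpha Q_\alpha(k)$ such that $\{T^iI^{(k)}:0\le i<p_k\}$ are pairwise disjoint intervals of total measure at least $\delta|I|$; * $\lim_k r(0,k)/k$ exists and lies in $(1,1+\tau)$; * $\|Q|_{E_j^{(k)}}(k,l)\|\le Ce^{(\lambda_j+\tau)r(k,l)}$ ($1\le j\le g+1$) and $\|Q|_{E_{-j}^{(k)}}(k,l)\|\le Ce^{(-\lambda_j+\tau)r(k,l)}$ ($1\le j\le g$); * $\|Q|_{U_j^{(k)}}(k,l)^{-1}\|\le Ce^{(-\lambda_{j-1}+\tau)r(k,l)}$ ($2\le j\le g+1$) and $\|Q|_{U_{-j}^{(k)}}(k,l)^{-1}\|\le Ce^{(\lambda_{j+1}+\tau)r(k,l)}$ ($0\le j\le g$); * for all $k\ge 0$: $\|Z(k+1)\|\le Ce^{\tau k}$, $\;C^{-1}e^{\lambda_1k}\le\|Q(k)\|\le Ce^{\lambda_1(1+\tau)k}$, $\;\max_\alpha|I^{(k)}|/|I^{(k)}_\alpha|\le\kappa$;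 * for all $k\ge 0$ and $-g\le j\le g+1$: $|\sin\angle(E^{(k)}_j,U^{(k)}_j)|\ge c\|Q(k)\|^{-\tau}$ (no condition if one of the two spaces is zero). **Function spaces.** For $0\le a<1$ and $n\ge0$ let $C^{n+\mathrm{P_aG}}(\sqcup_\alpha I_\alpha)$ be the space of real $C^{n+1}$ functions $\varphi$ on $\bigcup_\alpha\operatorname{Int}I_\alpha$ such that $$p_a(D^n\varphi)=\max_\alpha\sup_{x\in(l_\alpha,r_\alpha)}|D^{n+1}\varphi(x)|\min\{x-l_\alpha,r_\alpha-x\}^{1+a}<\infty,$$ the limits $C^{+}_\alpha=(-1)^{n+1}\lim_{x\searrow l_\alpha}D^{n+1}\varphi(x)(x-l_\alpha)^{1+a}$ and $C^{-}_\alpha=\lim_{x\nearrow r_\alpha}D^{n+1}\varphi(x)(r_\alpha-x)^{1+a}$ exist, and $C^-_{\pi_0^{-1}(d)}C^-_{\pi_1^{-1}(d)}=0=C^+_{\pi_0^{-1}(1)}C^+_{\pi_1^{-1}(1)}$. Put $\|\varphi\|_{C^{n+\mathrm{P_a}}}=\sum_{k=0}^n\|D^k\varphi\|_{L^1(I)}+p_a(D^n\varphi)$.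 For $r=m+b$ with an integer $m\ge0$ and $0<b\le1$, $C^r(I)$ is the space of $C^m$ functions $v$ on $I$ with $\|v\|_{C^r}=\sum_{j\le m}\|D^jv\|_{\sup}+\sup_{x\ne y}\frac{|D^mv(x)-D^mv(y)|}{|x-y|^b}<\infty$. **Theorem 6.4.** Let $n\ge1$ and $0\le a<1$, and let $T$ satisfy the FFDC, with exponents $\lambda_i$ and Oseledets filtration $(E_j)$. For every $\tau>0$ fix an accelerating sequence admissible at level $\tau$, write $S_\tau(k)$, $I^{(k)}_\tau$ for the corresponding $S(k)$, $I^{(k)}$, and fix a constant $K_\tau$. Then there are constants $C_{\tau,n}>0$, depending on these data and on $a$, but not on $\varphi$, such that the following holds. Let $\varphi\in C^{n+\mathrm{P_aG}}(\sqcup_\alpha I_\alpha)$ be such that for every $\tau>0$ and all $k\ge0$ $$\|S_\tau(k)D^l\varphi\|_{\sup}\le K_\tau\,e^{(-\lambda_1(n-l-a)+\tau)k}\,\|D^l\varphi\|_{C^{n-l+\mathrm{P_a}}}\qquad(0\le l<n),$$ $$\frac1{|I_\tau^{(k)}|}\|S_\tau(k)D^n\varphi\|_{L^1(I_\tau^{(k)})}\le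 K_\tau\,e^{(\lambda_1a+\tau)k}\,\|D^n\varphi\|_{C^{0+\mathrm{P_a}}}.$$ Then there is a $C^{n-1}$ function $v:I\to\mathbb R$ with $v(0)=0$ and $\varphi=v\circ T-v$ (on $\bigcup_\alpha\operatorname{Int}I_\alpha$, and at each $l_\alpha$ with $\varphi(l_\alpha)$ understood as the right limit, which exists), such that for every $0<\tau<1-a$ we have $v\in C^{n-a-\tau}(I)$ and $\|v\|_{C^{n-a-\tau}}\le C_{\tau,n}\|\varphi\|_{C^{n+\mathrm{P_a}}}$. -/

import Mathlib

open Set Filter Topology MeasureTheory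
open scoped ENNReal

noncomputable section

/-- Combinatorial and length data `(π, λ)` of an interval exchange on the alphabet `A` with
`d = m + 1` letters.  Positions are numbered `0, …, m` instead of `1, …, d`;
`top = π₀`, `bot = π₁`, `len = λ`. -/
structure IETData (A : Type*) (m : ℕ) where
  top : A ≃ Fin (m + 1)
  bot : A ≃ Fin (m + 1)
  len : A → ℝ

namespace IETData

variable {A : Type*} [Fintype A] [DecidableEq A] {m : ℕ}

/-! ### Interval exchange transformations -/

/-- `|λ|`, so that `I = [0, |λ|)`. -/
def total (X : IETData A m) : ℝ := ∑ α, X.len α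

/-- The left end point `l_α` of `I_α`. -/
def left (X : IETData A m) (α : A) : ℝ := ∑ β with X.top β < X.top α, X.len β

/-- The right end point `r_α` of `I_α`. -/
def right (X : IETData A m) (α : A) : ℝ := ∑ β with X.top β ≤ X.top α, X.len β

/-- The matrix `Ω_π`. -/
def Omega (X : IETData A m) : Matrix A A ℝ := fun α β =>
  if X.bot β < X.bot α ∧ X.top α < X.top β then 1
  else if X.bot α < X.bot β ∧ X.top β < X.top α then -1
  else 0

/-- The translation vector `w = Ω_π λ`. -/
def trans (X : IETData A m) : A → ℝ := X.Omega.mulVec X.len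

/-- The space `H(π) = Ω_π (ℝ^A)`. -/
def H (X : IETData A m) : Submodule ℝ (A → ℝ) := LinearMap.range (Matrix.toLin' X.Omega)

/-- The interval exchange transformation: `T x = x + w_α` for `x ∈ I_α = [l_α, r_α)`
(and `T x = x` outside `I`; the `I_α` are pairwise disjoint, so the sum has at most one
nonzero term). -/
def T (X : IETData A m) (x : ℝ) : ℝ :=
  x + ∑ α, (Ico (X.left α) (X.right α)).indicator (fun _ => X.trans α) x

/-- Positive lengths and an irreducible pair of bijections:
`π₁ ∘ π₀⁻¹ {1, …, k} ≠ {1, …, k}` for `1 ≤ k < d`. -/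
def IsIET (X : IETData A m) : Prop :=
  (∀ α, 0 < X.len α) ∧
  ∀ k : ℕ, 1 ≤ k → k < m + 1 →
    (fun i => X.bot (X.top.symm i)) '' {i : Fin (m + 1) | i.val < k} ≠ {i | i.val < k}

/-- Keane's condition. -/
def Keane (X : IETData A m) : Prop :=
  ∀ j : ℕ, 1 ≤ j → ∀ α β : A, X.top β ≠ 0 → X.T^[j] (X.left α) ≠ X.left β

/-! ### Rauzy–Veech induction and the Kontsevich–Zorich cocycle -/

/-- The last letter of the top row, `π₀⁻¹(d)`. -/
def lastTop (X : IETData A m) : A := X.top.symm (Fin.last m)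

/-- The last letter of the bottom row, `π₁⁻¹(d)`. -/
def lastBot (X : IETData A m) : A := X.bot.symm (Fin.last m)

/-- One step of Rauzy–Veech induction.  If the last top letter is the longer one, the last bottom
letter is moved in the bottom row to the place right after the last top letter, otherwise the
roles of the rows are exchanged; the length of the longer letter is diminished by the length of the
shorter one.  (Under Keane's condition the two lengths are different at every step.) -/
def rauzy (X : IETData A m) : IETData A m :=
  if X.len X.lastBot < X.len X.lastTop then
    { top := X.top
      bot := X.bot.trans (Fin.cycleIcc (X.bot X.lastTop + 1) (Fin.last m))
      len := Function.update X.len X.lastTop (X.len X.lastTop - X.len X.lastBot) }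
  else
    { top := X.top.trans (Fin.cycleIcc (X.top X.lastBot + 1) (Fin.last m))
      bot := X.bot
      len := Function.update X.len X.lastBot (X.len X.lastBot - X.len X.lastTop) }

/-- The matrix `A(π, λ) = Id + E_{winner, loser}`. -/
def rauzyMatrix (X : IETData A m) : Matrix A A ℕ :=
  if X.len X.lastBot < X.len X.lastTop then 1 + Matrix.single X.lastTop X.lastBot 1
  else 1 + Matrix.single X.lastBot X.lastTop 1

/-- The cocycle `A⁽ⁿ⁾(T) = A(T) A(R T) ⋯ A(Rⁿ⁻¹ T)`. -/
def kz (X : IETData A m) : ℕ → Matrix A A ℕ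
  | 0 => 1
  | n + 1 => kz X n * (rauzy^[n] X).rauzyMatrix

/-- An accelerating sequence: increasing, starting at `0`. -/
def IsAccel (N : ℕ → ℕ) : Prop := StrictMono N ∧ N 0 = 0

/-- The data of `T⁽ᵏ⁾` along the sequence `N`. -/
def accel (X : IETData A m) (N : ℕ → ℕ) (k : ℕ) : IETData A m := rauzy^[N k] X

/-- `Q(k,l)` with its natural number entries.  `Q(k) = Q(0,k)` and `Z(k+1) = Q(k,k+1)`. -/
def Qnat (X : IETData A m) (N : ℕ → ℕ) (k l : ℕ) : Matrix A A ℕ :=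
  ((X.accel N k).kz (N l - N k)).transpose

/-- The return time `Q_α(k) = ∑_β Q_{αβ}(k)`. -/
def retTime (X : IETData A m) (N : ℕ → ℕ) (k : ℕ) (α : A) : ℕ := ∑ β, X.Qnat N 0 k α β

/-- `Q(k,l)` as a linear map of `ℝ^A`. -/
def Q (X : IETData A m) (N : ℕ → ℕ) (k l : ℕ) : (A → ℝ) →ₗ[ℝ] (A → ℝ) :=
  Matrix.toLin' ((X.Qnat N k l).map (fun q : ℕ => (q : ℝ)))

/-- The operator norm of `Q(k,l)` for the maximum norm on `ℝ^A`. -/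
def normQ (X : IETData A m) (N : ℕ → ℕ) (k l : ℕ) : ℝ :=
  ‖LinearMap.toContinuousLinearMap (X.Q N k l)‖

/-! ### The Full Filtration Diophantine Condition -/

/-- Oseledets genericity: `E` is a filtration
`0 = E₀ ⊂ E₋₁ ⊂ … ⊂ E₋g ⊂ E_{g+1} ⊂ E_g ⊂ … ⊂ E₁ = ℝ^A` with exponents
`±λ₁, …, ±λ_g` (simple) and `0`, the growth being measured along some accelerating sequence.
Here `E_{g+1}` is the central-stable space and `dim H(π) = 2g`. -/
def IsOseledets (X : IETData A m) (g : ℕ) (lam : ℕ → ℝ) (E : ℤ → Submodule ℝ (A → ℝ)) : Prop :=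
  1 ≤ g ∧ Module.finrank ℝ X.H = 2 * g ∧
  (∀ i, 1 ≤ i → i ≤ g → lam (i + 1) < lam i) ∧ lam (g + 1) = 0 ∧
  E 0 = ⊥ ∧ E 1 = ⊤ ∧ E (-(g : ℤ)) ≤ E (g + 1) ∧
  (∀ i : ℕ, 1 ≤ i → i ≤ g → E (-(i : ℤ) + 1) ≤ E (-(i : ℤ)) ∧ E ((i : ℤ) + 1) ≤ E i ∧
    Module.finrank ℝ (E (-(i : ℤ))) = Module.finrank ℝ (E (-(i : ℤ) + 1)) + 1 ∧
    Module.finrank ℝ (E i) = Module.finrank ℝ (E ((i : ℤ) + 1)) + 1) ∧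
  ∃ N : ℕ → ℕ, IsAccel N ∧
    (∀ i : ℕ, 1 ≤ i → i ≤ g →
      (∀ h ∈ E (-(i : ℤ)), h ∉ E (-(i : ℤ) + 1) →
        Tendsto (fun k : ℕ => Real.log ‖X.Q N 0 k h‖ / k) atTop (𝓝 (-lam i))) ∧
      (∀ h ∈ E i, h ∉ E ((i : ℤ) + 1) →
        Tendsto (fun k : ℕ => Real.log ‖X.Q N 0 k h‖ / k) atTop (𝓝 (lam i)))) ∧
    (∀ h ∈ E (g + 1), h ∉ E (-(g : ℤ)) →
      Tendsto (fun k : ℕ => Real.log ‖X.Q N 0 k h‖ / k) atTop (𝓝 0))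

/-- A filtration `0 = U₁ ⊂ U₂ ⊂ … ⊂ U_{g+1} ⊂ U₋g ⊂ … ⊂ U₋₁ ⊂ U₀ = ℝ^A` complementary to `E`. -/
def IsComplementary (X : IETData A m) (g : ℕ) (E U : ℤ → Submodule ℝ (A → ℝ)) : Prop :=
  U 1 = ⊥ ∧ U 0 = ⊤ ∧ U (g + 1) ≤ U (-(g : ℤ)) ∧
  (∀ i : ℕ, 1 ≤ i → i ≤ g → U i ≤ U ((i : ℤ) + 1) ∧ U (-(i : ℤ)) ≤ U (-(i : ℤ) + 1)) ∧
  U (g + 1) ≤ X.H ∧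
  ∀ j : ℤ, -(g : ℤ) ≤ j → j ≤ g + 1 → IsCompl (E j) (U j)

/-- The Rokhlin tower condition along `N`. -/
def RTC (X : IETData A m) (N : ℕ → ℕ) : Prop :=
  ∃ δ : ℝ, 0 < δ ∧ δ < 1 ∧ ∀ k : ℕ, 1 ≤ k → ∃ p : ℕ, 0 < p ∧ (∀ α, p ≤ X.retTime N k α) ∧
    (∀ i < p, (X.T^[i] '' Ico 0 (X.accel N k).total).OrdConnected) ∧
    (∀ i < p, ∀ j < p, i ≠ j →
      Disjoint (X.T^[i] '' Ico 0 (X.accel N k).total) (X.T^[j] '' Ico 0 (X.accel N k).total)) ∧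
    ENNReal.ofReal (δ * X.total) ≤
      volume (⋃ i ∈ Finset.range p, X.T^[i] '' Ico 0 (X.accel N k).total)

/-- `r(k,l) = ∑_{k ≤ j < l} r_j`. -/
def rsum (r : ℕ → ℕ) (k l : ℕ) : ℝ := ∑ j ∈ Finset.Ico k l, (r j : ℝ)

/-- The accelerating sequence `N` satisfies the requirements of the Full Filtration Diophantine
Condition at the level `τ`.  A bound `‖Q|_{E⁽ᵏ⁾}(k,l)‖ ≤ c` of the norm of a restriction is written
`‖Q(k,l) h‖ ≤ c ‖h‖` for `h ∈ E⁽ᵏ⁾ = Q(k) E`, and `‖(Q|_{U⁽ᵏ⁾}(k,l))⁻¹‖ ≤ c` is written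
`‖h‖ ≤ c ‖Q(k,l) h‖` for `h ∈ U⁽ᵏ⁾ = Q(k) U`. -/
def IsFFDCAccel (X : IETData A m) (g : ℕ) (lam : ℕ → ℝ) (E : ℤ → Submodule ℝ (A → ℝ))
    (τ : ℝ) (N : ℕ → ℕ) : Prop :=
  IsAccel N ∧ X.RTC N ∧
  ∃ (C κ c : ℝ) (r : ℕ → ℕ) (U : ℤ → Submodule ℝ (A → ℝ)),
    1 ≤ C ∧ 1 ≤ κ ∧ 0 < c ∧ r 0 = 0 ∧ X.IsComplementary g E U ∧
    (∃ ρ : ℝ, 1 < ρ ∧ ρ < 1 + τ ∧ Tendsto (fun k : ℕ => rsum r 0 k / k) atTop (𝓝 ρ)) ∧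
    (∀ k l : ℕ, k < l → ∀ j : ℕ, 1 ≤ j → j ≤ g + 1 → ∀ h ∈ (E j).map (X.Q N 0 k),
      ‖X.Q N k l h‖ ≤ C * Real.exp ((lam j + τ) * rsum r k l) * ‖h‖) ∧
    (∀ k l : ℕ, k < l → ∀ j : ℕ, 1 ≤ j → j ≤ g → ∀ h ∈ (E (-(j : ℤ))).map (X.Q N 0 k),
      ‖X.Q N k l h‖ ≤ C * Real.exp ((-lam j + τ) * rsum r k l) * ‖h‖) ∧
    (∀ k l : ℕ, k < l → ∀ j : ℕ, 2 ≤ j → j ≤ g + 1 → ∀ h ∈ (U j).map (X.Q N 0 k),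
      ‖h‖ ≤ C * Real.exp ((-lam (j - 1) + τ) * rsum r k l) * ‖X.Q N k l h‖) ∧
    (∀ k l : ℕ, k < l → ∀ j : ℕ, j ≤ g → ∀ h ∈ (U (-(j : ℤ))).map (X.Q N 0 k),
      ‖h‖ ≤ C * Real.exp ((lam (j + 1) + τ) * rsum r k l) * ‖X.Q N k l h‖) ∧
    (∀ k : ℕ, X.normQ N k (k + 1) ≤ C * Real.exp (τ * k)) ∧
    (∀ k : ℕ, C⁻¹ * Real.exp (lam 1 * k) ≤ X.normQ N 0 k ∧
      X.normQ N 0 k ≤ C * Real.exp (lam 1 * (1 + τ) * k)) ∧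
    (∀ k : ℕ, ∀ α, (X.accel N k).total / (X.accel N k).len α ≤ κ) ∧
    (∀ k : ℕ, ∀ j : ℤ, -(g : ℤ) ≤ j → j ≤ g + 1 →
      ∀ e ∈ (E j).map (X.Q N 0 k), ∀ u ∈ (U j).map (X.Q N 0 k), e ≠ 0 → u ≠ 0 →
        c * X.normQ N 0 k ^ (-τ) ≤ Real.sin (InnerProductGeometry.angle
          (WithLp.toLp 2 e : EuclideanSpace ℝ A) (WithLp.toLp 2 u : EuclideanSpace ℝ A)))

/-- The Full Filtration Diophantine Condition, with exponents `lam` and Oseledets filtration `E`. -/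
def FFDC (X : IETData A m) (g : ℕ) (lam : ℕ → ℝ) (E : ℤ → Submodule ℝ (A → ℝ)) : Prop :=
  X.IsIET ∧ X.Keane ∧ X.IsOseledets g lam E ∧ ∀ τ : ℝ, 0 < τ → ∃ N, X.IsFFDCAccel g lam E τ N

/-! ### Functions with polynomial or logarithmic singularities

A function on `⋃_α Int I_α` is a function `φ : ℝ → ℝ` of which only the values on the open intervals
`Int I_α = (l_α, r_α)` are used; there `Dˡ φ = iteratedDeriv l φ`.  Norms take values in `[0, ∞]`. -/

/-- `p_a(ψ) = max_α sup_{x ∈ Int I_α} |ψ'(x)| min (x - l_α, r_α - x) ^ (1 + a)`. -/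
def pa (X : IETData A m) (a : ℝ) (ψ : ℝ → ℝ) : ℝ≥0∞ :=
  ⨆ α, ⨆ x ∈ Ioo (X.left α) (X.right α),
    ‖deriv ψ x‖ₑ * ENNReal.ofReal (min (x - X.left α) (X.right α - x) ^ (1 + a))

/-- The norm `∑_{k ≤ n} ‖Dᵏ φ‖_{L¹(I)} + p_a(Dⁿ φ)` of `C^{n + P_a}`. -/
def paNorm (X : IETData A m) (n : ℕ) (a : ℝ) (φ : ℝ → ℝ) : ℝ≥0∞ :=
  ∑ k ∈ Finset.range (n + 1), (∫⁻ x in Ico 0 X.total, ‖iteratedDeriv k φ x‖ₑ) +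
    X.pa a (iteratedDeriv n φ)

/-- Membership in `C^{n + P_a G}(⊔ I_α)`; `cp α`, `cm α` are the constants `C_{α,n}^{a,±}(φ)`, and
the last two conditions say that `φ` is of geometric type. -/
def MemPaG (X : IETData A m) (n : ℕ) (a : ℝ) (φ : ℝ → ℝ) : Prop :=
  ContDiffOn ℝ ((n + 1 : ℕ) : WithTop ℕ∞) φ (⋃ α, Ioo (X.left α) (X.right α)) ∧
  X.pa a (iteratedDeriv n φ) < ∞ ∧
  ∃ cp cm : A → ℝ,
    (∀ α, Tendsto
      (fun x => (-1) ^ (n + 1) * (iteratedDeriv (n + 1) φ x * (x - X.left α) ^ (1 + a)))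
      (𝓝[>] X.left α) (𝓝 (cp α))) ∧
    (∀ α, Tendsto (fun x => iteratedDeriv (n + 1) φ x * (X.right α - x) ^ (1 + a))
      (𝓝[<] X.right α) (𝓝 (cm α))) ∧
    cm X.lastTop * cm X.lastBot = 0 ∧ cp (X.top.symm 0) * cp (X.bot.symm 0) = 0

/-! ### Special Birkhoff sums -/

/-- `S(k) ψ (x) = ∑_{0 ≤ i < Q_α(k)} ψ(Tⁱ x)` for `x ∈ I_α⁽ᵏ⁾` (and `0` outside `I⁽ᵏ⁾`). -/
def S (X : IETData A m) (N : ℕ → ℕ) (k : ℕ) (ψ : ℝ → ℝ) (x : ℝ) : ℝ :=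
  ∑ α, (Ico ((X.accel N k).left α) ((X.accel N k).right α)).indicator
    (fun y => ∑ i ∈ Finset.range (X.retTime N k α), ψ (X.T^[i] y)) x

/-- The supremum norm of `S(k) ψ`, over the open intervals `Int I_α⁽ᵏ⁾`: the points
`Tⁱ x`, `0 ≤ i < Q_α(k)`, of their orbits lie in the open intervals `Int I_β`. -/
def supS (X : IETData A m) (N : ℕ → ℕ) (k : ℕ) (ψ : ℝ → ℝ) : ℝ≥0∞ :=
  ⨆ α, ⨆ x ∈ Ioo ((X.accel N k).left α) ((X.accel N k).right α), ‖X.S N k ψ x‖ₑ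

/-- The normalized norm `‖S(k) ψ‖_{L¹(I⁽ᵏ⁾)} / |I⁽ᵏ⁾|`. -/
def meanS (X : IETData A m) (N : ℕ → ℕ) (k : ℕ) (ψ : ℝ → ℝ) : ℝ≥0∞ :=
  (∫⁻ x in Ico 0 (X.accel N k).total, ‖X.S N k ψ x‖ₑ) / ENNReal.ofReal (X.accel N k).total

/-! ### Hölder spaces -/

/-- The integer part `m` in `r = m + b` with `0 < b ≤ 1` (for `r > 0`). -/
def holderInt (r : ℝ) : ℕ := ⌈r⌉₊ - 1

/-- The norm of `C^r(I)`, `r = m + b`, `0 < b ≤ 1`: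
`∑_{j ≤ m} ‖Dʲ v‖_sup` plus the `b`-Hölder seminorm of `Dᵐ v`, on `I = [0, |I|)`. -/
def holderNorm (X : IETData A m) (r : ℝ) (v : ℝ → ℝ) : ℝ≥0∞ :=
  ∑ j ∈ Finset.range (holderInt r + 1),
      (⨆ x ∈ Ico 0 X.total, ‖iteratedDerivWithin j v (Ico 0 X.total) x‖ₑ) +
    ⨆ x ∈ Ico 0 X.total, ⨆ y ∈ Ico 0 X.total,
      ‖iteratedDerivWithin (holderInt r) v (Ico 0 X.total) x -
          iteratedDerivWithin (holderInt r) v (Ico 0 X.total) y‖ₑ /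
        edist x y ^ (r - holderInt r)

/-- Membership in `C^r(I)`. -/
def MemHolder (X : IETData A m) (r : ℝ) (v : ℝ → ℝ) : Prop :=
  ContDiffOn ℝ (holderInt r : WithTop ℕ∞) v (Ico 0 X.total) ∧ X.holderNorm r v < ∞

end IETData

end

open Set Filter Topology MeasureTheory
open scoped ENNReal

noncomputable section

set_option linter.unusedSectionVars false

/-! The solution is a limit of partial Birkhoff sums over Rokhlin towers. The floors `T^i I_α^(k)`,
`0 ≤ i < Q_α(k)`, fill `I`, and `towerSum` of level `k` sends the point `T^i y`, with `y` in the
base, to the Birkhoff sum along the orbit from `y` up to it. A floor of level `k + 1` lies in a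
floor of level `k`, and there the two tower sums differ by at most `‖Z(k+1)‖` special Birkhoff sums
of level `k`. These decay exponentially, while `‖Z(k+1)‖` grows at an arbitrarily small rate, so the
tower sums converge uniformly to some `v`. They satisfy the cohomological equation except on the top
floors, where the error is one full special sum (`abs_towerSum_succ_sub_le`, `exists_solution`).
Tower sums vanish on the base, so `v` is exponentially small on `I^(k)`. By Keane's condition, near
each nonzero point either the way back to the base or the way forward to the next return is a local
translation; this transports the smallness and yields continuity (`solution_eventually_close`).

For regularity the construction is applied to every `D^l φ`, `l < n`, giving `v_l`. An interval
shorter than all bases of level `k` meets at most two floors (`Tower.abs_sub_le_of_floor`). If `l +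
1 < n`, the error of the tower sums for `v_l` is of smaller order than the scale of the next level,
so the mean value theorem on the floors gives `v_l' = v_{l+1}` (`hasDerivWithinAt_of_floor`).

For the Hölder bound on `v_{n-1}`, note that `D^{n+1} φ` is at most of the order of distance to the
power `-1 - b`, where `b = a + τ/2`. Orbit points in one tower are separated, so the special sums of
`D^{n+1} φ` have the same kind of singularity with a constant independent of `k`
(`Tower.abs_birkhoffSum_le`). Two integrations, with the constant controlled by the sup bound on the
special sums of `D^{n-1} φ`, give `(1 - b)`-Hölder bounds on the floors that grow slowly with `k`
(`holder_special`, `exists_floor_const`). Choosing `k` according to the distance of the two points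
turns the remaining `τ/2` into a true Hölder bound of exponent `1 - a - τ` (`holder_of_floor`).

Different `τ` use different accelerating sequences. Solutions tending to `0` on shrinking bases are
unique (`eq_of_solutions`), so a single `v` serves all `τ`. -/

namespace IETData

/-! ### Partitions of an interval by an ordered alphabet -/

section Partition

variable {A : Type*} [Fintype A] {m : ℕ}

/-- The left end point of the interval of `α` when intervals of lengths `len` are placed in the
order prescribed by `e`. -/
def placeLeft (e : A ≃ Fin (m + 1)) (len : A → ℝ) (α : A) : ℝ := ∑ β with e β < e α, len β

variable {e : A ≃ Fin (m + 1)} {len : A → ℝ}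

theorem placeLeft_nonneg (h : ∀ α, 0 < len α) (α : A) : 0 ≤ placeLeft e len α :=
  Finset.sum_nonneg fun β _ => (h β).le

theorem placeLeft_add (e : A ≃ Fin (m + 1)) (len : A → ℝ) (α : A) :
    placeLeft e len α + len α = ∑ β with e β ≤ e α, len β := by
  classical
  have : (Finset.univ.filter fun β => e β ≤ e α) =
      insert α (Finset.univ.filter fun β => e β < e α) := by
    ext β
    simp [le_iff_eq_or_lt]
  rw [this, Finset.sum_insert (by simp), placeLeft, add_comm]

theorem placeLeft_add_le (h : ∀ α, 0 < len α) {α β : A} (hab : e α < e β) :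
    placeLeft e len α + len α ≤ placeLeft e len β := by
  rw [placeLeft_add]
  refine Finset.sum_le_sum_of_subset_of_nonneg ?_ fun γ _ _ => (h γ).le
  intro γ hγ
  simp only [Finset.mem_filter, Finset.mem_univ, true_and] at hγ ⊢
  exact hγ.trans_lt hab

theorem placeLeft_add_le_total (h : ∀ α, 0 < len α) (α : A) :
    placeLeft e len α + len α ≤ ∑ β, len β := by
  rw [placeLeft_add]
  exact Finset.sum_le_sum_of_subset_of_nonneg (Finset.filter_subset _ _) fun γ _ _ => (h γ).le

theorem placeLeft_last {α : A} (hα : e α = Fin.last m) :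
    placeLeft e len α + len α = ∑ β, len β := by
  rw [placeLeft_add]
  congr 1
  ext β
  simp [hα, Fin.le_last]

theorem placeLeft_zero {α : A} (hα : e α = 0) : placeLeft e len α = 0 := by
  simp [placeLeft, hα]

theorem exists_mem_place {x : ℝ} (hx0 : 0 ≤ x) (hx : x < ∑ β, len β) :
    ∃ α, placeLeft e len α ≤ x ∧ x < placeLeft e len α + len α := by
  -- The candidate is the last letter whose interval starts at or before `x`.
  obtain ⟨α, hα, hmax⟩ := Finset.exists_max_image
    (Finset.univ.filter fun α => placeLeft e len α ≤ x) e
    ⟨e.symm 0, by simpa [placeLeft_zero (e := e) (len := len) (e.apply_symm_apply 0)] using hx0⟩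
  simp only [Finset.mem_filter, Finset.mem_univ, true_and] at hα hmax
  refine ⟨α, hα, ?_⟩
  by_contra! hcon
  by_cases hl : e α = Fin.last m
  · rw [placeLeft_last hl] at hcon
    linarith
  -- `β` is the immediate successor of `α`; its interval starts where that of `α` ends,
  -- contradicting maximality of `α`.
  · obtain ⟨β, hβ, hmin⟩ := Finset.exists_min_image
      (Finset.univ.filter fun β => e α < e β) e
      ⟨e.symm (Fin.last m), by simpa using lt_of_le_of_ne (Fin.le_last _) hl⟩
    simp only [Finset.mem_filter, Finset.mem_univ, true_and] at hβ hmin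
    have : placeLeft e len β = placeLeft e len α + len α := by
      rw [placeLeft_add]
      unfold placeLeft
      congr 1
      ext γ
      simp only [Finset.mem_filter, Finset.mem_univ, true_and]
      constructor
      · intro h
        by_contra! h'
        exact absurd (hmin γ h') (not_le.2 h)
      · intro h
        exact h.trans_lt hβ
    exact absurd (hmax β (this ▸ hcon)) (not_le.2 hβ)

theorem place_unique (h : ∀ α, 0 < len α) {α β : A} {x : ℝ}
    (h1 : placeLeft e len α ≤ x) (h2 : x < placeLeft e len α + len α)
    (h3 : placeLeft e len β ≤ x) (h4 : x < placeLeft e len β + len β) : α = β := by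
  by_contra hne
  rcases lt_or_gt_of_ne (e.injective.ne hne) with hlt | hlt
  · linarith [placeLeft_add_le h hlt]
  · linarith [placeLeft_add_le h hlt]

end Partition

/-! ### Basic properties of interval exchanges -/

variable {A : Type*} [Fintype A] [DecidableEq A] {m : ℕ}

/-- The exchanged interval `I_α`. -/
def J (X : IETData A m) (α : A) : Set ℝ := Ico (X.left α) (X.right α)

/-- The left end point of `T I_α`. -/
def botLeft (X : IETData A m) (α : A) : ℝ := placeLeft X.bot X.len α

theorem right_eq (X : IETData A m) (α : A) : X.right α = X.left α + X.len α :=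
  (placeLeft_add X.top X.len α).symm

theorem mem_J {X : IETData A m} {α : A} {x : ℝ} : x ∈ X.J α ↔ X.left α ≤ x ∧ x < X.right α :=
  Iff.rfl

/-- The entry of `Ω_π` at `(α, β)` is the indicator of `β` preceding `α` in the bottom row minus
that in the top row. -/
theorem trans_eq (X : IETData A m) (α : A) : X.trans α = X.botLeft α - X.left α := by
  unfold trans Matrix.mulVec dotProduct botLeft placeLeft left Omega
  rw [Finset.sum_filter, Finset.sum_filter, ← Finset.sum_sub_distrib]
  refine Finset.sum_congr rfl fun β _ => ?_
  rcases eq_or_ne α β with rfl | hne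
  · simp
  · have ht := X.top.injective.ne hne
    have hb := X.bot.injective.ne hne
    rcases lt_or_gt_of_ne ht with h1 | h1 <;> rcases lt_or_gt_of_ne hb with h2 | h2 <;>
      simp [h1, h2, h1.not_gt, h2.not_gt]

section Pos

variable {X : IETData A m}

theorem left_nonneg (hp : ∀ α, 0 < X.len α) (α : A) : 0 ≤ X.left α := placeLeft_nonneg hp α

theorem left_lt_right (hp : ∀ α, 0 < X.len α) (α : A) : X.left α < X.right α := by
  rw [right_eq]; linarith [hp α]

theorem right_le_total (hp : ∀ α, 0 < X.len α) (α : A) : X.right α ≤ X.total := by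
  rw [right_eq]; exact placeLeft_add_le_total hp α

theorem total_pos [Nonempty A] (hp : ∀ α, 0 < X.len α) : 0 < X.total :=
  Finset.sum_pos (fun β _ => hp β) Finset.univ_nonempty

theorem J_subset (hp : ∀ α, 0 < X.len α) (α : A) : X.J α ⊆ Ico 0 X.total := fun _ hx =>
  ⟨(left_nonneg hp α).trans hx.1, hx.2.trans_le (right_le_total hp α)⟩

theorem left_mem_J (hp : ∀ α, 0 < X.len α) (α : A) : X.left α ∈ X.J α := ⟨le_rfl, left_lt_right hp α⟩

theorem J_unique (hp : ∀ α, 0 < X.len α) {α β : A} {x : ℝ} (h1 : x ∈ X.J α) (h2 : x ∈ X.J β) : α = β := by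
  rw [mem_J, right_eq] at h1 h2
  exact place_unique hp h1.1 h1.2 h2.1 h2.2

theorem exists_mem_J {x : ℝ} (hx : x ∈ Ico 0 X.total) : ∃ α, x ∈ X.J α := by
  obtain ⟨α, h1, h2⟩ := exists_mem_place (e := X.top) hx.1 hx.2
  exact ⟨α, h1, by rw [right_eq]; exact h2⟩

theorem T_eq (hp : ∀ α, 0 < X.len α) {α : A} {x : ℝ} (hx : x ∈ X.J α) : X.T x = x + X.trans α := by
  unfold T
  rw [Finset.sum_eq_single α]
  · rw [indicator_of_mem (show x ∈ Ico (X.left α) (X.right α) from hx)]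
  · intro β _ hβ
    rw [indicator_of_notMem]
    intro h
    exact hβ (J_unique hp h hx)
  · simp

theorem T_eq' (hp : ∀ α, 0 < X.len α) {α : A} {x : ℝ} (hx : x ∈ X.J α) : X.T x = x - X.left α + X.botLeft α := by
  rw [T_eq hp hx, trans_eq]; ring

theorem T_mem (hp : ∀ α, 0 < X.len α) {x : ℝ} (hx : x ∈ Ico 0 X.total) : X.T x ∈ Ico 0 X.total := by
  obtain ⟨α, hα⟩ := exists_mem_J hx
  rw [T_eq' hp hα]
  have h1 : 0 ≤ X.botLeft α := placeLeft_nonneg hp α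
  have h2 : X.botLeft α + X.len α ≤ X.total := placeLeft_add_le_total hp α
  rw [mem_J, right_eq] at hα
  constructor <;> linarith [hα.1, hα.2]

theorem iterate_T_mem (hp : ∀ α, 0 < X.len α) {x : ℝ} (hx : x ∈ Ico 0 X.total) (i : ℕ) : X.T^[i] x ∈ Ico 0 X.total := by
  induction i with
  | zero => exact hx
  | succ i ih => rw [Function.iterate_succ_apply']; exact T_mem hp ih

/-- The images of the exchanged intervals are the intervals placed in the bottom order, which are
again disjoint; so a common image forces a common letter. -/
theorem T_injOn (hp : ∀ α, 0 < X.len α) : InjOn X.T (Ico 0 X.total) := by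
  intro x hx y hy hxy
  obtain ⟨α, hα⟩ := exists_mem_J hx
  obtain ⟨β, hβ⟩ := exists_mem_J hy
  have h1 := T_eq' hp hα
  have h2 := T_eq' hp hβ
  have hab : α = β := by
    have hα' := hα
    have hβ' := hβ
    rw [mem_J, right_eq] at hα' hβ'
    refine place_unique (e := X.bot) hp (x := X.T x) ?_ ?_ ?_ ?_
    · change X.botLeft α ≤ _; linarith
    · change _ < X.botLeft α + _; linarith
    · change X.botLeft β ≤ _; linarith
    · change _ < X.botLeft β + _; linarith
  subst hab
  linarith

theorem iterate_T_inj (hp : ∀ α, 0 < X.len α) {x y : ℝ} (hx : x ∈ Ico 0 X.total) (hy : y ∈ Ico 0 X.total) {i : ℕ}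
    (h : X.T^[i] x = X.T^[i] y) : x = y := by
  induction i with
  | zero => exact h
  | succ i ih =>
    rw [Function.iterate_succ_apply', Function.iterate_succ_apply'] at h
    exact ih (T_injOn hp (iterate_T_mem hp hx i) (iterate_T_mem hp hy i) h)

theorem left_first {α : A} (h : X.top α = 0) : X.left α = 0 := placeLeft_zero h

end Pos

/-- With a single letter `Ω_π` is zero and cannot have rank `2g`. Two letters are needed for Rauzy
induction to make sense. -/
theorem one_le_of_finrank {X : IETData A m} {g : ℕ} (hg : 1 ≤ g)
    (h : Module.finrank ℝ X.H = 2 * g) : 1 ≤ m := by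
  by_contra! hm
  obtain rfl : m = 0 := by omega
  have hO : X.Omega = 0 := by
    ext α β
    have h1 : X.top α = X.top β := Fin.ext (by omega)
    have h2 : X.bot α = X.bot β := Fin.ext (by omega)
    simp [Omega, h1, h2]
  have : X.H = ⊥ := by simp [H, hO]
  rw [this, finrank_bot] at h
  omega

end IETData

/-! ### First return towers and their composition -/

/-- An index below a finite sum of natural numbers lies in one of the blocks. -/
theorem Nat.exists_block (q : ℕ → ℕ) {p t : ℕ} (ht : t < ∑ j ∈ Finset.range p, q j) :
    ∃ j < p, ∃ s < q j, t = ∑ i ∈ Finset.range j, q i + s := by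
  induction p with
  | zero => simp at ht
  | succ p ih =>
    by_cases h : t < ∑ j ∈ Finset.range p, q j
    · obtain ⟨j, hj, s, hs, rfl⟩ := ih h
      exact ⟨j, by omega, s, hs, rfl⟩
    · rw [Finset.sum_range_succ] at ht
      exact ⟨p, by omega, t - ∑ j ∈ Finset.range p, q j, by omega, by omega⟩

theorem Nat.sum_range_le_of_lt (q : ℕ → ℕ) {j p s : ℕ} (hj : j < p) (hs : s ≤ q j) :
    ∑ i ∈ Finset.range j, q i + s ≤ ∑ i ∈ Finset.range p, q i := by
  have h1 : ∑ i ∈ Finset.range (j + 1), q i ≤ ∑ i ∈ Finset.range p, q i :=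
    Finset.sum_le_sum_of_subset (Finset.range_mono (by omega))
  rw [Finset.sum_range_succ] at h1
  omega

namespace IETData

variable {A : Type*} [Fintype A] [DecidableEq A] {m : ℕ}

/-- `Y` is the first return map of `X` to the interval `[0, |Y|)`, with return times `q`, and the
floors of the towers over the exchanged intervals of `Y` are translated into the exchanged
intervals of `X`. -/
structure Tower (X Y : IETData A m) (q : A → ℕ) : Prop where
  pos_base : ∀ α, 0 < X.len α
  pos : ∀ α, 0 < Y.len α
  height_pos : ∀ α, 0 < q α
  total_le : Y.total ≤ X.total
  transl : ∀ α, ∀ i < q α, ∃ β c, ∀ x ∈ Y.J α, X.T^[i] x = x + c ∧ x + c ∈ X.J β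
  ret : ∀ α, ∀ x ∈ Y.J α, X.T^[q α] x = Y.T x
  not_mem : ∀ α, ∀ x ∈ Y.J α, ∀ i, 0 < i → i < q α → X.T^[i] x ∉ Ico 0 Y.total
  cover : ∀ x ∈ Ico 0 X.total, ∃ α, ∃ y ∈ Y.J α, ∃ i < q α, X.T^[i] y = x
  sing : ∀ α, ∃ e < q α, X.T^[e] (Y.left α) = X.left α
  top_zero : ∀ α, X.top α = 0 → Y.top α = 0

namespace Tower

variable {X Y Z : IETData A m} {q p Q : A → ℕ}

theorem refl (hp : ∀ α, 0 < X.len α) : Tower X X (fun _ => 1) where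
  pos_base := hp
  pos := hp
  height_pos _ := one_pos
  total_le := le_rfl
  transl α i hi := by
    obtain rfl : i = 0 := by omega
    exact ⟨α, 0, fun x hx => by simpa using hx⟩
  ret α x hx := rfl
  not_mem α x hx i h1 h2 := by omega
  cover x hx := by
    obtain ⟨α, hα⟩ := exists_mem_J hx
    exact ⟨α, x, hα, 0, one_pos, rfl⟩
  sing α := ⟨0, one_pos, rfl⟩
  top_zero _ h := h

theorem mem_base (h : Tower X Y q) {α : A} {x : ℝ} (hx : x ∈ Y.J α) : x ∈ Ico 0 X.total :=
  ⟨(J_subset h.pos α hx).1, (J_subset h.pos α hx).2.trans_le h.total_le⟩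

/-- Cancelling the smaller number of iterates by injectivity would leave a point of the base that
returns before its return time, unless the two numbers agree. -/
theorem floor_unique (h : Tower X Y q) {α β : A} {x y : ℝ} (hx : x ∈ Y.J α) (hy : y ∈ Y.J β)
    {i j : ℕ} (hi : i < q α) (hj : j < q β) (hxy : X.T^[i] x = X.T^[j] y) :
    α = β ∧ i = j ∧ x = y := by
  have key : ∀ {α β : A} {x y : ℝ}, x ∈ Y.J α → y ∈ Y.J β → ∀ {i j : ℕ}, i ≤ j → j < q β →
      X.T^[i] x = X.T^[j] y → i = j := by
    intro α β x y hx hy i j hij hj hxy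
    obtain ⟨k, rfl⟩ := Nat.exists_eq_add_of_le hij
    rw [Function.iterate_add_apply] at hxy
    have h1 := iterate_T_inj h.pos_base (h.mem_base hx)
      (iterate_T_mem h.pos_base (h.mem_base hy) k) hxy
    by_contra hne
    exact h.not_mem β y hy k (by omega) (by omega) (h1 ▸ J_subset h.pos α hx)
  have hij : i = j := by
    rcases le_total i j with hle | hle
    · exact key hx hy hle hj hxy
    · exact (key hy hx hle hi hxy.symm).symm
  subst hij
  have hxy' := iterate_T_inj h.pos_base (h.mem_base hx) (h.mem_base hy) hxy
  subst hxy'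
  exact ⟨J_unique h.pos hx hy, rfl, rfl⟩

/-- Both heights are first return times. This identifies the heights `Q_α(k+1)` with those of a
composed tower without any computation with matrices. -/
theorem height_unique (h : Tower X Y q) (h' : Tower X Y p) : q = p := by
  have key : ∀ {q p : A → ℕ}, Tower X Y q → Tower X Y p → ∀ α, p α ≤ q α := by
    intro q p h h' α
    by_contra! hlt
    have hmem := left_mem_J h.pos α
    refine h'.not_mem α _ hmem (q α) (h.height_pos α) hlt ?_
    rw [h.ret α _ hmem]
    exact T_mem h.pos (J_subset h.pos α hmem)
  exact funext fun α => le_antisymm (key h' h α) (key h h' α)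

/-- The exchanged intervals visited by the tower over the interval of `α`. -/
theorem exists_letters (h : Tower X Y q) :
    ∃ w : A → ℕ → A, ∀ α, ∀ i < q α, ∀ x ∈ Y.J α, X.T^[i] x ∈ X.J (w α i) := by
  classical
  have : ∀ α i, ∃ β, i < q α → ∀ x ∈ Y.J α, X.T^[i] x ∈ X.J β := by
    intro α i
    by_cases hi : i < q α
    · obtain ⟨β, c, hc⟩ := h.transl α i hi
      exact ⟨β, fun _ x hx => by rw [(hc x hx).1]; exact (hc x hx).2⟩
    · exact ⟨α, fun h => absurd h hi⟩
  choose w hw using this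
  exact ⟨w, hw⟩

variable {w : A → ℕ → A}

/-- Each step of the induced map is a block of `q` steps of the original map, with `q` read off from
the letter being visited. -/
theorem iterate_block (h : Tower X Y q)
    (hw : ∀ α, ∀ j < p α, ∀ x ∈ Z.J α, Y.T^[j] x ∈ Y.J (w α j)) {α : A} {x : ℝ}
    (hx : x ∈ Z.J α) {j : ℕ} (hj : j ≤ p α) :
    X.T^[∑ i ∈ Finset.range j, q (w α i)] x = Y.T^[j] x := by
  induction j with
  | zero => rfl
  | succ j ih =>
    rw [Finset.sum_range_succ, add_comm, Function.iterate_add_apply, ih (by omega),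
      h.ret _ _ (hw α j hj x hx), Function.iterate_succ_apply']

theorem birkhoffSum_block (h : Tower X Y q)
    (hw : ∀ α, ∀ j < p α, ∀ x ∈ Z.J α, Y.T^[j] x ∈ Y.J (w α j)) {α : A} {x : ℝ}
    (hx : x ∈ Z.J α) {j : ℕ} (hj : j ≤ p α) (f : ℝ → ℝ) :
    birkhoffSum X.T f (∑ i ∈ Finset.range j, q (w α i)) x =
      ∑ i ∈ Finset.range j, birkhoffSum X.T f (q (w α i)) (Y.T^[i] x) := by
  induction j with
  | zero => simp
  | succ j ih =>
    rw [Finset.sum_range_succ, birkhoffSum_add, ih (by omega), h.iterate_block hw hx (by omega),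
      Finset.sum_range_succ]

/-- Every time below the new height is a number of full blocks plus a remainder inside the current
block, and each field follows by treating the blocks with `h'` and the remainder with `h`. -/
theorem comp (h : Tower X Y q) (h' : Tower Y Z p)
    (hw : ∀ α, ∀ j < p α, ∀ x ∈ Z.J α, Y.T^[j] x ∈ Y.J (w α j)) :
    Tower X Z (fun α => ∑ j ∈ Finset.range (p α), q (w α j)) where
  pos_base := h.pos_base
  pos := h'.pos
  height_pos α := by
    have := Nat.sum_range_le_of_lt (fun j => q (w α j)) (h'.height_pos α) (h.height_pos _)
    simp only [Finset.range_zero, Finset.sum_empty] at this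
    omega
  total_le := h'.total_le.trans h.total_le
  transl α i hi := by
    obtain ⟨j, hj, s, hs, rfl⟩ := Nat.exists_block _ hi
    obtain ⟨β, c, hc⟩ := h.transl _ s hs
    obtain ⟨γ, d, hd⟩ := h'.transl α j hj
    refine ⟨β, d + c, fun x hx => ?_⟩
    have h1 := hw α j hj x hx
    rw [(hd x hx).1] at h1
    rw [add_comm, Function.iterate_add_apply, h.iterate_block hw hx hj.le, (hd x hx).1,
      (hc _ h1).1, ← add_assoc]
    exact ⟨rfl, (hc _ h1).2⟩
  ret α x hx := by rw [h.iterate_block hw hx le_rfl, h'.ret α x hx]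
  not_mem α x hx i h0 hi := by
    obtain ⟨j, hj, s, hs, rfl⟩ := Nat.exists_block _ hi
    rw [add_comm, Function.iterate_add_apply, h.iterate_block hw hx hj.le]
    rcases Nat.eq_zero_or_pos s with rfl | hs0
    · refine h'.not_mem α x hx j ?_ hj
      rcases Nat.eq_zero_or_pos j with rfl | hj0
      · simp at h0
      · exact hj0
    -- A positive remainder lies strictly inside a tower over `Y`, outside the base of `Y` and hence
    -- outside the smaller base of `Z`.
    · intro hmem
      exact h.not_mem _ _ (hw α j hj x hx) s hs0 hs ⟨hmem.1, hmem.2.trans_le h'.total_le⟩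
  cover x hx := by
    obtain ⟨β, y, hy, s, hs, rfl⟩ := h.cover x hx
    obtain ⟨α, z, hz, j, hj, rfl⟩ := h'.cover y (J_subset h.pos β hy)
    have hβ : β = w α j := J_unique h.pos hy (hw α j hj z hz)
    subst hβ
    refine ⟨α, z, hz, ∑ i ∈ Finset.range j, q (w α i) + s, ?_, ?_⟩
    · exact lt_of_lt_of_le (Nat.lt_succ_self _)
        (Nat.sum_range_le_of_lt (fun i => q (w α i)) hj (Nat.succ_le_of_lt hs))
    · rw [add_comm, Function.iterate_add_apply, h.iterate_block hw hz hj.le]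
  sing α := by
    obtain ⟨e, he, h1⟩ := h'.sing α
    obtain ⟨s, hs, h2⟩ := h.sing α
    have hmem := left_mem_J h'.pos α
    have hα : α = w α e := by
      refine J_unique h.pos (left_mem_J h.pos α) ?_
      rw [← h1]
      exact hw α e he _ hmem
    refine ⟨∑ i ∈ Finset.range e, q (w α i) + s, ?_, ?_⟩
    · rw [hα] at hs
      exact lt_of_lt_of_le (Nat.lt_succ_self _)
        (Nat.sum_range_le_of_lt (fun i => q (w α i)) he (Nat.succ_le_of_lt hs))
    · rw [add_comm, Function.iterate_add_apply, h.iterate_block hw hmem he.le, h1, h2]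
  top_zero α hα := h'.top_zero α (h.top_zero α hα)

/-- Iterates of the induced map are iterates of the original one, with at least as many steps. -/
theorem exists_iterate (h : Tower X Y q) {x : ℝ} (hx : x ∈ Ico 0 Y.total) (j : ℕ) :
    ∃ t, j ≤ t ∧ X.T^[t] x = Y.T^[j] x := by
  induction j with
  | zero => exact ⟨0, le_rfl, rfl⟩
  | succ j ih =>
    obtain ⟨t, ht, h1⟩ := ih
    obtain ⟨α, hα⟩ := exists_mem_J (iterate_T_mem h.pos hx j)
    refine ⟨q α + t, by have := h.height_pos α; omega, ?_⟩
    rw [Function.iterate_add_apply, h1, h.ret α _ hα, Function.iterate_succ_apply']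

/-- Keane's condition is inherited by the first return maps. -/
theorem keane (h : Tower X Y q) (hK : X.Keane) : Y.Keane := by
  intro j hj α β hβ heq
  have hmem := left_mem_J h.pos α
  -- The orbits of the new end points pass through the old ones before returning, so a connection
  -- for `Y` extends to one for `X`. Its length is positive because `e < q α`.
  obtain ⟨e, he, h1⟩ := h.sing α
  obtain ⟨e', he', h2⟩ := h.sing β
  obtain ⟨i, rfl⟩ : ∃ i, j = i + 1 := ⟨j - 1, by omega⟩
  rw [Function.iterate_succ_apply, ← h.ret α _ hmem] at heq
  have hmem' : X.T^[q α] (Y.left α) ∈ Ico 0 Y.total := by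
    rw [h.ret α _ hmem]; exact T_mem h.pos (J_subset h.pos α hmem)
  obtain ⟨t, -, ht⟩ := h.exists_iterate hmem' i
  rw [heq] at ht
  have h3 : X.T^[e' + t + (q α - e)] (X.left α) = X.left β := by
    rw [← h1, ← Function.iterate_add_apply, show e' + t + (q α - e) + e = e' + t + q α by omega,
      Function.iterate_add_apply, Function.iterate_add_apply, ht, h2]
  exact hK _ (by omega) α β (fun h0 => hβ (h.top_zero β h0)) h3

end Tower

end IETData

/-! ### One step of Rauzy–Veech induction as a first return map -/

namespace IETData

section Move

variable {A : Type*} [Fintype A] [DecidableEq A] {m : ℕ}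
  {e : A ≃ Fin (m + 1)} {len : A → ℝ} {w l : A}

/-- The order in which the last letter is moved to the place after `w`. -/
def moveAfter (e : A ≃ Fin (m + 1)) (w : A) : A ≃ Fin (m + 1) :=
  e.trans (Fin.cycleIcc (e w + 1) (Fin.last m))

/-- Addition in `Fin` does not wrap around here, since `w` is not in the last position. -/
theorem val_succ_of_ne (hl : e l = Fin.last m) (hwl : w ≠ l) :
    (e w + 1).val = (e w).val + 1 := by
  refine Fin.val_add_one_of_lt ?_
  rw [← hl]
  exact lt_of_le_of_ne (hl ▸ Fin.le_last _) (e.injective.ne hwl)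

theorem moveAfter_of_le (hl : e l = Fin.last m) (hwl : w ≠ l) {α : A} (h : e α ≤ e w) :
    moveAfter e w α = e α := by
  refine Fin.cycleIcc_of_lt ?_
  rw [Fin.lt_def, val_succ_of_ne hl hwl]
  exact Nat.lt_succ_of_le h

theorem moveAfter_last (hl : e l = Fin.last m) :
    moveAfter e w l = e w + 1 := by
  change Fin.cycleIcc _ _ (e l) = _
  rw [hl, Fin.cycleIcc_of_last (Fin.le_last _)]

theorem moveAfter_val_of_gt (hl : e l = Fin.last m) (hwl : w ≠ l) {α : A} (hα : α ≠ l)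
    (h : e w < e α) : (moveAfter e w α).val = (e α).val + 1 := by
  have hlt : e α < Fin.last m := by
    rw [← hl]
    exact lt_of_le_of_ne (hl ▸ Fin.le_last _) (e.injective.ne hα)
  change (Fin.cycleIcc _ _ (e α)).val = _
  rw [Fin.cycleIcc_of_ge_of_lt _ hlt, Fin.val_add_one_of_lt hlt]
  rw [Fin.le_def, val_succ_of_ne hl hwl]
  exact h

theorem moveAfter_lt_iff (hl : e l = Fin.last m) (hwl : w ≠ l) {α β : A} (hα : α ≠ l)
    (hβ : β ≠ l) : moveAfter e w β < moveAfter e w α ↔ e β < e α := by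
  rcases le_or_gt (e α) (e w) with h1 | h1 <;> rcases le_or_gt (e β) (e w) with h2 | h2
  · rw [moveAfter_of_le hl hwl h1, moveAfter_of_le hl hwl h2]
  · rw [moveAfter_of_le hl hwl h1, Fin.lt_def, moveAfter_val_of_gt hl hwl hβ h2, Fin.lt_def]
    rw [Fin.le_def] at h1
    rw [Fin.lt_def] at h2
    omega
  · rw [moveAfter_of_le hl hwl h2, Fin.lt_def, moveAfter_val_of_gt hl hwl hα h1, Fin.lt_def]
    rw [Fin.le_def] at h2
    rw [Fin.lt_def] at h1
    omega
  · rw [Fin.lt_def, moveAfter_val_of_gt hl hwl hβ h2, moveAfter_val_of_gt hl hwl hα h1, Fin.lt_def]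
    omega

theorem moveAfter_last_lt_iff (hl : e l = Fin.last m) (hwl : w ≠ l) {α : A} (hα : α ≠ l) :
    moveAfter e w l < moveAfter e w α ↔ e w < e α := by
  rw [moveAfter_last hl, Fin.lt_def, val_succ_of_ne hl hwl]
  rcases le_or_gt (e α) (e w) with h1 | h1
  · rw [moveAfter_of_le hl hwl h1]
    rw [Fin.le_def] at h1
    rw [Fin.lt_def]
    omega
  · rw [moveAfter_val_of_gt hl hwl hα h1]
    rw [Fin.lt_def] at h1 ⊢
    omega

theorem moveAfter_lt_last_iff (hl : e l = Fin.last m) (hwl : w ≠ l) {β : A} (hβ : β ≠ l) :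
    moveAfter e w β < moveAfter e w l ↔ e β ≤ e w := by
  rw [← not_le, le_iff_eq_or_lt, moveAfter_last_lt_iff hl hwl hβ,
    (moveAfter e w).injective.eq_iff]
  simp [hβ.symm]

/-- The length vector in which the length of `l` is subtracted from the length of `w`. -/
def shorten (len : A → ℝ) (w l : A) : A → ℝ := Function.update len w (len w - len l)

theorem shorten_apply (β : A) : shorten len w l β = len β - if β = w then len l else 0 := by
  unfold shorten
  by_cases h : β = w
  · subst h; simp
  · simp [h]

theorem sum_shorten : ∑ β, shorten len w l β = ∑ β, len β - len l := by
  simp [shorten_apply, Finset.sum_sub_distrib]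

theorem placeLeft_shorten_of_last (hw : e w = Fin.last m) (α : A) :
    placeLeft e (shorten len w l) α = placeLeft e len α := by
  refine Finset.sum_congr rfl fun β hβ => ?_
  simp only [Finset.mem_filter, Finset.mem_univ, true_and] at hβ
  rw [shorten_apply, if_neg, sub_zero]
  rintro rfl
  rw [hw] at hβ
  exact absurd (Fin.le_last _) (not_le.2 hβ)

/-- The letter `l` is inserted before `α` exactly when `w` is before `α`, and then the shortening of
`w` by the length of `l` compensates for it. -/
theorem placeLeft_moveAfter (hl : e l = Fin.last m) (hwl : w ≠ l) {α : A} (hα : α ≠ l) :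
    placeLeft (moveAfter e w) (shorten len w l) α = placeLeft e len α := by
  have key : ∀ β, (if moveAfter e w β < moveAfter e w α then shorten len w l β else 0) =
      (if e β < e α then len β else 0) + (if β = l then if e w < e α then len l else 0 else 0) -
        (if β = w then if e w < e α then len l else 0 else 0) := by
    intro β
    by_cases h1 : β = l
    · subst h1
      have h2 : ¬ e β < e α := by rw [hl]; exact not_lt.2 (Fin.le_last _)
      simp only [moveAfter_last_lt_iff hl hwl hα, shorten_apply, hwl.symm, h2, if_false, if_true]
      simp
    · simp only [moveAfter_lt_iff hl hwl hα h1, shorten_apply, h1, if_false, add_zero]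
      by_cases h3 : β = w
      · subst h3
        by_cases h4 : e β < e α <;> simp [h4]
      · simp [h3]
  unfold placeLeft
  rw [Finset.sum_filter, Finset.sum_filter, Finset.sum_congr rfl fun β _ => key β,
    Finset.sum_sub_distrib, Finset.sum_add_distrib]
  simp

/-- The moved interval occupies the right end of the old interval of `w`. -/
theorem placeLeft_moveAfter_last (hl : e l = Fin.last m) (hwl : w ≠ l) :
    placeLeft (moveAfter e w) (shorten len w l) l = placeLeft e len w + len w - len l := by
  have key : ∀ β, (if moveAfter e w β < moveAfter e w l then shorten len w l β else 0) =
      (if e β ≤ e w then len β else 0) - (if β = w then len l else 0) := by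
    intro β
    by_cases h1 : β = l
    · subst h1
      have h2 : ¬ e β ≤ e w := by
        rw [hl]
        intro h
        exact hwl (e.injective ((le_antisymm h (Fin.le_last _)).symm.trans hl.symm))
      simp [h2, hwl.symm]
    · simp only [moveAfter_lt_last_iff hl hwl h1, shorten_apply]
      by_cases h3 : β = w
      · subst h3
        simp
      · simp [h3]
  rw [placeLeft_add]
  unfold placeLeft
  rw [Finset.sum_filter, Finset.sum_filter, Finset.sum_congr rfl fun β _ => key β,
    Finset.sum_sub_distrib]
  simp

end Move

variable {A : Type*} [Fintype A] [DecidableEq A] {m : ℕ}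

/-- A criterion for the first return map to a shorter interval to be the one in which a single
letter `l` has return time `2`. -/
theorem Tower.of_step {X Y : IETData A m} {l b₁ b₂ : A} (hX : ∀ α, 0 < X.len α)
    (hY : ∀ α, 0 < Y.len α) (htot : Y.total = X.total - X.len l)
    (hlen : Y.len l = X.len l)
    (hJ : ∀ α, α ≠ l → Y.J α ⊆ X.J α) (htr : ∀ α, α ≠ l → Y.trans α = X.trans α)
    (hJl : Y.J l ⊆ X.J b₁) (hstart : Y.left l + X.trans b₁ = Y.total)
    (hb₂ : Ico Y.total X.total ⊆ X.J b₂)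
    (htrl : Y.trans l = X.trans b₁ + X.trans b₂)
    (hleft : ∀ α, α ≠ l → Y.left α = X.left α)
    (hleftl : Y.left l = X.left l ∨ Y.total = X.left l)
    (h0 : ∀ α, X.top α = 0 → Y.top α = 0) :
    Tower X Y (fun α => if α = l then 2 else 1) ∧
      ∀ α, ∀ j < (if α = l then 2 else 1), ∀ x ∈ Y.J α,
        X.T^[j] x ∈ X.J (if α = l then if j = 0 then b₁ else b₂ else α) := by
  have hT1 : ∀ x ∈ Y.J l, X.T x = x + X.trans b₁ := fun x hx => T_eq hX (hJl hx)
  -- The interval of `l` is carried exactly onto the part that was cut off. This is why only `l`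
  -- needs a second step, which starts in the interval of `b₂`.
  have hT1m : ∀ x ∈ Y.J l, x + X.trans b₁ ∈ Ico Y.total X.total := by
    intro x hx
    rw [mem_J, right_eq] at hx
    constructor <;> linarith [hx.1, hx.2]
  have hle : Y.total ≤ X.total := by linarith [hX l]
  have hself : ∀ α x, x ∈ Y.J α → ∃ β, x ∈ X.J β := fun α x hx =>
    exists_mem_J ⟨(J_subset hY α hx).1, (J_subset hY α hx).2.trans_le hle⟩
  refine ⟨⟨hX, hY, ?_, hle, ?_, ?_, ?_, ?_, ?_, h0⟩, ?_⟩
  · intro α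
    split_ifs <;> norm_num
  · intro α i hi
    by_cases hα : α = l
    · subst hα
      rw [if_pos rfl] at hi
      interval_cases i
      · exact ⟨b₁, 0, fun x hx => by simpa using hJl hx⟩
      · exact ⟨b₂, X.trans b₁, fun x hx => ⟨hT1 x hx, hb₂ (hT1m x hx)⟩⟩
    · rw [if_neg hα] at hi
      obtain rfl : i = 0 := by omega
      exact ⟨α, 0, fun x hx => by simpa using hJ α hα hx⟩
  · intro α x hx
    by_cases hα : α = l
    · subst hα
      rw [if_pos rfl, T_eq hY hx, htrl]
      change X.T (X.T x) = _
      rw [hT1 x hx, T_eq hX (hb₂ (hT1m x hx))]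
      ring
    · rw [if_neg hα, T_eq hY hx, htr α hα]
      exact T_eq hX (hJ α hα hx)
  · intro α x hx i hi0 hi
    by_cases hα : α = l
    · subst hα
      rw [if_pos rfl] at hi
      obtain rfl : i = 1 := by omega
      intro hmem
      have h1 := hT1m x hx
      rw [Function.iterate_one, hT1 x hx] at hmem
      exact absurd hmem.2 (not_lt.2 h1.1)
    · rw [if_neg hα] at hi
      omega
  · intro x hx
    by_cases hxY : x < Y.total
    · obtain ⟨α, hα⟩ := exists_mem_J (X := Y) ⟨hx.1, hxY⟩
      refine ⟨α, x, hα, 0, ?_, rfl⟩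
      split_ifs <;> norm_num
    · have hmem : x - X.trans b₁ ∈ Y.J l := by
        rw [mem_J, right_eq]
        constructor <;> linarith [hx.2]
      refine ⟨l, _, hmem, 1, by simp, ?_⟩
      rw [Function.iterate_one, hT1 _ hmem]
      ring
  · intro α
    by_cases hα : α = l
    · subst hα
      rcases hleftl with h | h
      · exact ⟨0, by simp, h⟩
      · refine ⟨1, by simp, ?_⟩
        rw [Function.iterate_one, hT1 _ (left_mem_J hY α), hstart, h]
    · exact ⟨0, by simp [hα], hleft α hα⟩
  · intro α j hj x hx
    by_cases hα : α = l
    · subst hα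
      rw [if_pos rfl] at hj ⊢
      interval_cases j
      · exact hJl hx
      · rw [if_neg one_ne_zero, Function.iterate_one, hT1 x hx]
        exact hb₂ (hT1m x hx)
    · rw [if_neg hα] at hj ⊢
      obtain rfl : j = 0 := by omega
      exact hJ α hα hx

section Rauzy

variable {X : IETData A m}

theorem bot_lastBot : X.bot X.lastBot = Fin.last m := X.bot.apply_symm_apply _

theorem top_lastTop : X.top X.lastTop = Fin.last m := X.top.apply_symm_apply _

theorem T_lastBot (hp : ∀ α, 0 < X.len α) :
    X.T (X.left X.lastBot) = X.total - X.len X.lastBot := by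
  rw [T_eq' hp (left_mem_J hp _)]
  have : X.botLeft X.lastBot + X.len X.lastBot = X.total := placeLeft_last bot_lastBot
  linarith

theorem left_lastTop : X.left X.lastTop = X.total - X.len X.lastTop := by
  have : X.left X.lastTop + X.len X.lastTop = X.total := placeLeft_last top_lastTop
  linarith

theorem top_lastTop_ne_zero (hm : 1 ≤ m) : X.top X.lastTop ≠ 0 := by
  rw [top_lastTop]
  intro h
  have := congrArg Fin.val h
  simp at this
  omega

theorem len_ne_of_keane (hp : ∀ α, 0 < X.len α) (hm : 1 ≤ m) (hK : X.Keane) :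
    X.len X.lastBot ≠ X.len X.lastTop := by
  intro h
  refine hK 1 le_rfl X.lastBot X.lastTop (top_lastTop_ne_zero hm) ?_
  rw [Function.iterate_one, T_lastBot hp, left_lastTop, h]

/-- One step of Rauzy–Veech induction is a first return map. -/
theorem tower_rauzy (hp : ∀ α, 0 < X.len α) (hm : 1 ≤ m) (hK : X.Keane) :
    Tower X X.rauzy (fun α => ∑ β, X.rauzyMatrix β α) ∧
      ∃ w : A → ℕ → A,
        (∀ α, ∀ j < ∑ β, X.rauzyMatrix β α, ∀ x ∈ X.rauzy.J α, X.T^[j] x ∈ X.J (w α j)) ∧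
        ∀ (q : A → ℕ) (α : A), ∑ j ∈ Finset.range (∑ β, X.rauzyMatrix β α), q (w α j) =
          ∑ β, X.rauzyMatrix β α * q β := by
  have hne := len_ne_of_keane hp hm hK
  have hwl : X.lastTop ≠ X.lastBot := fun h => hne (h ▸ rfl)
  -- The column of the loser is the only one with sum `2`: its return time is the only one that
  -- changes.
  have hmat : ∀ w l α : A, ∑ β, (1 + Matrix.single w l 1 : Matrix A A ℕ) β α =
      if α = l then 2 else 1 := by
    intro w l α
    simp only [Matrix.add_apply, Finset.sum_add_distrib, Matrix.one_apply, Matrix.single_apply,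
      Finset.sum_ite_eq', Finset.mem_univ, if_true]
    by_cases h : l = α
    · subst h; simp
    · simp [h, Ne.symm h]
  have hmul : ∀ (q : A → ℕ) (w l α : A),
      ∑ β, (1 + Matrix.single w l 1 : Matrix A A ℕ) β α * q β =
        if α = l then q l + q w else q α := by
    intro q w l α
    simp only [Matrix.add_apply, add_mul, Finset.sum_add_distrib, Matrix.one_apply,
      Matrix.single_apply, ite_mul, one_mul, zero_mul, Finset.sum_ite_eq', Finset.mem_univ, if_true]
    by_cases h : l = α
    · subst h; simp
    · simp [h, Ne.symm h]
  have hsum : ∀ (q : A → ℕ) (l b₁ b₂ α : A),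
      ∑ j ∈ Finset.range (if α = l then 2 else 1),
        q (if α = l then if j = 0 then b₁ else b₂ else α) =
        if α = l then q b₁ + q b₂ else q α := by
    intro q l b₁ b₂ α
    by_cases h : α = l <;> simp [h, Finset.sum_range_succ]
  have hbot : X.botLeft X.lastBot + X.len X.lastBot = X.total := placeLeft_last bot_lastBot
  have htop := left_lastTop (X := X)
  -- In both cases the loser visits first `lastBot` and then `lastTop`; the cases differ in which of
  -- the two is the loser.
  by_cases hlt : X.len X.lastBot < X.len X.lastTop
  · have hr : X.rauzy = ⟨X.top, moveAfter X.bot X.lastTop,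
        shorten X.len X.lastTop X.lastBot⟩ := if_pos hlt
    have hM : X.rauzyMatrix = 1 + Matrix.single X.lastTop X.lastBot 1 := if_pos hlt
    simp only [hM, hmat, hmul]
    generalize X.rauzy = Y at hr
    have hlenw : Y.len X.lastTop = X.len X.lastTop - X.len X.lastBot := by
      simp [hr, shorten_apply]
    have hlen : ∀ α, α ≠ X.lastTop → Y.len α = X.len α := fun α hα => by
      simp [hr, shorten_apply, hα]
    have hY : ∀ α, 0 < Y.len α := by
      intro α
      by_cases hα : α = X.lastTop
      · rw [hα, hlenw]; linarith
      · rw [hlen α hα]; exact hp α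
    have hleft : ∀ α, Y.left α = X.left α := fun α => by
      subst hr; exact placeLeft_shorten_of_last top_lastTop α
    have hbl : ∀ α, α ≠ X.lastBot → Y.botLeft α = X.botLeft α := fun α hα => by
      subst hr; exact placeLeft_moveAfter bot_lastBot hwl hα
    have hbll : Y.botLeft X.lastBot = X.botLeft X.lastTop + X.len X.lastTop - X.len X.lastBot := by
      subst hr; exact placeLeft_moveAfter_last bot_lastBot hwl
    have htot : Y.total = X.total - X.len X.lastBot := by subst hr; exact sum_shorten
    have hJ : ∀ α, Y.J α ⊆ X.J α := by
      intro α x hx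
      rw [mem_J, right_eq, hleft] at hx
      rw [mem_J, right_eq]
      refine ⟨hx.1, hx.2.trans_le ?_⟩
      by_cases hα : α = X.lastTop
      · rw [hα, hlenw]; linarith [hp X.lastBot]
      · rw [hlen α hα]
    refine (fun h => ⟨h.1, _, h.2, fun q α => hsum q X.lastBot X.lastBot X.lastTop α⟩) <|
      Tower.of_step (b₁ := X.lastBot) (b₂ := X.lastTop) hp hY htot (hlen _ hwl.symm)
      (fun α _ => hJ α) (fun α hα => by rw [trans_eq, trans_eq, hleft, hbl α hα]) (hJ _) ?_ ?_ ?_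
      (fun α _ => hleft α) (Or.inl (hleft _)) (fun α h => by rw [hr]; exact h)
    · rw [trans_eq, hleft, htot]; linarith
    · intro x hx
      rw [mem_J, right_eq]
      constructor <;> linarith [hx.1, hx.2]
    · rw [trans_eq, trans_eq, trans_eq, hbll, hleft]; linarith
  · have hlt' : X.len X.lastTop < X.len X.lastBot := lt_of_le_of_ne (not_lt.1 hlt) hne.symm
    have hr : X.rauzy = ⟨moveAfter X.top X.lastBot, X.bot,
        shorten X.len X.lastBot X.lastTop⟩ := if_neg hlt
    have hM : X.rauzyMatrix = 1 + Matrix.single X.lastBot X.lastTop 1 := if_neg hlt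
    simp only [hM, hmat, hmul]
    generalize X.rauzy = Y at hr
    have hlenw : Y.len X.lastBot = X.len X.lastBot - X.len X.lastTop := by
      simp [hr, shorten_apply]
    have hlen : ∀ α, α ≠ X.lastBot → Y.len α = X.len α := fun α hα => by
      simp [hr, shorten_apply, hα]
    have hY : ∀ α, 0 < Y.len α := by
      intro α
      by_cases hα : α = X.lastBot
      · rw [hα, hlenw]; linarith
      · rw [hlen α hα]; exact hp α
    have hleft : ∀ α, α ≠ X.lastTop → Y.left α = X.left α := fun α hα => by
      subst hr; exact placeLeft_moveAfter top_lastTop hwl.symm hα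
    have hleftl : Y.left X.lastTop = X.left X.lastBot + X.len X.lastBot - X.len X.lastTop := by
      subst hr; exact placeLeft_moveAfter_last top_lastTop hwl.symm
    have hbl : ∀ α, Y.botLeft α = X.botLeft α := fun α => by
      subst hr; exact placeLeft_shorten_of_last bot_lastBot α
    have htot : Y.total = X.total - X.len X.lastTop := by subst hr; exact sum_shorten
    have hJ : ∀ α, α ≠ X.lastTop → Y.J α ⊆ X.J α := by
      intro α hα x hx
      rw [mem_J, right_eq, hleft α hα] at hx
      rw [mem_J, right_eq]
      refine ⟨hx.1, hx.2.trans_le ?_⟩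
      by_cases hα : α = X.lastBot
      · rw [hα, hlenw]; linarith [hp X.lastTop]
      · rw [hlen α hα]
    -- Here the interval of the loser `lastTop` has moved to the right end of the old interval of
    -- `lastBot`. The old end point `l_lastTop` is the cut point and is reached on the second floor,
    -- hence `Or.inr`.
    refine (fun h => ⟨h.1, _, h.2, fun q α => (hsum q X.lastTop X.lastBot X.lastTop α).trans
      (by rw [add_comm])⟩) <|
      Tower.of_step (b₁ := X.lastBot) (b₂ := X.lastTop) hp hY htot (hlen _ hwl)
      hJ (fun α hα => by rw [trans_eq, trans_eq, hleft α hα, hbl α]) ?_ ?_ ?_ ?_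
      hleft (Or.inr (by rw [htot, htop])) ?_
    · intro x hx
      rw [mem_J, right_eq, hleftl, hlen _ hwl] at hx
      rw [mem_J, right_eq]
      constructor <;> linarith [hx.1, hx.2]
    · rw [trans_eq, hleftl, htot]; linarith
    · intro x hx
      rw [mem_J, right_eq]
      constructor <;> linarith [hx.1, hx.2]
    · rw [trans_eq, trans_eq, trans_eq, hbl, hleftl]; linarith
    · intro α h
      rw [hr]
      change moveAfter X.top X.lastBot α = 0
      rw [moveAfter_of_le top_lastTop hwl.symm (h ▸ Fin.zero_le _), h]

/-- The length vectors are related by the transpose of the action on the return times. -/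
theorem sum_mul_rauzy_len (hwl : X.lastTop ≠ X.lastBot) (q : A → ℕ) :
    ∑ α, ((∑ β, X.rauzyMatrix β α * q β : ℕ) : ℝ) * X.rauzy.len α = ∑ α, (q α : ℝ) * X.len α := by
  have key : ∀ w l : A, w ≠ l →
      ∑ α, ((∑ β, (1 + Matrix.single w l 1 : Matrix A A ℕ) β α * q β : ℕ) : ℝ) *
        shorten X.len w l α = ∑ α, (q α : ℝ) * X.len α := by
    intro w l hne
    have h1 : ∀ α, ((∑ β, (1 + Matrix.single w l 1 : Matrix A A ℕ) β α * q β : ℕ) : ℝ) *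
        shorten X.len w l α = q α * X.len α + (if α = l then (q w : ℝ) * X.len l else 0) -
          if α = w then (q w : ℝ) * X.len l else 0 := by
      intro α
      have : ∑ β, (1 + Matrix.single w l 1 : Matrix A A ℕ) β α * q β =
          q α + if α = l then q w else 0 := by
        simp only [Matrix.add_apply, add_mul, Finset.sum_add_distrib, Matrix.one_apply,
          Matrix.single_apply, ite_mul, one_mul, zero_mul, Finset.sum_ite_eq', Finset.mem_univ,
          if_true]
        by_cases h : l = α
        · subst h; simp
        · simp [h, Ne.symm h]
      rw [this, shorten_apply]
      by_cases h2 : α = l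
      · subst h2
        simp [hne.symm]
        ring
      · by_cases h3 : α = w
        · subst h3
          simp [h2]
          ring
        · simp [h2, h3]
    rw [Finset.sum_congr rfl fun α _ => h1 α, Finset.sum_sub_distrib, Finset.sum_add_distrib]
    simp
  unfold rauzyMatrix rauzy
  split_ifs
  · exact key _ _ hwl
  · exact key _ _ hwl.symm

end Rauzy

end IETData

/-! ### Iterated induction and the bounds from the Diophantine condition -/

namespace IETData

variable {A : Type*} [Fintype A] [DecidableEq A] {m : ℕ} {X : IETData A m}

/-- Iterated Rauzy–Veech induction yields first return maps; the return times are the column sums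
of the cocycle, and the towers fill the whole interval. -/
theorem tower_iterate_rauzy (hp : ∀ α, 0 < X.len α) (hm : 1 ≤ m) (hK : X.Keane) (n : ℕ) :
    Tower X (rauzy^[n] X) (fun α => ∑ β, X.kz n β α) ∧
      ∑ α, ((∑ β, X.kz n β α : ℕ) : ℝ) * (rauzy^[n] X).len α = X.total := by
  induction n with
  | zero =>
    have : (fun α => ∑ β, X.kz 0 β α) = fun _ => 1 := by
      ext α
      simp [kz, Matrix.one_apply]
    refine ⟨this ▸ Tower.refl hp, ?_⟩
    simp only [fun α => congrFun this α]
    simp [total]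
  | succ n ih =>
    obtain ⟨h, hs⟩ := ih
    obtain ⟨h', w, hw, hsum⟩ := tower_rauzy h.pos hm (h.keane hK)
    -- Column sums of a product are the column sums of the left factor, weighted by the right
    -- factor. This matches the block heights of the composed tower.
    have hcol : ∀ α, ∑ β, X.kz (n + 1) β α =
        ∑ β, (rauzy^[n] X).rauzyMatrix β α * ∑ γ, X.kz n γ β := by
      intro α
      simp only [kz, Matrix.mul_apply, Finset.mul_sum]
      rw [Finset.sum_comm]
      simp only [mul_comm]
    have hne := len_ne_of_keane h.pos hm (h.keane hK)
    rw [Function.iterate_succ_apply']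
    constructor
    · have := h.comp h' hw
      simp only [hsum (fun γ => ∑ β, X.kz n β γ)] at this
      simpa only [hcol] using this
    · simp only [hcol]
      rw [sum_mul_rauzy_len (fun h => hne (h ▸ rfl)) (fun γ => ∑ β, X.kz n β γ), hs]

theorem tower_accel (hp : ∀ α, 0 < X.len α) (hm : 1 ≤ m) (hK : X.Keane) {N : ℕ → ℕ}
    (hN : IsAccel N) {k l : ℕ} (hkl : k ≤ l) :
    Tower (X.accel N k) (X.accel N l) (fun α => ∑ β, X.Qnat N k l α β) ∧
      ∑ α, ((∑ β, X.Qnat N k l α β : ℕ) : ℝ) * (X.accel N l).len α = (X.accel N k).total := by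
  have h0 := (tower_iterate_rauzy hp hm hK (N k)).1
  have h := tower_iterate_rauzy h0.pos hm (h0.keane hK) (N l - N k)
  have hle : N k ≤ N l := hN.1.monotone hkl
  rw [← Function.iterate_add_apply, Nat.sub_add_cancel hle] at h
  exact h

theorem accel_zero {N : ℕ → ℕ} (hN : IsAccel N) : X.accel N 0 = X := by
  simp [accel, hN.2]

/-- Apply `Q(k,l)` to the vector of ones, which has norm `1`. -/
theorem rowSum_le_normQ [Nonempty A] (N : ℕ → ℕ) (k l : ℕ) (α : A) :
    ((∑ β, X.Qnat N k l α β : ℕ) : ℝ) ≤ X.normQ N k l := by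
  have h := (LinearMap.toContinuousLinearMap (X.Q N k l)).le_opNorm (fun _ => 1)
  have h1 : ‖(fun _ : A => (1 : ℝ))‖ = 1 := by
    rw [pi_norm_const]; simp
  rw [h1, mul_one] at h
  refine le_trans ?_ ((norm_le_pi_norm _ α).trans h)
  refine le_trans (le_of_eq ?_) (le_abs_self _)
  simp [Q, Matrix.mulVec, dotProduct]

/-- A sequence of nested first return maps `Y k` of `X` with exponential bounds governed by the rate `lam` and the
precision `σ`. -/
structure Renorm (X : IETData A m) (Y : ℕ → IETData A m) (q p : ℕ → A → ℕ) (lam σ B : ℝ) :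
    Prop where
  zero : Y 0 = X
  tower : ∀ k, Tower X (Y k) (q k)
  step : ∀ k, Tower (Y k) (Y (k + 1)) (p k)
  one_le : 1 ≤ B
  step_le : ∀ k α, (p k α : ℝ) ≤ B * Real.exp (σ * k)
  le_len : ∀ (k : ℕ) α, B⁻¹ * Real.exp (-(lam * (1 + σ)) * k) ≤ (Y k).len α

/-- The number of blocks is controlled by `‖Z(k+1)‖`. For the lower bound on lengths, the towers
fill `I`, so `|I| ≤ ‖Q(k)‖ |I^(k)|`, and by the balance condition `|I^(k)|` is comparable to each
`|I_α^(k)|`. -/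
theorem exists_renorm (hp : ∀ α, 0 < X.len α) (hm : 1 ≤ m) (hK : X.Keane) {N : ℕ → ℕ}
    {g : ℕ} {lam : ℕ → ℝ} {E : ℤ → Submodule ℝ (A → ℝ)} {σ : ℝ}
    (h : X.IsFFDCAccel g lam E σ N) :
    ∃ B, Renorm X (X.accel N) (X.retTime N) (fun k α => ∑ β, X.Qnat N k (k + 1) α β)
      (lam 1) σ B := by
  have : Nonempty A := ⟨X.top.symm 0⟩
  obtain ⟨hN, -, C, κ, -, -, -, hC, hκ, -, -, -, -, -, -, -, -, hZ, hQ, hbal, -⟩ := h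
  have hC0 : 0 < C := by linarith
  have hκ0 : 0 < κ := by linarith
  have ht := total_pos hp
  have htow : ∀ k, Tower X (X.accel N k) (X.retTime N k) ∧
      ∑ α, (X.retTime N k α : ℝ) * (X.accel N k).len α = X.total := by
    intro k
    have := tower_accel hp hm hK hN (Nat.zero_le k)
    rw [accel_zero hN] at this
    exact this
  have hbal' : ∀ k α, (X.accel N k).total ≤ κ * (X.accel N k).len α := by
    intro k α
    have := hbal k α
    rwa [div_le_iff₀ ((htow k).1.pos α)] at this
  have hlower : ∀ (k : ℕ) α, X.total * C⁻¹ * κ⁻¹ * Real.exp (-(lam 1 * (1 + σ)) * k) ≤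
      (X.accel N k).len α := by
    intro k α
    have h1 : X.total ≤ C * Real.exp (lam 1 * (1 + σ) * k) * (X.accel N k).total := by
      conv_lhs => rw [← (htow k).2]
      rw [total, Finset.mul_sum]
      refine Finset.sum_le_sum fun β _ => mul_le_mul_of_nonneg_right ?_ ((htow k).1.pos β).le
      exact (rowSum_le_normQ N 0 k β).trans (hQ k).2
    have h2 : X.total ≤ C * Real.exp (lam 1 * (1 + σ) * k) * (κ * (X.accel N k).len α) :=
      h1.trans (mul_le_mul_of_nonneg_left (hbal' k α) (by positivity))
    calc X.total * C⁻¹ * κ⁻¹ * Real.exp (-(lam 1 * (1 + σ)) * k)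
        ≤ (C * Real.exp (lam 1 * (1 + σ) * k) * (κ * (X.accel N k).len α)) * C⁻¹ * κ⁻¹ *
          Real.exp (-(lam 1 * (1 + σ)) * k) := by gcongr
      _ = (X.accel N k).len α := by
        rw [neg_mul, Real.exp_neg]
        field_simp
  -- One constant has to be at least `1`, bound `Z` from above and, inverted, bound the lengths from
  -- below.
  refine ⟨max (max 1 C) (X.total * C⁻¹ * κ⁻¹)⁻¹, accel_zero hN,
    fun k => (htow k).1, fun k => (tower_accel hp hm hK hN (Nat.le_succ k)).1, ?_, ?_, ?_⟩
  · exact (le_max_left _ _).trans (le_max_left _ _)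
  · intro k α
    refine (rowSum_le_normQ N k (k + 1) α).trans ((hZ k).trans ?_)
    gcongr
    exact (le_max_right _ _).trans (le_max_left _ _)
  · intro k α
    refine le_trans ?_ (hlower k α)
    gcongr
    exact inv_le_of_inv_le₀ (by positivity) (le_max_right _ _)

end IETData

/-! ### Tower sums and their convergence -/

namespace IETData

variable {A : Type*} [Fintype A] [DecidableEq A] {m : ℕ}

/-- The Birkhoff sum of `f` along the tower over `Y`, from the base up to the point `x`. -/
def towerSum (X Y : IETData A m) (q : A → ℕ) (f : ℝ → ℝ) (x : ℝ) : ℝ :=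
  open Classical in
  if h : ∃ t : A × ℝ × ℕ, t.2.1 ∈ Y.J t.1 ∧ t.2.2 < q t.1 ∧ X.T^[t.2.2] t.2.1 = x then
    birkhoffSum X.T f h.choose.2.2 h.choose.2.1 else 0

/-- The choice made in `towerSum` is harmless because the floors are disjoint and each point has one
base point and one height. -/
theorem Tower.towerSum_eq {X Y : IETData A m} {q : A → ℕ} (h : Tower X Y q) (f : ℝ → ℝ) {α : A}
    {y : ℝ} (hy : y ∈ Y.J α) {i : ℕ} (hi : i < q α) :
    towerSum X Y q f (X.T^[i] y) = birkhoffSum X.T f i y := by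
  have hex : ∃ t : A × ℝ × ℕ, t.2.1 ∈ Y.J t.1 ∧ t.2.2 < q t.1 ∧
      X.T^[t.2.2] t.2.1 = X.T^[i] y := ⟨(α, y, i), hy, hi, rfl⟩
  unfold towerSum
  rw [dif_pos hex]
  obtain ⟨h1, h2, h3⟩ := hex.choose_spec
  obtain ⟨-, h5, h6⟩ := h.floor_unique h1 hy h2 hi h3
  rw [h5, h6]

theorem Tower.towerSum_base {X Y : IETData A m} {q : A → ℕ} (h : Tower X Y q) (f : ℝ → ℝ)
    {y : ℝ} (hy : y ∈ Ico 0 Y.total) : towerSum X Y q f y = 0 := by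
  obtain ⟨α, hα⟩ := exists_mem_J hy
  have := h.towerSum_eq f hα (h.height_pos α)
  simpa using this

namespace Renorm

variable {X : IETData A m} {Y : ℕ → IETData A m} {q p : ℕ → A → ℕ} {lam σ B : ℝ}

/-- A floor of a tower of level `k + 1` lies in a floor of a tower of level `k`, and the
Birkhoff sums up to this floor are decomposed accordingly. -/
theorem floor_decomp (h : Renorm X Y q p lam σ B) {k : ℕ} {α : A} {t : ℕ} (ht : t < q (k + 1) α) :
    ∃ (w : ℕ → A) (j s : ℕ), j < p k α ∧ s < q k (w j) ∧
      (∀ i < p k α, ∃ c, ∀ z ∈ (Y (k + 1)).J α, (Y k).T^[i] z = z + c ∧ z + c ∈ (Y k).J (w i)) ∧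
      ∀ z ∈ (Y (k + 1)).J α, X.T^[t] z = X.T^[s] ((Y k).T^[j] z) ∧
        ∀ f : ℝ → ℝ, birkhoffSum X.T f t z =
          ∑ i ∈ Finset.range j, birkhoffSum X.T f (q k (w i)) ((Y k).T^[i] z) +
            birkhoffSum X.T f s ((Y k).T^[j] z) := by
  obtain ⟨w, hw⟩ := (h.step k).exists_letters
  -- The height of level `k + 1` is thus a sum of heights of level `k`, and `t` can be split into
  -- full blocks and a remainder.
  have hq := (h.tower (k + 1)).height_unique ((h.tower k).comp (h.step k) hw)
  rw [hq] at ht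
  obtain ⟨j, hj, s, hs, rfl⟩ := Nat.exists_block _ ht
  refine ⟨w α, j, s, hj, hs, fun i hi => ?_, fun z hz => ⟨?_, fun f => ?_⟩⟩
  · obtain ⟨β, c, hc⟩ := (h.step k).transl α i hi
    refine ⟨c, fun z hz => ⟨(hc z hz).1, ?_⟩⟩
    rw [← (hc z hz).1]
    exact hw α i hi z hz
  · rw [add_comm, Function.iterate_add_apply, (h.tower k).iterate_block hw hz hj.le]
  · rw [birkhoffSum_add, (h.tower k).birkhoffSum_block hw hz hj.le,
      (h.tower k).iterate_block hw hz hj.le]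

theorem B_pos (h : Renorm X Y q p lam σ B) : 0 < B := by linarith [h.one_le]

/-- The incomplete last block reproduces the tower sum of level `k`, so the difference consists of
fewer than `p k α` full special sums. Their number, at most `B e^{σk}`, costs the `σ` in the decay
rate. -/
theorem abs_towerSum_succ_sub_le (h : Renorm X Y q p lam σ B) {f : ℝ → ℝ} {D ρ : ℝ}
    (hD : 0 ≤ D)
    (hf : ∀ (k : ℕ) α, ∀ y ∈ (Y k).J α, |birkhoffSum X.T f (q k α) y| ≤
      D * Real.exp (-(ρ + σ) * k)) (k : ℕ) {x : ℝ} (hx : x ∈ Ico 0 X.total) :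
    |towerSum X (Y (k + 1)) (q (k + 1)) f x - towerSum X (Y k) (q k) f x| ≤
      B * D * Real.exp (-ρ) ^ k := by
  obtain ⟨α, z, hz, t, ht, rfl⟩ := (h.tower (k + 1)).cover x hx
  obtain ⟨w, j, s, hj, hs, hw, hdec⟩ := h.floor_decomp ht
  rw [(h.tower (k + 1)).towerSum_eq f hz ht, (hdec z hz).2 f, (hdec z hz).1,
    (h.tower k).towerSum_eq f (α := w j) _ hs, add_sub_cancel_right]
  · refine (Finset.abs_sum_le_sum_abs _ _).trans ?_
    have h1 : ∀ i ∈ Finset.range j, |birkhoffSum X.T f (q k (w i)) ((Y k).T^[i] z)| ≤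
        D * Real.exp (-(ρ + σ) * k) := by
      intro i hi
      obtain ⟨c, hc⟩ := hw i ((Finset.mem_range.1 hi).trans hj)
      refine hf k (w i) _ ?_
      rw [(hc z hz).1]
      exact (hc z hz).2
    refine (Finset.sum_le_sum h1).trans ?_
    rw [Finset.sum_const, Finset.card_range, nsmul_eq_mul]
    have h2 : (j : ℝ) ≤ B * Real.exp (σ * k) :=
      le_trans (Nat.cast_le.2 hj.le) (h.step_le k α)
    calc (j : ℝ) * (D * Real.exp (-(ρ + σ) * k))
        ≤ (B * Real.exp (σ * k)) * (D * Real.exp (-(ρ + σ) * k)) := by gcongr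
      _ = B * D * (Real.exp (σ * k) * Real.exp (-(ρ + σ) * k)) := by ring
      _ = B * D * Real.exp (-ρ) ^ k := by
        rw [← Real.exp_add, ← Real.exp_nat_mul]
        congr 2
        ring
  · obtain ⟨c, hc⟩ := hw j hj
    rw [(hc z hz).1]
    exact (hc z hz).2

end Renorm

/-! ### Continuity and uniqueness of solutions -/

section Continuity

variable {X : IETData A m}

theorem mem_Ioo_of_ne {α : A} {y : ℝ} (hy : y ∈ X.J α) (hne : y ≠ X.left α) :
    y ∈ Ioo (X.left α) (X.right α) := ⟨lt_of_le_of_ne hy.1 hne.symm, hy.2⟩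

/-- Away from the backward orbits of the end points, iterates are local translations and Birkhoff
sums are continuous. -/
theorem iterate_local (hp : ∀ α, 0 < X.len α) {f : ℝ → ℝ}
    (hf : ∀ α, ContinuousOn f (Ioo (X.left α) (X.right α))) {y : ℝ} (hy : y ∈ Ico 0 X.total)
    {j : ℕ} (hj : ∀ s < j, ∀ β, X.T^[s] y ≠ X.left β) :
    (∀ᶠ x in 𝓝 y, X.T^[j] x = x + (X.T^[j] y - y)) ∧ ContinuousAt (birkhoffSum X.T f j) y := by
  induction j with
  | zero =>
    refine ⟨by simp, ?_⟩
    rw [birkhoffSum_zero']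
    exact continuousAt_const (y := (0 : ℝ))
  | succ j ih =>
    obtain ⟨h1, h2⟩ := ih fun s hs => hj s (by omega)
    have hmem := iterate_T_mem hp hy j
    obtain ⟨β, hβ⟩ := exists_mem_J hmem
    have hβ' := mem_Ioo_of_ne hβ (hj j (by omega) β)
    have hcont : ContinuousAt (X.T^[j]) y := by
      refine ContinuousAt.congr ?_ (h1.mono fun x hx => hx.symm)
      fun_prop
    have hnhds := hcont.eventually (isOpen_Ioo.mem_nhds hβ')
    constructor
    · filter_upwards [h1, hnhds] with x hx1 hx2
      rw [Function.iterate_succ_apply', Function.iterate_succ_apply',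
        T_eq hp (Ioo_subset_Ico_self hx2 : _ ∈ X.J β), T_eq hp hβ, hx1]
      ring
    · have h3 : ContinuousAt (fun x => f (X.T^[j] x)) y :=
        ContinuousAt.comp (f := X.T^[j]) ((hf β).continuousAt (isOpen_Ioo.mem_nhds hβ')) hcont
      have : birkhoffSum X.T f (j + 1) = fun x => birkhoffSum X.T f j x + f (X.T^[j] x) := by
        ext x
        exact birkhoffSum_succ _ _ _ _
      rw [this]
      exact h2.add h3

theorem solution_iterate (hp : ∀ α, 0 < X.len α) {f v : ℝ → ℝ}
    (hv : ∀ x ∈ Ico 0 X.total, f x = v (X.T x) - v x) {x : ℝ} (hx : x ∈ Ico 0 X.total) (i : ℕ) :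
    v (X.T^[i] x) = v x + birkhoffSum X.T f i x := by
  induction i with
  | zero => simp
  | succ i ih =>
    rw [birkhoffSum_succ, hv _ (iterate_T_mem hp hx i), Function.iterate_succ_apply', ih]
    ring

/-- The first interval in the bottom row is not the first one in the top row. -/
theorem top_bot_zero_ne (hm : 1 ≤ m) (hX : X.IsIET) : X.top (X.bot.symm 0) ≠ 0 := by
  intro h
  refine hX.2 1 le_rfl (by omega) ?_
  have h1 : {i : Fin (m + 1) | i.val < 1} = {0} := by
    ext i
    change i.val < 1 ↔ i = 0
    rw [Fin.ext_iff, Fin.val_zero]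
    omega
  have h2 : X.top.symm 0 = X.bot.symm 0 := by rw [Equiv.symm_apply_eq, h]
  rw [h1, image_singleton, h2, X.bot.apply_symm_apply]

theorem T_left_bot_zero (hp : ∀ α, 0 < X.len α) : X.T (X.left (X.bot.symm 0)) = 0 := by
  rw [T_eq' hp (left_mem_J hp _)]
  have : X.botLeft (X.bot.symm 0) = 0 := placeLeft_zero (X.bot.apply_symm_apply _)
  rw [this]
  ring

/-- Writing `v` near `z` as its value on the base plus or minus a continuous Birkhoff sum bounds the
oscillation at `z` by `2η`. The transport to the base goes backwards or forwards along the orbit,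
whichever avoids the end points of the exchanged intervals. -/
theorem solution_eventually_close {Y : IETData A m} {q : A → ℕ} (h : Tower X Y q) (hm : 1 ≤ m)
    (hX : X.IsIET) (hK : X.Keane) {f v : ℝ → ℝ}
    (hf : ∀ α, ContinuousOn f (Ioo (X.left α) (X.right α)))
    (hv : ∀ x ∈ Ico 0 X.total, f x = v (X.T x) - v x) {η : ℝ}
    (hη : ∀ x ∈ Ico 0 Y.total, |v x| ≤ η) {z : ℝ} (hz : z ∈ Ico 0 X.total) {ε : ℝ} (hε : 0 < ε) :
    ∀ᶠ x in 𝓝[Ico 0 X.total] z, |v x - v z| ≤ 2 * η + ε := by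
  have hp := h.pos_base
  have : Nonempty A := ⟨X.top.symm 0⟩
  have hYt := total_pos h.pos
  rcases eq_or_lt_of_le hz.1 with rfl | hz0
  · filter_upwards [nhdsWithin_le_nhds (Iio_mem_nhds hYt), self_mem_nhdsWithin] with x hx1 hx2
    have h1 := hη x ⟨hx2.1, hx1⟩
    have h2 := hη 0 ⟨le_rfl, hYt⟩
    rw [abs_le] at *
    constructor <;> linarith
  obtain ⟨α, z', hz', i, hi, rfl⟩ := h.cover z hz
  have hz'X := h.mem_base hz'
  -- If the orbit segment from the base to `z` avoids all end points, nearby points are pulled back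
  -- to the base.
  by_cases hc : ∀ s < i, ∀ β, X.T^[s] z' ≠ X.left β
  · obtain ⟨h1, h2⟩ := iterate_local hp hf hz'X hc
    have hz'0 : 0 < z' := by
      refine lt_of_le_of_ne hz'X.1 fun h0 => ?_
      rcases Nat.eq_zero_or_pos i with rfl | hi0
      · exact hz0.ne h0
      · refine hc 0 hi0 (X.top.symm 0) ?_
        rw [left_first (X.top.apply_symm_apply _)]
        exact h0.symm
    have h3 : ∀ᶠ x in 𝓝 z', x ∈ Ioo 0 Y.total :=
      isOpen_Ioo.mem_nhds ⟨hz'0, (J_subset h.pos α hz').2⟩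
    have h4 : ∀ᶠ x in 𝓝 z', |birkhoffSum X.T f i x - birkhoffSum X.T f i z'| < ε := by
      have := h2.eventually (Metric.ball_mem_nhds _ hε)
      simpa [Real.dist_eq] using this
    have h5 : Tendsto (fun x => x - (X.T^[i] z' - z')) (𝓝 (X.T^[i] z')) (𝓝 z') := by
      have : Tendsto (fun x => x - (X.T^[i] z' - z')) (𝓝 (X.T^[i] z'))
          (𝓝 (X.T^[i] z' - (X.T^[i] z' - z'))) := tendsto_id.sub_const _
      rwa [sub_sub_cancel] at this
    filter_upwards [nhdsWithin_le_nhds (h5.eventually (h1.and (h3.and h4)))] with x hx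
    obtain ⟨hx1, hx3, hx4⟩ := hx
    rw [sub_add_cancel] at hx1
    have hxX : x - (X.T^[i] z' - z') ∈ Ico 0 X.total := ⟨hx3.1.le, hx3.2.trans_le h.total_le⟩
    have e1 := solution_iterate hp hv hxX i
    have e2 := solution_iterate hp hv hz'X i
    rw [hx1] at e1
    have b1 := hη _ ⟨hx3.1.le, hx3.2⟩
    have b2 := hη z' (J_subset h.pos α hz')
    rw [e1, e2]
    rw [abs_le] at *
    rw [abs_lt] at hx4
    constructor <;> linarith
  · push Not at hc
    obtain ⟨s, hs, β, hβ⟩ := hc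
    -- One end point has been met before `z`. By Keane no nonzero end point can follow, and `0` lies
    -- in the base, which is not met before the return; so the way forward is free.
    have hj : ∀ s' < q α - i, ∀ γ, X.T^[s'] (X.T^[i] z') ≠ X.left γ := by
      intro s' hs' γ heq
      rw [← Function.iterate_add_apply] at heq
      by_cases hγ : X.top γ = 0
      · rw [left_first hγ] at heq
        refine h.not_mem α z' hz' (s' + i) (by omega) (by omega) ?_
        rw [heq]
        exact ⟨le_rfl, hYt⟩
      · refine hK (s' + i - s) (by omega) β γ hγ ?_
        rw [← hβ, ← Function.iterate_add_apply, ← heq]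
        exact congrArg (fun n => X.T^[n] z') (by omega)
    obtain ⟨h1, h2⟩ := iterate_local hp hf hz hj
    have hret : X.T^[q α - i] (X.T^[i] z') = X.T^[q α] z' := by
      rw [← Function.iterate_add_apply]
      congr 2
      omega
    have hmem : X.T^[q α - i] (X.T^[i] z') ∈ Ico 0 Y.total := by
      rw [hret, h.ret α z' hz']
      exact T_mem h.pos (J_subset h.pos α hz')
    -- Returning exactly to `0` would make the point before it the left end of the first bottom
    -- interval, again a connection. So the return point is interior to the base and its neighbours
    -- return with it.
    have hne : X.T^[q α - i] (X.T^[i] z') ≠ 0 := by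
      intro h0
      rw [hret, show q α = (q α - 1) + 1 by omega, Function.iterate_succ_apply',
        ← T_left_bot_zero hp] at h0
      have h3 := T_injOn hp (iterate_T_mem hp hz'X _)
        (J_subset hp _ (left_mem_J hp _)) h0
      refine hK (q α - 1 - s) (by omega) β _ (top_bot_zero_ne hm hX) ?_
      rw [← h3, ← hβ, ← Function.iterate_add_apply]
      congr 2
      omega
    have hcont : ContinuousAt (X.T^[q α - i]) (X.T^[i] z') := by
      refine ContinuousAt.congr ?_ (h1.mono fun x hx => hx.symm)
      fun_prop
    have h3 := hcont.eventually (isOpen_Ioo.mem_nhds ⟨lt_of_le_of_ne hmem.1 hne.symm, hmem.2⟩)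
    have h4 : ∀ᶠ x in 𝓝 (X.T^[i] z'), |birkhoffSum X.T f (q α - i) x -
        birkhoffSum X.T f (q α - i) (X.T^[i] z')| < ε := by
      have := h2.eventually (Metric.ball_mem_nhds _ hε)
      simpa [Real.dist_eq] using this
    filter_upwards [nhdsWithin_le_nhds h3, nhdsWithin_le_nhds h4, self_mem_nhdsWithin]
      with x hx3 hx4 hxX
    have e1 := solution_iterate hp hv hxX (q α - i)
    have e2 := solution_iterate hp hv hz (q α - i)
    have b1 := hη _ ⟨hx3.1.le, hx3.2⟩
    have b2 := hη _ hmem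
    rw [e1] at b1
    rw [e2] at b2
    rw [abs_le] at *
    rw [abs_lt] at hx4
    constructor <;> linarith

/-- Invariant functions that vanish in the limit at `0` vanish. -/
theorem eq_zero_of_invariant {Y : ℕ → IETData A m} {q : ℕ → A → ℕ}
    (h : ∀ k, Tower X (Y k) (q k)) {w : ℝ → ℝ}
    (hw : ∀ x ∈ Ico 0 X.total, w (X.T x) = w x) {η : ℕ → ℝ} (hη : Tendsto η atTop (𝓝 0))
    (hwη : ∀ k, ∀ x ∈ Ico 0 (Y k).total, |w x| ≤ η k) {x : ℝ} (hx : x ∈ Ico 0 X.total) :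
    w x = 0 := by
  have hinv : ∀ y ∈ Ico 0 X.total, ∀ i, w (X.T^[i] y) = w y := by
    intro y hy i
    induction i with
    | zero => rfl
    | succ i ih => rw [Function.iterate_succ_apply', hw _ (iterate_T_mem (h 0).pos_base hy i), ih]
  have : ∀ k, |w x| ≤ η k := by
    intro k
    obtain ⟨α, y, hy, i, hi, rfl⟩ := (h k).cover x hx
    rw [hinv y ((h k).mem_base hy) i]
    exact hwη k y (J_subset (h k).pos α hy)
  have h0 : |w x| ≤ 0 := ge_of_tendsto' hη this
  exact abs_eq_zero.1 (le_antisymm h0 (abs_nonneg _))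

end Continuity

/-! ### Existence of continuous solutions -/

namespace Renorm

variable {X : IETData A m} {Y : ℕ → IETData A m} {q p : ℕ → A → ℕ} {lam σ B : ℝ}

/-- The tower sums form a geometrically Cauchy sequence. Below the top floor they satisfy the
equation exactly; on the top floor the sum restarts at `0`, and the discrepancy is a special sum
tending to `0`. -/
theorem exists_solution (h : Renorm X Y q p lam σ B) (hm : 1 ≤ m)
    (hX : X.IsIET) (hK : X.Keane) {f : ℝ → ℝ}
    (hfc : ∀ α, ContinuousOn f (Ioo (X.left α) (X.right α))) {D ρ : ℝ} (hD : 0 ≤ D) (hρ : 0 < ρ)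
    (hσ : 0 < σ)
    (hf : ∀ (k : ℕ) α, ∀ y ∈ (Y k).J α, |birkhoffSum X.T f (q k α) y| ≤
      D * Real.exp (-(ρ + σ) * k)) :
    ∃ v : ℝ → ℝ, v 0 = 0 ∧ ContinuousOn v (Ico 0 X.total) ∧
      (∀ x ∈ Ico 0 X.total, f x = v (X.T x) - v x) ∧
      ∀ k, ∀ x ∈ Ico 0 X.total, |v x - towerSum X (Y k) (q k) f x| ≤
        B * D / (1 - Real.exp (-ρ)) * Real.exp (-ρ) ^ k := by
  have hne : Nonempty A := ⟨X.top.symm 0⟩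
  have hp := hX.1
  have hr : Real.exp (-ρ) < 1 := Real.exp_lt_one_iff.2 (by linarith)
  have hdist : ∀ x ∈ Ico 0 X.total, ∀ k, dist (towerSum X (Y k) (q k) f x)
      (towerSum X (Y (k + 1)) (q (k + 1)) f x) ≤ B * D * Real.exp (-ρ) ^ k := by
    intro x hx k
    rw [dist_comm, Real.dist_eq]
    exact h.abs_towerSum_succ_sub_le hD hf k hx
  have hlim : ∀ x, ∃ L, x ∈ Ico 0 X.total →
      Tendsto (fun k => towerSum X (Y k) (q k) f x) atTop (𝓝 L) := by
    intro x
    by_cases hx : x ∈ Ico 0 X.total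
    · obtain ⟨L, hL⟩ := cauchySeq_tendsto_of_complete
        (cauchySeq_of_le_geometric _ _ hr (hdist x hx))
      exact ⟨L, fun _ => hL⟩
    · exact ⟨0, fun h => absurd h hx⟩
  choose v hv using hlim
  have hbound : ∀ k, ∀ x ∈ Ico 0 X.total, |v x - towerSum X (Y k) (q k) f x| ≤
      B * D / (1 - Real.exp (-ρ)) * Real.exp (-ρ) ^ k := by
    intro k x hx
    have := dist_le_of_le_geometric_of_tendsto _ _ hr (hdist x hx) (hv x hx) k
    rw [dist_comm, Real.dist_eq] at this
    refine this.trans (le_of_eq ?_)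
    ring
  have h0 : (0 : ℝ) ∈ Ico 0 X.total := ⟨le_rfl, total_pos hp⟩
  have hcoh : ∀ x ∈ Ico 0 X.total, f x = v (X.T x) - v x := by
    intro x hx
    have h1 := (hv _ (T_mem hp hx)).sub (hv x hx)
    refine tendsto_nhds_unique ?_ h1
    have hpow : Tendsto (fun k : ℕ => D * Real.exp (-(ρ + σ)) ^ k) atTop (𝓝 (D * 0)) :=
      (tendsto_pow_atTop_nhds_zero_of_lt_one (Real.exp_pos _).le
        (Real.exp_lt_one_iff.2 (by linarith))).const_mul D
    rw [mul_zero] at hpow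
    rw [tendsto_iff_dist_tendsto_zero]
    refine squeeze_zero (fun _ => dist_nonneg) (fun k => ?_) hpow
    obtain ⟨α, y, hy, i, hi, rfl⟩ := (h.tower k).cover x hx
    rw [← Function.iterate_succ_apply' X.T, (h.tower k).towerSum_eq f hy hi, Real.dist_eq]
    by_cases hi' : i + 1 < q k α
    · rw [(h.tower k).towerSum_eq f hy hi', birkhoffSum_succ, add_sub_cancel_left, sub_self,
        abs_zero]
      positivity
    · have hq : i + 1 = q k α := by omega
      rw [Nat.succ_eq_add_one, hq, (h.tower k).ret α y hy, (h.tower k).towerSum_base f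
        (T_mem (h.tower k).pos (J_subset (h.tower k).pos α hy))]
      have h2 := hf k α y hy
      rw [← hq, birkhoffSum_succ] at h2
      rw [← Real.exp_nat_mul, mul_comm (k : ℝ), zero_sub, ← neg_add', abs_neg]
      exact h2
  refine ⟨v, ?_, ?_, hcoh, hbound⟩
  · refine tendsto_nhds_unique (hv 0 h0) ?_
    have : ∀ k, towerSum X (Y k) (q k) f 0 = 0 := fun k =>
      (h.tower k).towerSum_base f ⟨le_rfl, total_pos (h.tower k).pos⟩
    simp only [this]
    exact tendsto_const_nhds
  · intro z hz
    have hpow : Tendsto (fun k : ℕ => 2 * (B * D / (1 - Real.exp (-ρ)) * Real.exp (-ρ) ^ k)) atTop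
        (𝓝 (2 * (B * D / (1 - Real.exp (-ρ)) * 0))) :=
      ((tendsto_pow_atTop_nhds_zero_of_lt_one (Real.exp_pos _).le hr).const_mul _).const_mul _
    rw [mul_zero, mul_zero] at hpow
    refine Metric.tendsto_nhds.2 fun ε hε => ?_
    obtain ⟨k, hk⟩ := (hpow.eventually (gt_mem_nhds (half_pos hε))).exists
    -- On the base of level `k` the tower sum is `0`, so the error estimate is itself a bound for
    -- `v` there.
    have := solution_eventually_close (h.tower k) hm hX hK hfc hcoh
      (η := B * D / (1 - Real.exp (-ρ)) * Real.exp (-ρ) ^ k) ?_ hz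
      (half_pos hε |> half_pos)
    · filter_upwards [this] with x hx
      rw [Real.dist_eq]
      linarith
    · intro x hx
      have h1 := hbound k x ⟨hx.1, hx.2.trans_le (h.tower k).total_le⟩
      rwa [(h.tower k).towerSum_base f hx, sub_zero] at h1

end Renorm

end IETData

/-! ### One-variable estimates for power singularities -/

/-- A function whose derivative is dominated by the derivative of `Φ` varies at most like `Φ`. -/
theorem abs_sub_le_of_hasDerivAt {F F' Φ Φ' : ℝ → ℝ} {l r : ℝ}
    (hF : ∀ s ∈ Ioo l r, HasDerivAt F (F' s) s) (hΦ : ∀ s ∈ Ioo l r, HasDerivAt Φ (Φ' s) s)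
    (hle : ∀ s ∈ Ioo l r, |F' s| ≤ Φ' s) {x y : ℝ} (hx : x ∈ Ioo l r) (hy : y ∈ Ioo l r)
    (hxy : x ≤ y) : |F y - F x| ≤ Φ y - Φ x := by
  have h1 : MonotoneOn (Φ - F) (Ioo l r) := by
    refine monotoneOn_of_deriv_nonneg (convex_Ioo l r)
      (fun s hs => ((hΦ s hs).sub (hF s hs)).continuousAt.continuousWithinAt) ?_ ?_
    · rw [interior_Ioo]
      exact fun s hs => ((hΦ s hs).sub (hF s hs)).differentiableAt.differentiableWithinAt
    · rw [interior_Ioo]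
      intro s hs
      rw [((hΦ s hs).sub (hF s hs)).deriv]
      linarith [le_abs_self (F' s), hle s hs]
  have h2 : MonotoneOn (Φ + F) (Ioo l r) := by
    refine monotoneOn_of_deriv_nonneg (convex_Ioo l r)
      (fun s hs => ((hΦ s hs).add (hF s hs)).continuousAt.continuousWithinAt) ?_ ?_
    · rw [interior_Ioo]
      exact fun s hs => ((hΦ s hs).add (hF s hs)).differentiableAt.differentiableWithinAt
    · rw [interior_Ioo]
      intro s hs
      rw [((hΦ s hs).add (hF s hs)).deriv]
      linarith [neg_abs_le (F' s), hle s hs]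
  have h3 := h1 hx hy hxy
  have h4 := h2 hx hy hxy
  simp only [Pi.sub_apply, Pi.add_apply] at h3 h4
  rw [abs_le]
  constructor <;> linarith

theorem hasDerivAt_sub_rpow {l s c : ℝ} (h : l < s) :
    HasDerivAt (fun s => (s - l) ^ c) (c * (s - l) ^ (c - 1)) s := by
  have := ((hasDerivAt_id s).sub_const l).rpow_const (p := c) (Or.inl (sub_pos.2 h).ne')
  simpa using this

theorem hasDerivAt_rpow_sub {r s c : ℝ} (h : s < r) :
    HasDerivAt (fun s => (r - s) ^ c) (-(c * (r - s) ^ (c - 1))) s := by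
  have := ((hasDerivAt_id s).const_sub r).rpow_const (p := c) (Or.inl (sub_pos.2 h).ne')
  simpa using this

/-- Integrating a power singularity of order `1 + b` at the end points. -/
theorem abs_le_of_deriv_le_rpow {g g' : ℝ → ℝ} {l r b M x₀ : ℝ} (hb : 0 < b) (hb1 : b < 1)
    (hM : 0 ≤ M) (hg : ∀ s ∈ Ioo l r, HasDerivAt g (g' s) s)
    (hle : ∀ s ∈ Ioo l r, |g' s| ≤ M * ((s - l) ^ (-1 - b) + (r - s) ^ (-1 - b)))
    (hx₀ : l + (r - l) / 4 ≤ x₀) (hx₀' : x₀ ≤ r - (r - l) / 4) {x : ℝ} (hx : x ∈ Ioo l r) :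
    |g x| ≤ |g x₀| + 5 * M / b * ((x - l) ^ (-b) + (r - x) ^ (-b)) := by
  have hlr : l < r := hx.1.trans hx.2
  have hx₀m : x₀ ∈ Ioo l r := ⟨by linarith, by linarith⟩
  set Φ : ℝ → ℝ := fun s => M / b * ((r - s) ^ (-b) - (s - l) ^ (-b)) with hΦ
  have hΦd : ∀ s ∈ Ioo l r, HasDerivAt Φ (M * ((s - l) ^ (-1 - b) + (r - s) ^ (-1 - b))) s := by
    intro s hs
    have := ((hasDerivAt_rpow_sub (c := -b) hs.2).sub
      (hasDerivAt_sub_rpow (c := -b) hs.1)).const_mul (M / b)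
    refine HasDerivAt.congr_deriv this ?_
    rw [show -b - 1 = -1 - b by ring]
    field_simp
    ring
  have hdiff : |g x - g x₀| ≤ |Φ x - Φ x₀| := by
    rcases le_total x x₀ with h | h
    · have := abs_sub_le_of_hasDerivAt hg hΦd hle hx hx₀m h
      rw [abs_sub_comm, abs_sub_comm (Φ x)]
      exact this.trans (le_abs_self _)
    · exact (abs_sub_le_of_hasDerivAt hg hΦd hle hx₀m hx h).trans (le_abs_self _)
  -- Since `x₀` is in the middle half, its terms are at most `4 ^ b ≤ 4` times those at `x`;
  -- together with the latter this gives the factor `5`.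
  have h4 : ∀ {u v : ℝ}, 0 < u → u ≤ r - l → (r - l) / 4 ≤ v → v ^ (-b) ≤ 4 * u ^ (-b) := by
    intro u v hu hur hv
    have h1 : v ^ (-b) ≤ (u / 4) ^ (-b) :=
      Real.rpow_le_rpow_of_nonpos (by linarith) (by linarith) (by linarith)
    refine h1.trans ?_
    rw [Real.div_rpow hu.le (by norm_num), Real.rpow_neg (by norm_num : (0 : ℝ) ≤ 4), div_inv_eq_mul,
      mul_comm]
    gcongr
    calc (4 : ℝ) ^ b ≤ 4 ^ (1 : ℝ) := Real.rpow_le_rpow_of_exponent_le (by norm_num) hb1.le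
      _ = 4 := by norm_num
  have e1 := h4 (u := x - l) (v := x₀ - l) (by linarith [hx.1]) (by linarith [hx.2]) (by linarith)
  have e2 := h4 (u := r - x) (v := r - x₀) (by linarith [hx.2]) (by linarith [hx.1]) (by linarith)
  have p1 : 0 ≤ (x - l) ^ (-b) := Real.rpow_nonneg (by linarith [hx.1]) _
  have p2 : 0 ≤ (r - x) ^ (-b) := Real.rpow_nonneg (by linarith [hx.2]) _
  have p3 : 0 ≤ (x₀ - l) ^ (-b) := Real.rpow_nonneg (by linarith) _
  have p4 : 0 ≤ (r - x₀) ^ (-b) := Real.rpow_nonneg (by linarith) _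
  have hMb : 0 ≤ M / b := by positivity
  have hfin : |Φ x - Φ x₀| ≤ 5 * M / b * ((x - l) ^ (-b) + (r - x) ^ (-b)) := by
    have : Φ x - Φ x₀ = M / b * ((r - x) ^ (-b) - (x - l) ^ (-b) - (r - x₀) ^ (-b) +
      (x₀ - l) ^ (-b)) := by rw [hΦ]; ring
    rw [this, abs_mul, abs_of_nonneg hMb, mul_div_assoc, mul_comm 5 (M / b), mul_assoc]
    refine mul_le_mul_of_nonneg_left ?_ hMb
    rw [abs_le]
    constructor <;> linarith
  have := abs_sub_abs_le_abs_sub (g x) (g x₀)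
  linarith

/-- Integrating a power singularity of order `b < 1` at the end points. -/
theorem abs_sub_le_of_deriv_le_rpow {F F' : ℝ → ℝ} {l r b M G : ℝ} (hb : 0 ≤ b) (hb1 : b < 1)
    (hM : 0 ≤ M) (hF : ∀ s ∈ Ioo l r, HasDerivAt F (F' s) s)
    (hle : ∀ s ∈ Ioo l r, |F' s| ≤ G + M * ((s - l) ^ (-b) + (r - s) ^ (-b)))
    {x y : ℝ} (hx : x ∈ Ioo l r) (hy : y ∈ Ioo l r) (hxy : x ≤ y) :
    |F y - F x| ≤ G * (y - x) + 2 * M / (1 - b) * (y - x) ^ (1 - b) := by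
  have hb' : 0 < 1 - b := by linarith
  set Φ : ℝ → ℝ := fun s => G * s + M / (1 - b) * ((s - l) ^ (1 - b) - (r - s) ^ (1 - b)) with hΦ
  have hΦd : ∀ s ∈ Ioo l r, HasDerivAt Φ (G + M * ((s - l) ^ (-b) + (r - s) ^ (-b))) s := by
    intro s hs
    have := ((hasDerivAt_id s).const_mul G).add (((hasDerivAt_sub_rpow (c := 1 - b) hs.1).sub
      (hasDerivAt_rpow_sub (c := 1 - b) hs.2)).const_mul (M / (1 - b)))
    refine HasDerivAt.congr_deriv this ?_
    rw [show 1 - b - 1 = -b by ring]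
    field_simp
    ring
  refine (abs_sub_le_of_hasDerivAt hF hΦd hle hx hy hxy).trans ?_
  -- Subadditivity of the power `1 - b ∈ (0, 1]`.
  have hsub : ∀ {u v : ℝ}, 0 ≤ u → u ≤ v → v ^ (1 - b) - u ^ (1 - b) ≤ (v - u) ^ (1 - b) := by
    intro u v hu huv
    have := Real.rpow_add_le_add_rpow (sub_nonneg.2 huv) hu hb'.le (by linarith)
    rw [sub_add_cancel] at this
    linarith
  have h1 := hsub (u := x - l) (v := y - l) (by linarith [hx.1]) (by linarith)
  have h2 := hsub (u := r - y) (v := r - x) (by linarith [hy.2]) (by linarith)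
  rw [sub_sub_sub_cancel_right] at h1
  rw [sub_sub_sub_cancel_left] at h2
  have : Φ y - Φ x = G * (y - x) + M / (1 - b) * (((y - l) ^ (1 - b) - (x - l) ^ (1 - b)) +
      ((r - x) ^ (1 - b) - (r - y) ^ (1 - b))) := by rw [hΦ]; ring
  rw [this]
  have h3 : M / (1 - b) * (((y - l) ^ (1 - b) - (x - l) ^ (1 - b)) +
      ((r - x) ^ (1 - b) - (r - y) ^ (1 - b))) ≤ M / (1 - b) * (2 * (y - x) ^ (1 - b)) :=
    mul_le_mul_of_nonneg_left (by linarith) (by positivity)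
  have h4 : M / (1 - b) * (2 * (y - x) ^ (1 - b)) = 2 * M / (1 - b) * (y - x) ^ (1 - b) := by ring
  linarith

/-- A bounded function whose second derivative has power singularities of order `1 + b` at the end
points is Hölder continuous with exponent `1 - b`. -/
theorem abs_sub_le_of_second_deriv {F F' F'' : ℝ → ℝ} {l r b M K : ℝ} (hb : 0 < b) (hb1 : b < 1)
    (hM : 0 ≤ M) (hF : ∀ s ∈ Ioo l r, HasDerivAt F (F' s) s)
    (hF' : ∀ s ∈ Ioo l r, HasDerivAt F' (F'' s) s)
    (hle : ∀ s ∈ Ioo l r, |F'' s| ≤ M * ((s - l) ^ (-1 - b) + (r - s) ^ (-1 - b)))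
    (hK : ∀ s ∈ Ioo l r, |F s| ≤ K) {x y : ℝ} (hx : x ∈ Ioo l r) (hy : y ∈ Ioo l r)
    (hxy : x ≤ y) :
    |F y - F x| ≤ (4 * K * (r - l) ^ (b - 1) + 10 * M / (b * (1 - b))) * (y - x) ^ (1 - b) := by
  have hlr : l < r := hx.1.trans hx.2
  have hL : 0 < r - l := by linarith
  have hb' : 0 < 1 - b := by linarith
  have hmem : ∀ s ∈ Icc (l + (r - l) / 4) (r - (r - l) / 4), s ∈ Ioo l r := fun s hs =>
    ⟨by linarith [hs.1], by linarith [hs.2]⟩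
  -- The sup bound on `F` yields, by the mean value theorem on the middle half, a point where `F'`
  -- is at most `4K/(r - l)`. This is the constant for the first integration.
  obtain ⟨x₀, hx₀, hslope⟩ := exists_hasDerivAt_eq_slope F F'
    (show l + (r - l) / 4 < r - (r - l) / 4 by linarith)
    (fun s hs => (hF s (hmem s hs)).continuousAt.continuousWithinAt)
    (fun s hs => hF s (hmem s (Ioo_subset_Icc_self hs)))
  have h0 : |F' x₀| ≤ 4 * K / (r - l) := by
    have k1 := hK _ (hmem _ (left_mem_Icc.2 (by linarith)))
    have k2 := hK _ (hmem _ (right_mem_Icc.2 (by linarith)))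
    rw [hslope, abs_div, abs_of_pos (by linarith : 0 < r - (r - l) / 4 - (l + (r - l) / 4)),
      div_le_div_iff₀ (by linarith) hL]
    have : |F (r - (r - l) / 4) - F (l + (r - l) / 4)| ≤ 2 * K := by
      rw [abs_le] at *
      constructor <;> linarith
    calc |F (r - (r - l) / 4) - F (l + (r - l) / 4)| * (r - l) ≤ 2 * K * (r - l) := by gcongr
      _ = _ := by ring
  have h1 : ∀ s ∈ Ioo l r, |F' s| ≤ 4 * K / (r - l) +
      5 * M / b * ((s - l) ^ (-b) + (r - s) ^ (-b)) := fun s hs =>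
    (abs_le_of_deriv_le_rpow hb hb1 hM hF' hle hx₀.1.le hx₀.2.le hs).trans (by linarith)
  have h2 := abs_sub_le_of_deriv_le_rpow hb.le hb1 (by positivity) hF h1 hx hy hxy
  have hK0 : 0 ≤ K := (abs_nonneg _).trans (hK x hx)
  have h3 : y - x ≤ (r - l) ^ b * (y - x) ^ (1 - b) := by
    have hyx : 0 ≤ y - x := by linarith
    calc y - x = (y - x) ^ (b + (1 - b)) := by rw [add_sub_cancel, Real.rpow_one]
      _ = (y - x) ^ b * (y - x) ^ (1 - b) := Real.rpow_add_of_nonneg hyx hb.le hb'.le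
      _ ≤ (r - l) ^ b * (y - x) ^ (1 - b) := by
        refine mul_le_mul_of_nonneg_right ?_ (Real.rpow_nonneg hyx _)
        exact Real.rpow_le_rpow hyx (by linarith [hx.1, hy.2]) hb.le
  refine h2.trans ?_
  have h4 : 4 * K / (r - l) * (y - x) ≤ 4 * K * (r - l) ^ (b - 1) * (y - x) ^ (1 - b) := by
    calc 4 * K / (r - l) * (y - x) ≤ 4 * K / (r - l) * ((r - l) ^ b * (y - x) ^ (1 - b)) := by
          gcongr
      _ = _ := by
        rw [Real.rpow_sub hL, Real.rpow_one]
        ring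
  have h5 : 2 * (5 * M / b) / (1 - b) * (y - x) ^ (1 - b) =
      10 * M / (b * (1 - b)) * (y - x) ^ (1 - b) := by
    congr 1
    field_simp
    ring
  rw [add_mul]
  linarith

/-- Sums of negative powers over separated points. -/
theorem sum_rpow_le_of_separated {ι : Type*} (s : Finset ι) (d : ι → ℝ) {t b : ℝ} (ht : 0 < t)
    (hb : 0 < b) (hd : ∀ i ∈ s, t ≤ d i) (hsep : ∀ i ∈ s, ∀ j ∈ s, i ≠ j → t ≤ |d i - d j|) :
    ∑ i ∈ s, d i ^ (-1 - b) ≤ t ^ (-1 - b) * ∑' n : ℕ, (n : ℝ) ^ (-1 - b) := by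
  have hsum : Summable fun n : ℕ => (n : ℝ) ^ (-1 - b) := Real.summable_nat_rpow.2 (by linarith)
  -- Rounding `d i / t` down gives distinct positive integers, so the sum is compared with the
  -- series for `ζ(1 + b)`.
  have hinj : InjOn (fun i => ⌊d i / t⌋₊) s := by
    intro i hi j hj hij
    by_contra hne
    have hi0 : 0 ≤ d i / t := div_nonneg (ht.le.trans (hd i hi)) ht.le
    have hj0 : 0 ≤ d j / t := div_nonneg (ht.le.trans (hd j hj)) ht.le
    have h1 := Nat.floor_le hi0
    have h2 := Nat.lt_floor_add_one (d i / t)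
    have h3 := Nat.floor_le hj0
    have h4 := Nat.lt_floor_add_one (d j / t)
    simp only at hij
    rw [hij] at h1 h2
    have h5 : |d i / t - d j / t| < 1 := by
      rw [abs_lt]
      constructor <;> linarith
    rw [← sub_div, abs_div, abs_of_pos ht, div_lt_one ht] at h5
    exact absurd (hsep i hi j hj hne) (not_le.2 h5)
  calc ∑ i ∈ s, d i ^ (-1 - b)
      ≤ ∑ i ∈ s, t ^ (-1 - b) * ((⌊d i / t⌋₊ : ℕ) : ℝ) ^ (-1 - b) := by
        refine Finset.sum_le_sum fun i hi => ?_
        have h0 : 1 ≤ d i / t := (one_le_div ht).2 (hd i hi)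
        have h1 : (1 : ℝ) ≤ (⌊d i / t⌋₊ : ℕ) := by exact_mod_cast (Nat.one_le_floor_iff _).2 h0
        have h2 := Nat.floor_le (zero_le_one.trans h0)
        rw [le_div_iff₀ ht] at h2
        rw [← Real.mul_rpow ht.le (by linarith)]
        refine Real.rpow_le_rpow_of_nonpos (by positivity) (by linarith) (by linarith)
    _ = t ^ (-1 - b) * ∑ n ∈ s.image fun i => ⌊d i / t⌋₊, (n : ℝ) ^ (-1 - b) := by
        rw [Finset.sum_image hinj, Finset.mul_sum]
    _ ≤ t ^ (-1 - b) * ∑' n : ℕ, (n : ℝ) ^ (-1 - b) := by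
        refine mul_le_mul_of_nonneg_left ?_ (Real.rpow_nonneg ht.le _)
        exact hsum.sum_le_tsum _ fun n _ => Real.rpow_nonneg (Nat.cast_nonneg n) _

/-- Let the left point tend to `x` from the right; `y` is already interior unless it coincides with
`x`. -/
theorem abs_sub_le_Ico_of_Ioo {F Ψ : ℝ → ℝ} {l r : ℝ} (hF : ContinuousOn F (Ico l r))
    (hΨ : Continuous Ψ)
    (h : ∀ x ∈ Ioo l r, ∀ y ∈ Ioo l r, x ≤ y → |F y - F x| ≤ Ψ (y - x)) {x y : ℝ}
    (hx : x ∈ Ico l r) (hy : y ∈ Ico l r) (hxy : x ≤ y) : |F y - F x| ≤ Ψ (y - x) := by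
  have hlim : ∀ z ∈ Ico l r, Tendsto F (𝓝[>] z) (𝓝 (F z)) := fun z hz => by
    refine (hF z hz).mono_left (nhdsWithin_le_of_mem ?_)
    exact mem_of_superset (Ioo_mem_nhdsGT hz.2) fun w hw => ⟨hz.1.trans hw.1.le, hw.2⟩
  rcases eq_or_lt_of_le hxy with rfl | hlt
  · have h1 : Tendsto (fun w => |F w - F w|) (𝓝[>] x) (𝓝 |F x - F x|) :=
      ((hlim x hx).sub (hlim x hx)).abs
    have h2 : Tendsto (fun w : ℝ => Ψ (w - w)) (𝓝[>] x) (𝓝 (Ψ (x - x))) := by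
      simp only [sub_self]
      exact tendsto_const_nhds
    refine le_of_tendsto_of_tendsto h1 h2 ?_
    filter_upwards [Ioo_mem_nhdsGT hx.2] with w hw
    exact h w ⟨hx.1.trans_lt hw.1, hw.2⟩ w ⟨hx.1.trans_lt hw.1, hw.2⟩ le_rfl
  · have hy' : y ∈ Ioo l r := ⟨hx.1.trans_lt hlt, hy.2⟩
    have h1 : Tendsto (fun w => |F y - F w|) (𝓝[>] x) (𝓝 |F y - F x|) :=
      (tendsto_const_nhds.sub (hlim x hx)).abs
    have h2 : Tendsto (fun w => Ψ (y - w)) (𝓝[>] x) (𝓝 (Ψ (y - x))) :=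
      ((hΨ.comp (continuous_const.sub continuous_id)).tendsto x).mono_left nhdsWithin_le_nhds
    refine le_of_tendsto_of_tendsto h1 h2 ?_
    filter_upwards [Ioo_mem_nhdsGT hlt] with w hw
    exact h w ⟨hx.1.trans_lt hw.1, hw.2.trans hy.2⟩ y hy' hw.2.le

/-! ### Special Birkhoff sums of functions with power singularities -/

namespace IETData

variable {A : Type*} [Fintype A] [DecidableEq A] {m : ℕ}

/-- The open exchanged interval of `α`. -/
def Jo (X : IETData A m) (α : A) : Set ℝ := Ioo (X.left α) (X.right α)

theorem Jo_subset_J {X : IETData A m} (α : A) : X.Jo α ⊆ X.J α := Ioo_subset_Ico_self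

namespace Tower

variable {X Y : IETData A m} {q : A → ℕ}

/-- This is the containment of a floor in an exchanged interval in terms of end points: if the floor
ended too far to the right, one of its points would already be outside. -/
theorem floor_interval (h : Tower X Y q) {α : A} {i : ℕ} (hi : i < q α) :
    ∃ β c, (∀ x ∈ Y.J α, X.T^[i] x = x + c) ∧ X.left β ≤ Y.left α + c ∧
      Y.right α + c ≤ X.right β := by
  obtain ⟨β, c, hc⟩ := h.transl α i hi
  refine ⟨β, c, fun x hx => (hc x hx).1, (hc _ (left_mem_J h.pos α)).2.1, ?_⟩
  have hlt := left_lt_right h.pos α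
  by_contra! hcon
  have hx : max (Y.left α) (X.right β - c) ∈ Y.J α :=
    ⟨le_max_left _ _, max_lt hlt (by linarith)⟩
  have := (hc _ hx).2.2
  linarith [le_max_right (Y.left α) (X.right β - c)]

theorem hasDerivAt_birkhoffSum (h : Tower X Y q) {f f' : ℝ → ℝ}
    (hf : ∀ α, ∀ x ∈ X.Jo α, HasDerivAt f (f' x) x) {α : A} {n : ℕ} (hn : n ≤ q α) {x : ℝ}
    (hx : x ∈ Y.Jo α) : HasDerivAt (birkhoffSum X.T f n) (birkhoffSum X.T f' n x) x := by
  unfold birkhoffSum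
  refine HasDerivAt.fun_sum fun i hi => ?_
  obtain ⟨β, c, hc, h1, h2⟩ := h.floor_interval ((Finset.mem_range.1 hi).trans_le hn)
  have hmem : x + c ∈ X.Jo β := ⟨by linarith [hx.1], by linarith [hx.2]⟩
  have hd := (hf β _ hmem).comp_add_const x c
  rw [hc x (Jo_subset_J α hx)]
  refine hd.congr_of_eventuallyEq ?_
  filter_upwards [isOpen_Ioo.mem_nhds hx] with y hy
  rw [hc y (Jo_subset_J α hy)]

theorem continuousOn_birkhoffSum (h : Tower X Y q) {f : ℝ → ℝ}
    (hf : ∀ α, ContinuousOn f (X.J α)) {α : A} {n : ℕ} (hn : n ≤ q α) :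
    ContinuousOn (birkhoffSum X.T f n) (Y.J α) := by
  unfold birkhoffSum
  refine continuousOn_finsetSum _ fun i hi => ?_
  obtain ⟨β, c, hc⟩ := h.transl α i ((Finset.mem_range.1 hi).trans_le hn)
  have h1 : ContinuousOn (fun x => f (x + c)) (Y.J α) :=
    (hf β).comp (continuousOn_id.add continuousOn_const) fun x hx => (hc x hx).2
  exact h1.congr fun x hx => by rw [(hc x hx).1]

/-- Floors of one tower are translates of the same interval, and being disjoint they are shifted by
at least its length. -/
theorem floor_separated (h : Tower X Y q) {α : A} {i j : ℕ} (hi : i < q α) (hj : j < q α)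
    (hij : i ≠ j) {x : ℝ} (hx : x ∈ Y.J α) :
    Y.right α - Y.left α ≤ |X.T^[i] x - X.T^[j] x| := by
  obtain ⟨-, c, hc, -⟩ := h.floor_interval hi
  obtain ⟨-, d, hd, -⟩ := h.floor_interval hj
  rw [hc x hx, hd x hx, add_sub_add_left_eq_sub]
  by_contra! hlt
  rw [abs_lt] at hlt
  have hl := left_lt_right h.pos α
  have h1 : max (Y.left α) (Y.left α + d - c) ∈ Y.J α :=
    ⟨le_max_left _ _, max_lt hl (by linarith)⟩
  have h2 : max (Y.left α + c - d) (Y.left α) ∈ Y.J α :=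
    ⟨le_max_right _ _, max_lt (by linarith) hl⟩
  refine hij (h.floor_unique h1 h2 hi hj ?_).2.1
  rw [hc _ h1, hd _ h2, ← max_add_add_right, ← max_add_add_right]
  congr 1 <;> ring

/-- With `t` the distance of `x` to the ends of its base interval, the orbit points in a given `I_β`
are at least `t` apart and at least `t` from each end. Each end of each `I_β` therefore contributes
at most `t^{-1-b} ζ(1 + b)`, whence the factor `2 |A|`. The constant does not depend on the tower.
-/
theorem abs_birkhoffSum_le (h : Tower X Y q) {f : ℝ → ℝ} {M b : ℝ} (hM : 0 ≤ M) (hb : 0 < b)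
    (hf : ∀ α, ∀ x ∈ X.Jo α,
      |f x| ≤ M * ((x - X.left α) ^ (-1 - b) + (X.right α - x) ^ (-1 - b)))
    {α : A} {x : ℝ} (hx : x ∈ Y.Jo α) :
    |birkhoffSum X.T f (q α) x| ≤
      2 * Fintype.card A * M * (∑' n : ℕ, (n : ℝ) ^ (-1 - b)) *
        ((x - Y.left α) ^ (-1 - b) + (Y.right α - x) ^ (-1 - b)) := by
  classical
  have hxJ := Jo_subset_J α hx
  have hex : ∀ i, ∃ β, i < q α → X.left β ≤ X.T^[i] x - (x - Y.left α) ∧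
      X.T^[i] x + (Y.right α - x) ≤ X.right β := by
    intro i
    by_cases hi : i < q α
    · obtain ⟨β, c, hc, h1, h2⟩ := h.floor_interval hi
      refine ⟨β, fun _ => ?_⟩
      rw [hc x hxJ]
      constructor <;> linarith
    · exact ⟨α, fun hi' => absurd hi' hi⟩
  choose w hw using hex
  set t := min (x - Y.left α) (Y.right α - x) with ht
  have ht0 : 0 < t := lt_min (by linarith [hx.1]) (by linarith [hx.2])
  have htL : t ≤ Y.right α - Y.left α :=
    (min_le_left _ _).trans (by linarith [hx.2])
  set ζ := ∑' n : ℕ, (n : ℝ) ^ (-1 - b) with hζ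
  have hζ0 : 0 ≤ ζ := tsum_nonneg fun n => Real.rpow_nonneg (Nat.cast_nonneg n) _
  have htle : t ^ (-1 - b) ≤ (x - Y.left α) ^ (-1 - b) + (Y.right α - x) ^ (-1 - b) := by
    have p1 : 0 ≤ (x - Y.left α) ^ (-1 - b) := Real.rpow_nonneg (by linarith [hx.1]) _
    have p2 : 0 ≤ (Y.right α - x) ^ (-1 - b) := Real.rpow_nonneg (by linarith [hx.2]) _
    rcases min_choice (x - Y.left α) (Y.right α - x) with h1 | h1 <;> rw [ht, h1] <;> linarith
  have hterm : ∀ i ∈ Finset.range (q α), |f (X.T^[i] x)| ≤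
      M * ((X.T^[i] x - X.left (w i)) ^ (-1 - b) + (X.right (w i) - X.T^[i] x) ^ (-1 - b)) := by
    intro i hi
    obtain ⟨h1, h2⟩ := hw i (Finset.mem_range.1 hi)
    exact hf (w i) _ ⟨by linarith [hx.1], by linarith [hx.2]⟩
  have hfib : ∀ β, ∑ i ∈ Finset.range (q α) with w i = β,
      ((X.T^[i] x - X.left (w i)) ^ (-1 - b) + (X.right (w i) - X.T^[i] x) ^ (-1 - b)) ≤
        2 * (t ^ (-1 - b) * ζ) := by
    intro β
    have e : ∑ i ∈ Finset.range (q α) with w i = β,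
        ((X.T^[i] x - X.left (w i)) ^ (-1 - b) + (X.right (w i) - X.T^[i] x) ^ (-1 - b)) =
        ∑ i ∈ Finset.range (q α) with w i = β, (X.T^[i] x - X.left β) ^ (-1 - b) +
        ∑ i ∈ Finset.range (q α) with w i = β, (X.right β - X.T^[i] x) ^ (-1 - b) := by
      rw [← Finset.sum_add_distrib]
      refine Finset.sum_congr rfl fun i hi => ?_
      rw [(Finset.mem_filter.1 hi).2]
    rw [e, two_mul]
    refine add_le_add ?_ ?_
    · refine sum_rpow_le_of_separated _ (fun i => X.T^[i] x - X.left β) ht0 hb ?_ ?_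
      · intro i hi
        obtain ⟨hi', rfl⟩ := Finset.mem_filter.1 hi
        have := (hw i (Finset.mem_range.1 hi')).1
        exact (min_le_left _ _).trans (by linarith)
      · intro i hi j hj hij
        rw [sub_sub_sub_cancel_right]
        exact htL.trans (h.floor_separated (Finset.mem_range.1 (Finset.mem_filter.1 hi).1)
          (Finset.mem_range.1 (Finset.mem_filter.1 hj).1) hij hxJ)
    · refine sum_rpow_le_of_separated _ (fun i => X.right β - X.T^[i] x) ht0 hb ?_ ?_
      · intro i hi
        obtain ⟨hi', rfl⟩ := Finset.mem_filter.1 hi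
        have := (hw i (Finset.mem_range.1 hi')).2
        exact (min_le_right _ _).trans (by linarith)
      · intro i hi j hj hij
        rw [sub_sub_sub_cancel_left]
        exact htL.trans (h.floor_separated (Finset.mem_range.1 (Finset.mem_filter.1 hj).1)
          (Finset.mem_range.1 (Finset.mem_filter.1 hi).1) hij.symm hxJ)
  calc |birkhoffSum X.T f (q α) x| ≤ ∑ i ∈ Finset.range (q α), |f (X.T^[i] x)| :=
        Finset.abs_sum_le_sum_abs _ _
    _ ≤ ∑ i ∈ Finset.range (q α), M * ((X.T^[i] x - X.left (w i)) ^ (-1 - b) +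
          (X.right (w i) - X.T^[i] x) ^ (-1 - b)) := Finset.sum_le_sum hterm
    _ = M * ∑ β, ∑ i ∈ Finset.range (q α) with w i = β, ((X.T^[i] x - X.left (w i)) ^ (-1 - b) +
          (X.right (w i) - X.T^[i] x) ^ (-1 - b)) := by
        rw [← Finset.mul_sum, Finset.sum_fiberwise]
    _ ≤ M * ∑ _β : A, 2 * (t ^ (-1 - b) * ζ) :=
        mul_le_mul_of_nonneg_left (Finset.sum_le_sum fun β _ => hfib β) hM
    _ = 2 * Fintype.card A * M * ζ * t ^ (-1 - b) := by
        rw [Finset.sum_const, Finset.card_univ, nsmul_eq_mul]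
        ring
    _ ≤ _ := mul_le_mul_of_nonneg_left htle (by positivity)

/-- The constant in the Hölder estimate of special Birkhoff sums. -/
def specialConst (A : Type*) [Fintype A] (b : ℝ) : ℝ :=
  20 * Fintype.card A * (∑' n : ℕ, (n : ℝ) ^ (-1 - b)) / (b * (1 - b))

theorem specialConst_nonneg {b : ℝ} (hb : 0 < b) (hb1 : b < 1) : 0 ≤ specialConst A b := by
  have h1 : 0 < 1 - b := by linarith
  have h2 : 0 ≤ ∑' n : ℕ, (n : ℝ) ^ (-1 - b) :=
    tsum_nonneg fun n => Real.rpow_nonneg (Nat.cast_nonneg n) _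
  unfold specialConst
  positivity

/-- The second derivative of the special sum has the same type of singularity as `f''`, so
`abs_sub_le_of_second_deriv` applies on each base interval; continuity of `f` from the right
includes the left end. -/
theorem holder_special (h : Tower X Y q) {f f' f'' : ℝ → ℝ} {M b K : ℝ} (hM : 0 ≤ M) (hb : 0 < b)
    (hb1 : b < 1) (hfc : ∀ α, ContinuousOn f (X.J α))
    (hf : ∀ α, ∀ x ∈ X.Jo α, HasDerivAt f (f' x) x)
    (hf' : ∀ α, ∀ x ∈ X.Jo α, HasDerivAt f' (f'' x) x)
    (hf'' : ∀ α, ∀ x ∈ X.Jo α,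
      |f'' x| ≤ M * ((x - X.left α) ^ (-1 - b) + (X.right α - x) ^ (-1 - b)))
    {α : A} (hK : ∀ x ∈ Y.J α, |birkhoffSum X.T f (q α) x| ≤ K) {x y : ℝ} (hx : x ∈ Y.J α)
    (hy : y ∈ Y.J α) (hxy : x ≤ y) :
    |birkhoffSum X.T f (q α) y - birkhoffSum X.T f (q α) x| ≤
      (4 * K * Y.len α ^ (b - 1) + specialConst A b * M) * (y - x) ^ (1 - b) := by
  have hζ0 : 0 ≤ ∑' n : ℕ, (n : ℝ) ^ (-1 - b) :=
    tsum_nonneg fun n => Real.rpow_nonneg (Nat.cast_nonneg n) _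
  refine abs_sub_le_Ico_of_Ioo (l := Y.left α) (r := Y.right α)
    (Ψ := fun s => (4 * K * Y.len α ^ (b - 1) + specialConst A b * M) * s ^ (1 - b))
    (h.continuousOn_birkhoffSum hfc le_rfl) ?_ ?_ hx hy hxy
  · exact continuous_const.mul (Real.continuous_rpow_const (by linarith))
  · intro x hx y hy hxy
    have := abs_sub_le_of_second_deriv (F := birkhoffSum X.T f (q α))
      (F' := birkhoffSum X.T f' (q α)) (F'' := birkhoffSum X.T f'' (q α)) hb hb1
      (M := 2 * Fintype.card A * M * (∑' n : ℕ, (n : ℝ) ^ (-1 - b))) (by positivity)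
      (fun s hs => h.hasDerivAt_birkhoffSum hf le_rfl hs)
      (fun s hs => h.hasDerivAt_birkhoffSum hf' le_rfl hs)
      (fun s hs => h.abs_birkhoffSum_le hM hb hf'' hs)
      (fun s hs => hK s (Jo_subset_J α hs)) hx hy hxy
    have hlen : Y.right α - Y.left α = Y.len α := by rw [right_eq]; ring
    rw [hlen] at this
    refine this.trans (le_of_eq ?_)
    unfold specialConst
    ring

end Tower

namespace Renorm

variable {X : IETData A m} {Y : ℕ → IETData A m} {q p : ℕ → A → ℕ} {lam σ B : ℝ}

theorem height_zero (h : Renorm X Y q p lam σ B) (α : A) : q 0 α = 1 := by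
  have h1 := h.tower 0
  rw [h.zero] at h1
  exact congrFun (h1.height_unique (Tower.refl h1.pos)) α

/-- Hölder estimates of the special Birkhoff sums give Hölder estimates on the floors of the
towers. -/
theorem holder_floor (h : Renorm X Y q p lam σ B) {f : ℝ → ℝ} {G : ℕ → ℝ} {θ : ℝ}
    (hG : ∀ k, 0 ≤ G k)
    (hf : ∀ k α, ∀ x ∈ (Y k).J α, ∀ y ∈ (Y k).J α, x ≤ y →
      |birkhoffSum X.T f (q k α) y - birkhoffSum X.T f (q k α) x| ≤ G k * (y - x) ^ θ)
    (k : ℕ) {α : A} {i : ℕ} (hi : i < q k α) {x y : ℝ} (hx : x ∈ (Y k).J α) (hy : y ∈ (Y k).J α)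
    (hxy : x ≤ y) :
    |birkhoffSum X.T f i y - birkhoffSum X.T f i x| ≤
      (∑ j ∈ Finset.range k, B * Real.exp (σ * j) * G j) * (y - x) ^ θ := by
  induction k generalizing α i x y with
  | zero =>
    rw [h.height_zero] at hi
    obtain rfl : i = 0 := by omega
    simp
  | succ k ih =>
    obtain ⟨w, j, s, hj, hs, hw, hdec⟩ := h.floor_decomp hi
    have hpow : 0 ≤ (y - x) ^ θ := Real.rpow_nonneg (by linarith) _
    have key : ∀ r < p k α, ∃ c, (Y k).T^[r] x = x + c ∧ (Y k).T^[r] y = y + c ∧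
        x + c ∈ (Y k).J (w r) ∧ y + c ∈ (Y k).J (w r) := by
      intro r hr
      obtain ⟨c, hc⟩ := hw r hr
      exact ⟨c, (hc x hx).1, (hc y hy).1, (hc x hx).2, (hc y hy).2⟩
    -- The remainder is a partial sum of level `k`, treated by induction; the full blocks are
    -- special sums, at most `B e^{σk}` in number. Both points follow the same translations, so
    -- their distance never changes.
    rw [(hdec x hx).2 f, (hdec y hy).2 f, add_sub_add_comm, ← Finset.sum_sub_distrib,
      Finset.sum_range_succ, add_comm (Finset.sum _ _), add_comm (Finset.sum _ _), add_mul,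
      add_comm (_ * _)]
    refine (abs_add_le _ _).trans (add_le_add ?_ ?_)
    · obtain ⟨c, h1, h2, h3, h4⟩ := key j hj
      rw [h1, h2]
      have := ih hs h3 h4 (by linarith)
      rwa [add_sub_add_right_eq_sub] at this
    · refine (Finset.abs_sum_le_sum_abs _ _).trans ?_
      have h5 : ∀ r ∈ Finset.range j, |birkhoffSum X.T f (q k (w r)) ((Y k).T^[r] y) -
          birkhoffSum X.T f (q k (w r)) ((Y k).T^[r] x)| ≤ G k * (y - x) ^ θ := by
        intro r hr
        obtain ⟨c, h1, h2, h3, h4⟩ := key r ((Finset.mem_range.1 hr).trans hj)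
        rw [h1, h2]
        have := hf k (w r) _ h3 _ h4 (by linarith)
        rwa [add_sub_add_right_eq_sub] at this
      refine (Finset.sum_le_sum h5).trans ?_
      rw [Finset.sum_const, Finset.card_range, nsmul_eq_mul, mul_assoc _ (G k)]
      refine mul_le_mul_of_nonneg_right ?_ (mul_nonneg (hG k) hpow)
      exact le_trans (Nat.cast_le.2 hj.le) (h.step_le k α)

end Renorm

end IETData

/-! ### From estimates on floors to regularity of the solution -/

/-- The place of a small number in a scale tending to zero. -/
theorem exists_scale {μ : ℕ → ℝ} (hμ : Tendsto μ atTop (𝓝 0)) {k₀ : ℕ} {h : ℝ} (h0 : 0 < h)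
    (hk : h ≤ μ k₀) : ∃ k, k₀ ≤ k ∧ μ (k + 1) < h ∧ h ≤ μ k := by
  classical
  have hex : ∃ j, μ (k₀ + j + 1) < h := by
    have h1 := (hμ.comp (tendsto_add_atTop_nat (k₀ + 1))).eventually (gt_mem_nhds h0)
    obtain ⟨j, hj⟩ := h1.exists
    refine ⟨j, ?_⟩
    rw [show k₀ + j + 1 = j + (k₀ + 1) by omega]
    exact hj
  refine ⟨k₀ + Nat.find hex, by omega, Nat.find_spec hex, ?_⟩
  by_cases hz : Nat.find hex = 0
  · rw [hz]
    exact hk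
  · have h1 := Nat.find_min hex (m := Nat.find hex - 1) (by omega)
    rw [show k₀ + (Nat.find hex - 1) + 1 = k₀ + Nat.find hex by omega] at h1
    exact not_lt.1 h1

namespace IETData

variable {A : Type*} [Fintype A] [DecidableEq A] {m : ℕ} {X : IETData A m}

/-- An interval shorter than all the bases of the towers meets at most two floors; so the
oscillation of a continuous function on it is controlled by the oscillation on the floors. -/
theorem Tower.abs_sub_le_of_floor {Y : IETData A m} {q : A → ℕ} (h : Tower X Y q) {w : ℝ → ℝ}
    (hw : ContinuousOn w (Ico 0 X.total)) {x y D : ℝ} (hx : x ∈ Ico 0 X.total)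
    (hy : y ∈ Ico 0 X.total) (hxy : x ≤ y) (hlen : ∀ α, y - x ≤ Y.len α)
    (hD : ∀ α, ∀ i < q α, ∀ x' ∈ Y.J α, ∀ y' ∈ Y.J α, x' ≤ y' → x ≤ X.T^[i] x' →
      X.T^[i] x' ≤ X.T^[i] y' → X.T^[i] y' ≤ y → |w (X.T^[i] y') - w (X.T^[i] x')| ≤ D) :
    |w y - w x| ≤ 2 * D := by
  obtain ⟨α, x', hx', i, hi, hix⟩ := h.cover x hx
  obtain ⟨-, c, hc, -⟩ := h.floor_interval hi
  have hxc : x' + c = x := by rw [← hc x' hx', hix]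
  have hfl : ∀ u, x ≤ u → u < Y.right α + c → u ≤ y → |w u - w x| ≤ D := by
    intro u h1 h2 h3
    have hu : u - c ∈ Y.J α := ⟨by linarith [hx'.1], by linarith⟩
    have e1 : X.T^[i] (u - c) = u := by rw [hc _ hu]; ring
    have := hD α i hi x' hx' (u - c) hu (by linarith) (by rw [hix]) (by rw [hix, e1]; exact h1)
      (by rw [e1]; exact h3)
    rwa [e1, hix] at this
  have hxb : x < Y.right α + c := by linarith [hx'.2]
  have hD0 : 0 ≤ D := (abs_nonneg _).trans (hfl x le_rfl hxb hxy)
  rcases lt_or_ge y (Y.right α + c) with hyb | hyb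
  · exact (hfl y hxy hyb le_rfl).trans (by linarith)
  -- `b` is the end of the floor containing `x`. The estimate goes from `x` to `b` in this floor and
  -- from `b` to `y` in the next one, which is long enough by `hlen`.
  set b := Y.right α + c with hb
  have hbI : b ∈ Ico 0 X.total := ⟨by linarith [hx.1], by linarith [hy.2]⟩
  obtain ⟨β, z', hz', j, hj, hjz⟩ := h.cover b hbI
  obtain ⟨-, d, hd, -⟩ := h.floor_interval hj
  have hzd : z' + d = b := by rw [← hd z' hz', hjz]
  -- The next floor starts exactly at `b`, since otherwise the two floors would overlap just before
  -- `b`.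
  have hleft : Y.left β + d = b := by
    refine le_antisymm (by linarith [hz'.1]) ?_
    by_contra! hlt
    set u := max x (Y.left β + d) with hu
    have hub : u < b := max_lt hxb hlt
    have h1 : u - c ∈ Y.J α := ⟨by linarith [hx'.1, le_max_left x (Y.left β + d)], by linarith⟩
    have h2 : u - d ∈ Y.J β :=
      ⟨by linarith [le_max_right x (Y.left β + d)], by linarith [hz'.2]⟩
    obtain ⟨rfl, rfl, h3⟩ := h.floor_unique h1 h2 hi hj (by rw [hc _ h1, hd _ h2]; ring)
    linarith [hz'.2]
  have hyr : y - d ∈ Y.J β := by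
    have := hlen β
    rw [mem_J, right_eq]
    constructor <;> linarith
  have hby : |w y - w b| ≤ D := by
    have e1 : X.T^[j] (y - d) = y := by rw [hd _ hyr]; ring
    have := hD β j hj z' hz' (y - d) hyr (by linarith) (by rw [hjz]; exact hxb.le)
      (by rw [hjz, e1]; exact hyb) (by rw [e1])
    rwa [e1, hjz] at this
  -- `b` no longer belongs to the floor of `x`; continuity of `w` from the left supplies the
  -- estimate.
  have hxb' : |w b - w x| ≤ D := by
    have hlim : Tendsto w (𝓝[<] b) (𝓝 (w b)) := by
      refine (hw b hbI).mono_left (nhdsWithin_le_of_mem ?_)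
      exact mem_of_superset (Ioo_mem_nhdsLT hxb) fun u hu =>
        ⟨hx.1.trans hu.1.le, hu.2.trans hbI.2⟩
    refine le_of_tendsto (hlim.sub_const (w x)).abs ?_
    filter_upwards [Ioo_mem_nhdsLT hxb] with u hu
    exact hfl u hu.1.le hu.2 (by linarith [hu.2])
  have := abs_sub_le (w y) (w b) (w x)
  linarith

variable {Y : ℕ → IETData A m} {q : ℕ → A → ℕ}

/-- A Hölder estimate from approximations by functions with Hölder estimates on the floors. -/
theorem holder_of_floor (h : ∀ k, Tower X (Y k) (q k)) {f v : ℝ → ℝ}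
    (hv : ContinuousOn v (Ico 0 X.total)) {μ ε H : ℕ → ℝ} {θ s C₁ C₂ : ℝ}
    (hμ : Tendsto μ atTop (𝓝 0)) (hμ0 : ∀ k, 0 < μ k) (hμY : ∀ k α, μ k ≤ (Y k).len α)
    (hε : ∀ k, ∀ x ∈ Ico 0 X.total, |v x - towerSum X (Y k) (q k) f x| ≤ ε k)
    (hH0 : ∀ k, 0 ≤ H k) (hθ : 0 ≤ θ) (hs : 0 ≤ s)
    (hH : ∀ k α, ∀ i < q k α, ∀ x ∈ (Y k).J α, ∀ y ∈ (Y k).J α, x ≤ y →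
      |birkhoffSum X.T f i y - birkhoffSum X.T f i x| ≤ H k * (y - x) ^ (θ + s))
    (hC₁ : ∀ k, ε k ≤ C₁ * μ (k + 1) ^ θ) (hC₂ : ∀ k, H k * μ k ^ s ≤ C₂) {x y : ℝ}
    (hx : x ∈ Ico 0 X.total) (hy : y ∈ Ico 0 X.total) (hxy : x < y) (hle : y - x ≤ μ 0) :
    |v y - v x| ≤ (4 * C₁ + 2 * C₂) * (y - x) ^ θ := by
  have h0 : 0 < y - x := sub_pos.2 hxy
  -- With `μ (k+1) < y - x ≤ μ k`, the lower bound on the distance absorbs the approximation error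
  -- `ε k`, and the upper one turns the spare exponent `s` into decay against the growth of `H k`.
  obtain ⟨k, -, hk1, hk2⟩ := exists_scale hμ h0 hle
  have hC₁0 : 0 ≤ C₁ := by
    have h1 := (abs_nonneg _).trans (hε 0 x hx)
    have h2 := h1.trans (hC₁ 0)
    have h3 : 0 < μ (0 + 1) ^ θ := Real.rpow_pos_of_pos (hμ0 _) _
    exact nonneg_of_mul_nonneg_left h2 h3
  have hmain := (h k).abs_sub_le_of_floor hv hx hy hxy.le
    (fun α => hk2.trans (hμY k α)) (D := 2 * ε k + H k * (y - x) ^ (θ + s)) ?_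
  · have e1 : ε k ≤ C₁ * (y - x) ^ θ := (hC₁ k).trans
      (mul_le_mul_of_nonneg_left (Real.rpow_le_rpow (hμ0 _).le hk1.le hθ) hC₁0)
    have e2 : H k * (y - x) ^ (θ + s) ≤ C₂ * (y - x) ^ θ := by
      rw [Real.rpow_add h0, mul_left_comm, mul_comm C₂]
      refine mul_le_mul_of_nonneg_left ?_ (Real.rpow_nonneg h0.le _)
      exact (mul_le_mul_of_nonneg_left (Real.rpow_le_rpow h0.le hk2 hs) (hH0 k)).trans (hC₂ k)
    linarith
  · intro α i hi x' hx' y' hy' hxy' h1 h2 h3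
    obtain ⟨-, c, hc, -⟩ := (h k).floor_interval hi
    have e1 := hε k _ (iterate_T_mem (h k).pos_base ((h k).mem_base hx') i)
    have e2 := hε k _ (iterate_T_mem (h k).pos_base ((h k).mem_base hy') i)
    rw [(h k).towerSum_eq f hx' hi] at e1
    rw [(h k).towerSum_eq f hy' hi] at e2
    have e3 := hH k α i hi x' hx' y' hy' hxy'
    have e4 : H k * (y' - x') ^ (θ + s) ≤ H k * (y - x) ^ (θ + s) := by
      refine mul_le_mul_of_nonneg_left ?_ (hH0 k)
      rw [hc x' hx'] at h1
      rw [hc y' hy'] at h3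
      exact Real.rpow_le_rpow (by linarith) (by linarith) (by linarith)
    rw [abs_le] at *
    constructor <;> linarith

/-- If the approximation by Birkhoff sums is faster than the scale of the towers, then the
solutions can be differentiated. -/
theorem hasDerivWithinAt_of_floor (h : ∀ k, Tower X (Y k) (q k)) {f f' v v' : ℝ → ℝ}
    (hv : ContinuousOn v (Ico 0 X.total)) (hv' : ContinuousOn v' (Ico 0 X.total))
    (hf : ∀ α, ContinuousOn f (X.J α)) (hff' : ∀ α, ∀ x ∈ X.Jo α, HasDerivAt f (f' x) x)
    {μ ε ε' : ℕ → ℝ} (hμ : Tendsto μ atTop (𝓝 0)) (hμ0 : ∀ k, 0 < μ k)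
    (hμY : ∀ k α, μ k ≤ (Y k).len α)
    (hε : ∀ k, ∀ x ∈ Ico 0 X.total, |v x - towerSum X (Y k) (q k) f x| ≤ ε k)
    (hε' : ∀ k, ∀ x ∈ Ico 0 X.total, |v' x - towerSum X (Y k) (q k) f' x| ≤ ε' k)
    (hεμ : Tendsto (fun k => ε k / μ (k + 1)) atTop (𝓝 0)) (hε'0 : Tendsto ε' atTop (𝓝 0))
    {z : ℝ} (hz : z ∈ Ico 0 X.total) : HasDerivWithinAt v (v' z) (Ico 0 X.total) z := by
  rw [hasDerivWithinAt_iff_isLittleO, Asymptotics.isLittleO_iff]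
  intro η hη
  have hev := (hεμ.eventually (gt_mem_nhds (show 0 < η / 8 by positivity))).and
    (hε'0.eventually (gt_mem_nhds (show 0 < η / 8 by positivity)))
  obtain ⟨k₀, hk₀⟩ := eventually_atTop.1 hev
  obtain ⟨δ, hδ, hδv⟩ := Metric.continuousWithinAt_iff.1 (hv' z hz) (η / 8) (by positivity)
  have hnear : ∀ᶠ u in 𝓝[Ico 0 X.total] z, u ∈ Ico 0 X.total ∧ |u - z| < min δ (μ k₀) := by
    refine Filter.Eventually.and self_mem_nhdsWithin (nhdsWithin_le_nhds ?_)
    exact Metric.ball_mem_nhds z (lt_min hδ (hμ0 k₀))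
  filter_upwards [hnear] with u hu
  obtain ⟨huI, huδ⟩ := hu
  rcases eq_or_ne u z with rfl | hne
  · simp
  have huδ1 : |u - z| < δ := huδ.trans_le (min_le_left _ _)
  have huμ : |u - z| ≤ μ k₀ := huδ.le.trans (min_le_right _ _)
  have hpos : 0 < |u - z| := abs_pos.2 (sub_ne_zero.2 hne)
  obtain ⟨k, hkk, hk1, hk2⟩ := exists_scale hμ hpos huμ
  obtain ⟨hεk, hεk'⟩ := hk₀ k hkk
  rw [div_lt_iff₀ (hμ0 _)] at hεk
  set c := v' z with hc
  have hw : ContinuousOn (fun s => v s - c * s) (Ico 0 X.total) :=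
    hv.sub (continuousOn_const.mul continuousOn_id)
  -- Subtracting the linear part makes this an oscillation estimate. Per floor there are two
  -- approximation errors `ε k ≤ (η/8)|u - z|` and a slope error `(η/4)|u - z|`; two floors give `η
  -- |u - z|`.
  have key : ∀ x y, x ∈ Ico 0 X.total → y ∈ Ico 0 X.total → x ≤ y → y - x = |u - z| →
      (∀ s, x ≤ s → s ≤ y → |s - z| < δ) →
      |(v y - c * y) - (v x - c * x)| ≤ η * |u - z| := by
    intro x y hx hy hxy hyx hnear
    have hmain := (h k).abs_sub_le_of_floor hw hx hy hxy
      (fun α => hyx.le.trans (hk2.trans (hμY k α))) (D := 2 * ε k + η / 4 * |u - z|) ?_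
    · have hlt : ε k ≤ η / 8 * |u - z| :=
        hεk.le.trans (mul_le_mul_of_nonneg_left hk1.le (by positivity))
      refine hmain.trans ?_
      linarith
    · intro α i hi x' hx' y' hy' hxy' h1 h2 h3
      obtain ⟨-, d, hd, -⟩ := (h k).floor_interval hi
      have e1 := hε k _ (iterate_T_mem (h k).pos_base ((h k).mem_base hx') i)
      have e2 := hε k _ (iterate_T_mem (h k).pos_base ((h k).mem_base hy') i)
      rw [(h k).towerSum_eq f hx' hi] at e1
      rw [(h k).towerSum_eq f hy' hi] at e2
      have e3 : |birkhoffSum X.T f i y' - birkhoffSum X.T f i x' - c * (y' - x')| ≤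
          η / 4 * (y' - x') := by
        rcases eq_or_lt_of_le hxy' with rfl | hlt
        · simp
        have hsub : Icc x' y' ⊆ (Y k).J α := fun s hs =>
          ⟨hx'.1.trans hs.1, hs.2.trans_lt hy'.2⟩
        have hsubo : Ioo x' y' ⊆ (Y k).Jo α := fun s hs =>
          ⟨hx'.1.trans_lt hs.1, hs.2.trans hy'.2⟩
        -- The slope is a Birkhoff sum of `f'` at an intermediate point, which is a tower sum and
        -- hence close to `v'` there, and so to `v' z`.
        obtain ⟨ξ, hξ, hslope⟩ := exists_hasDerivAt_eq_slope (birkhoffSum X.T f i)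
          (birkhoffSum X.T f' i) hlt (((h k).continuousOn_birkhoffSum hf hi.le).mono hsub)
          (fun s hs => (h k).hasDerivAt_birkhoffSum hff' hi.le (hsubo hs))
        have hξJ := hsub (Ioo_subset_Icc_self hξ)
        have hTξ := iterate_T_mem (h k).pos_base ((h k).mem_base hξJ) i
        have e4 := hε' k _ hTξ
        rw [(h k).towerSum_eq f' hξJ hi] at e4
        have e5 : |v' (X.T^[i] ξ) - c| < η / 8 := by
          have := hδv hTξ
          rw [Real.dist_eq, Real.dist_eq] at this
          refine this ?_
          rw [hd x' hx'] at h1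
          rw [hd y' hy'] at h3
          refine hnear _ ?_ ?_ <;> rw [hd ξ hξJ] <;> linarith [hξ.1, hξ.2]
        rw [eq_div_iff (sub_pos.2 hlt).ne'] at hslope
        rw [← hslope, ← sub_mul, abs_mul, abs_of_pos (sub_pos.2 hlt)]
        refine mul_le_mul_of_nonneg_right ?_ (sub_pos.2 hlt).le
        rw [abs_le] at e4 ⊢
        rw [abs_lt] at e5
        constructor <;> linarith
      have e6 : η / 4 * (y' - x') ≤ η / 4 * |u - z| := by
        refine mul_le_mul_of_nonneg_left ?_ (by positivity)
        rw [hd x' hx'] at h1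
        rw [hd y' hy'] at h3
        linarith
      have e7 : X.T^[i] y' - X.T^[i] x' = y' - x' := by rw [hd x' hx', hd y' hy']; ring
      have e8 : c * (X.T^[i] y' - X.T^[i] x') = c * (y' - x') := by rw [e7]
      rw [abs_le] at *
      constructor <;> linarith
  rw [Real.norm_eq_abs, Real.norm_eq_abs, smul_eq_mul]
  rcases le_total z u with hzu | hzu
  · have := key z u hz huI hzu (abs_of_nonneg (sub_nonneg.2 hzu)).symm fun s h1 h2 =>
      lt_of_le_of_lt (abs_le_abs_of_nonneg (sub_nonneg.2 h1) (by linarith)) huδ1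
    refine le_trans (le_of_eq ?_) this
    congr 1
    ring
  · have := key u z huI hz hzu (by rw [abs_sub_comm]; exact (abs_of_nonneg (sub_nonneg.2 hzu)).symm)
      fun s h1 h2 => by
        refine lt_of_le_of_lt ?_ huδ1
        rw [abs_of_nonpos (by linarith), abs_of_nonpos (by linarith)]
        linarith
    refine le_trans (le_of_eq ?_) this
    rw [abs_sub_comm]
    congr 1
    ring

end IETData

/-! ### Quantitative form: smooth solutions with a Hölder bound -/

namespace IETData

variable {A : Type*} [Fintype A] [DecidableEq A] {m : ℕ}

/-- A jet of functions `f 0, …, f (n - 1)` on the exchanged intervals, each the derivative of the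
preceding one, such that the second derivative `f₂` of the last one has power singularities of order
`1 + b`. -/
structure SingularJet (X : IETData A m) (n : ℕ) (b M : ℝ) (f : ℕ → ℝ → ℝ) (f₁ f₂ : ℝ → ℝ) :
    Prop where
  cont : ∀ l < n, ∀ α, ContinuousOn (f l) (X.J α)
  deriv : ∀ l, l + 1 < n → ∀ α, ∀ x ∈ X.Jo α, HasDerivAt (f l) (f (l + 1) x) x
  deriv_last : ∀ α, ∀ x ∈ X.Jo α, HasDerivAt (f (n - 1)) (f₁ x) x
  deriv₁ : ∀ α, ∀ x ∈ X.Jo α, HasDerivAt f₁ (f₂ x) x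
  bound : ∀ α, ∀ x ∈ X.Jo α,
    |f₂ x| ≤ M * ((x - X.left α) ^ (-1 - b) + (X.right α - x) ^ (-1 - b))

namespace Renorm

variable {X : IETData A m} {Y : ℕ → IETData A m} {q p : ℕ → A → ℕ} {lam σ B : ℝ}

theorem tendsto_scale (hlam : 0 < lam) (hσ : 0 < σ) (B : ℝ) :
    Tendsto (fun k : ℕ => B⁻¹ * Real.exp (-(lam * (1 + σ)) * k)) atTop (𝓝 0) := by
  have h1 : Tendsto (fun k : ℕ => B⁻¹ * Real.exp (-(lam * (1 + σ))) ^ k) atTop (𝓝 (B⁻¹ * 0)) :=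
    (tendsto_pow_atTop_nhds_zero_of_lt_one (Real.exp_pos _).le
      (Real.exp_lt_one_iff.2 (neg_lt_zero.2 (by positivity)))).const_mul _
  rw [mul_zero] at h1
  refine h1.congr fun k => ?_
  rw [← Real.exp_nat_mul, mul_comm (k : ℝ)]

theorem scale_rpow (hB : 0 < B) (c s : ℝ) (k : ℕ) :
    (B⁻¹ * Real.exp (-c * k)) ^ s = B ^ (-s) * Real.exp (-(c * s) * k) := by
  rw [Real.mul_rpow (by positivity) (Real.exp_pos _).le, Real.inv_rpow hB.le,
    ← Real.rpow_neg hB.le, ← Real.exp_mul]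
  congr 2
  ring

theorem rpow_le_self_of_one_le (hB : 1 ≤ B) {s : ℝ} (hs : s ≤ 1) : B ^ s ≤ B := by
  calc B ^ s ≤ B ^ (1 : ℝ) := Real.rpow_le_rpow_of_exponent_le hB hs
    _ = B := Real.rpow_one B

/-- The Hölder estimate on the floors of the towers, with an explicit growth rate. -/
theorem exists_floor_const (h : Renorm X Y q p lam σ B) (hlam : 0 < lam) (hσ : 0 < σ) {a b K₀ W : ℝ}
    (hab : a ≤ b) (hb : 0 < b) (hb1 : b < 1) (hK₀ : 0 ≤ K₀) (hW : 0 ≤ W) :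
    ∃ G : ℝ, 0 ≤ G ∧ ∀ (f f₁ f₂ : ℝ → ℝ) (P : ℝ), 0 ≤ P →
      (∀ α, ContinuousOn f (X.J α)) → (∀ α, ∀ x ∈ X.Jo α, HasDerivAt f (f₁ x) x) →
      (∀ α, ∀ x ∈ X.Jo α, HasDerivAt f₁ (f₂ x) x) →
      (∀ α, ∀ x ∈ X.Jo α,
        |f₂ x| ≤ W * P * ((x - X.left α) ^ (-1 - b) + (X.right α - x) ^ (-1 - b))) →
      (∀ (k : ℕ) α, ∀ y ∈ (Y k).J α, |birkhoffSum X.T f (q k α) y| ≤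
        K₀ * P * Real.exp (-(lam * (1 - a) - σ) * k)) →
      ∀ (k : ℕ) α, ∀ i < q k α, ∀ x ∈ (Y k).J α, ∀ y ∈ (Y k).J α, x ≤ y →
        |birkhoffSum X.T f i y - birkhoffSum X.T f i x| ≤
          G * P * Real.exp (σ * (2 + lam) * k) * (y - x) ^ (1 - b) := by
  have hB := h.B_pos
  -- The first term comes from the sup bound divided by a power of the base length, the second from
  -- the singularity.
  set G₀ := 4 * K₀ * B + Tower.specialConst A b * W with hG₀
  have hsc := Tower.specialConst_nonneg (A := A) hb hb1
  have hG₀0 : 0 ≤ G₀ := by positivity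
  set e := Real.exp (σ * (2 + lam)) with he
  have he1 : 1 < e := Real.one_lt_exp_iff.2 (by positivity)
  have he1' : 0 < e - 1 := by linarith
  refine ⟨B * G₀ / (e - 1), by positivity, ?_⟩
  intro f f₁ f₂ P hP hc h1 h2 h3 hS k α i hi x hx y hy hxy
  have hspec : ∀ (k : ℕ) α, ∀ x ∈ (Y k).J α, ∀ y ∈ (Y k).J α, x ≤ y →
      |birkhoffSum X.T f (q k α) y - birkhoffSum X.T f (q k α) x| ≤
        G₀ * P * Real.exp (σ * (1 + lam) * k) * (y - x) ^ (1 - b) := by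
    intro k α x hx y hy hxy
    refine ((h.tower k).holder_special (by positivity) hb hb1 hc h1 h2 h3 (hS k α) hx hy
      hxy).trans (mul_le_mul_of_nonneg_right ?_ (Real.rpow_nonneg (by linarith) _))
    have hk : (0 : ℝ) ≤ k := Nat.cast_nonneg k
    have hlen : (Y k).len α ^ (b - 1) ≤ B * Real.exp (lam * (1 + σ) * (1 - b) * k) := by
      refine (Real.rpow_le_rpow_of_nonpos (by positivity) (h.le_len k α) (by linarith)).trans ?_
      rw [scale_rpow hB]
      refine mul_le_mul (rpow_le_self_of_one_le h.one_le (by linarith)) (le_of_eq ?_)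
        (Real.exp_pos _).le hB.le
      congr 1
      ring
    -- The main rates cancel because `a ≤ b`: the decay of the sums makes up for the shrinking of
    -- the base, up to a factor with exponent proportional to `σ`.
    have hexp : Real.exp (-(lam * (1 - a) - σ) * k) * Real.exp (lam * (1 + σ) * (1 - b) * k) ≤
        Real.exp (σ * (1 + lam) * k) := by
      rw [← Real.exp_add, Real.exp_le_exp, ← add_mul]
      refine mul_le_mul_of_nonneg_right ?_ hk
      have e1 : 0 ≤ lam * (b - a) := mul_nonneg hlam.le (by linarith)
      have e2 : 0 ≤ lam * σ * b := by positivity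
      linarith
    have hone : 1 ≤ Real.exp (σ * (1 + lam) * k) := Real.one_le_exp (by positivity)
    calc 4 * (K₀ * P * Real.exp (-(lam * (1 - a) - σ) * k)) * (Y k).len α ^ (b - 1) +
          Tower.specialConst A b * (W * P)
        ≤ 4 * (K₀ * P * Real.exp (-(lam * (1 - a) - σ) * k)) *
            (B * Real.exp (lam * (1 + σ) * (1 - b) * k)) +
          Tower.specialConst A b * (W * P) * 1 := by
          rw [mul_one]
          gcongr
      _ = 4 * K₀ * B * P * (Real.exp (-(lam * (1 - a) - σ) * k) *
            Real.exp (lam * (1 + σ) * (1 - b) * k)) +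
          Tower.specialConst A b * (W * P) * 1 := by ring
      _ ≤ 4 * K₀ * B * P * Real.exp (σ * (1 + lam) * k) +
          Tower.specialConst A b * (W * P) * Real.exp (σ * (1 + lam) * k) := by gcongr
      _ = _ := by rw [hG₀]; ring
  refine (h.holder_floor (fun k => by positivity) hspec k hi hx hy hxy).trans
    (mul_le_mul_of_nonneg_right ?_ (Real.rpow_nonneg (by linarith) _))
  have hsum : ∑ j ∈ Finset.range k, B * Real.exp (σ * j) * (G₀ * P * Real.exp (σ * (1 + lam) * j)) =
      B * G₀ * P * ∑ j ∈ Finset.range k, e ^ j := by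
    rw [Finset.mul_sum]
    refine Finset.sum_congr rfl fun j _ => ?_
    have : e ^ j = Real.exp (σ * j) * Real.exp (σ * (1 + lam) * j) := by
      rw [he, ← Real.exp_nat_mul, ← Real.exp_add]
      congr 1
      ring
    rw [this]
    ring
  rw [hsum, geom_sum_eq he1.ne']
  have hek : Real.exp (σ * (2 + lam) * k) = e ^ k := by
    rw [he, ← Real.exp_nat_mul, mul_comm]
  rw [hek]
  calc B * G₀ * P * ((e ^ k - 1) / (e - 1)) ≤ B * G₀ * P * (e ^ k / (e - 1)) := by
        gcongr
        linarith
    _ = _ := by ring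

/-- Solutions of the cohomological equation for a jet with decaying special Birkhoff sums: they
exist, are the derivatives of each other, and the last one is Hölder continuous. -/
theorem exists_smooth_solution (h : Renorm X Y q p lam σ B) (hm : 1 ≤ m) (hX : X.IsIET)
    (hK : X.Keane) (hlam : 0 < lam) (hσ : 0 < σ) {n : ℕ} (hn : 1 ≤ n) {a τ : ℝ} (ha : 0 ≤ a)
    (hτ : 0 < τ) (hτa : τ < 1 - a) (hστ : σ * (2 + lam) ≤ lam * τ / 2) {K₀ W : ℝ} (hK₀ : 0 ≤ K₀)
    (hW : 0 ≤ W) :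
    ∃ C : ℝ, 0 < C ∧ ∀ (f : ℕ → ℝ → ℝ) (f₁ f₂ : ℝ → ℝ) (P : ℝ), 0 ≤ P →
      SingularJet X n (a + τ / 2) (W * P) f f₁ f₂ →
      (∀ l < n, ∀ (k : ℕ) α, ∀ y ∈ (Y k).J α, |birkhoffSum X.T (f l) (q k α) y| ≤
        K₀ * P * Real.exp (-(lam * ((n : ℝ) - l - a) - σ) * k)) →
      ∃ v : ℕ → ℝ → ℝ,
        (∀ l < n, v l 0 = 0 ∧ ContinuousOn (v l) (Ico 0 X.total) ∧
          (∀ x ∈ Ico 0 X.total, f l x = v l (X.T x) - v l x) ∧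
          ∀ x ∈ Ico 0 X.total, |v l x| ≤ C * P) ∧
        (∀ l, l + 1 < n → ∀ z ∈ Ico 0 X.total,
          HasDerivWithinAt (v l) (v (l + 1) z) (Ico 0 X.total) z) ∧
        (∀ x ∈ Ico 0 X.total, ∀ y ∈ Ico 0 X.total, x < y →
          |v (n - 1) y - v (n - 1) x| ≤ C * P * (y - x) ^ (1 - a - τ)) ∧
        ∀ k, ∀ x ∈ Ico 0 (Y k).total, |v 0 x| ≤
          C * P * Real.exp (-(lam * (1 - a) - 2 * σ)) ^ k := by
  have hB := h.B_pos
  set θ := 1 - a - τ with hθ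
  set ρ₀ := lam * (1 - a) - 2 * σ with hρ₀
  have hlamσ : 0 < lam * σ := mul_pos hlam hσ
  have hlamτ : lam * τ < lam * (1 - a) := mul_lt_mul_of_pos_left hτa hlam
  have hlamτ0 : 0 < lam * τ := mul_pos hlam hτ
  have hσ2 : 2 * σ + lam * σ ≤ lam * τ / 2 := le_trans (le_of_eq (by ring)) hστ
  have hρ₀0 : 0 < ρ₀ := by linarith
  have hr₀ : Real.exp (-ρ₀) < 1 := Real.exp_lt_one_iff.2 (by linarith)
  have hr₀' : 0 < 1 - Real.exp (-ρ₀) := by linarith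
  have hθ0 : 0 < θ := by linarith
  have hθ1 : θ ≤ 1 := by linarith
  obtain ⟨G, hG, hfloor⟩ := h.exists_floor_const hlam hσ (a := a) (b := a + τ / 2) (K₀ := K₀)
    (W := W) (by linarith) (by linarith) (by linarith) hK₀ hW
  set E := B * K₀ / (1 - Real.exp (-ρ₀)) with hE
  have hE0 : 0 ≤ E := by positivity
  -- The exponential factor pays for comparing the error of level `k` with the scale of level `k +
  -- 1`.
  set C₁ := E * B * Real.exp (lam * (1 + σ) * θ) with hC₁
  refine ⟨E + (4 * C₁ + 2 * G) + 2 * E * B + 1, by positivity, ?_⟩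
  have hC₁0 : 0 ≤ C₁ := by positivity
  have hEB : 0 ≤ 2 * E * B := by positivity
  intro f f₁ f₂ P hP hjet hS
  set μ : ℕ → ℝ := fun k => B⁻¹ * Real.exp (-(lam * (1 + σ)) * k) with hμ
  have hμ0 : ∀ k, 0 < μ k := fun k => by positivity
  have hμlim : Tendsto μ atTop (𝓝 0) := tendsto_scale hlam hσ B
  have hρle : ∀ l < n, ρ₀ ≤ lam * ((n : ℝ) - l - a) - 2 * σ := by
    intro l hl
    have : (l : ℝ) + 1 ≤ n := by exact_mod_cast hl
    have := mul_le_mul_of_nonneg_left (show 1 - a ≤ (n : ℝ) - l - a by linarith) hlam.le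
    linarith
  have hsol : ∀ l, ∃ v : ℝ → ℝ, l < n → v 0 = 0 ∧ ContinuousOn v (Ico 0 X.total) ∧
      (∀ x ∈ Ico 0 X.total, f l x = v (X.T x) - v x) ∧
      ∀ k, ∀ x ∈ Ico 0 X.total, |v x - towerSum X (Y k) (q k) (f l) x| ≤
        E * P * Real.exp (-(lam * ((n : ℝ) - l - a) - 2 * σ)) ^ k := by
    intro l
    by_cases hl : l < n
    · have hρ := hρle l hl
      obtain ⟨v, h1, h2, h3, h4⟩ := h.exists_solution hm hX hK (f := f l)
        (fun α => (hjet.cont l hl α).mono (Jo_subset_J α)) (D := K₀ * P)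
        (ρ := lam * ((n : ℝ) - l - a) - 2 * σ) (by positivity) (by linarith) hσ
        (fun k α y hy => by
          refine (hS l hl k α y hy).trans (le_of_eq ?_)
          congr 2
          ring)
      refine ⟨v, fun _ => ⟨h1, h2, h3, fun k x hx => (h4 k x hx).trans ?_⟩⟩
      refine mul_le_mul_of_nonneg_right ?_ (by positivity)
      have he : Real.exp (-(lam * ((n : ℝ) - l - a) - 2 * σ)) ≤ Real.exp (-ρ₀) :=
        Real.exp_le_exp.2 (by linarith)
      calc B * (K₀ * P) / (1 - Real.exp (-(lam * ((n : ℝ) - l - a) - 2 * σ)))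
          ≤ B * (K₀ * P) / (1 - Real.exp (-ρ₀)) := by gcongr
        _ = E * P := by rw [hE]; ring
    · exact ⟨0, fun hl' => absurd hl' hl⟩
  choose v hv using hsol
  have hbase : ∀ l < n, ∀ k, ∀ x ∈ Ico 0 (Y k).total, |v l x| ≤
      E * P * Real.exp (-(lam * ((n : ℝ) - l - a) - 2 * σ)) ^ k := by
    intro l hl k x hx
    have := (hv l hl).2.2.2 k x ⟨hx.1, hx.2.trans_le (h.tower k).total_le⟩
    rwa [(h.tower k).towerSum_base _ hx, sub_zero] at this
  have hbound : ∀ l < n, ∀ x ∈ Ico 0 X.total, |v l x| ≤ E * P := by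
    intro l hl x hx
    have := hbase l hl 0 x (by rw [h.zero]; exact hx)
    rwa [pow_zero, mul_one] at this
  have hn1 : n - 1 < n := by omega
  have hcast : ((n - 1 : ℕ) : ℝ) = n - 1 := by rw [Nat.cast_sub hn, Nat.cast_one]
  have hlast : lam * ((n : ℝ) - (n - 1 : ℕ) - a) = lam * (1 - a) := by rw [hcast]; ring
  refine ⟨v, fun l hl => ⟨(hv l hl).1, (hv l hl).2.1, (hv l hl).2.2.1, fun x hx =>
    (hbound l hl x hx).trans ?_⟩, ?_, ?_, ?_⟩
  · refine mul_le_mul_of_nonneg_right ?_ hP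
    linarith
  · intro l hl z hz
    have hl' : l < n := by omega
    set ρ := lam * ((n : ℝ) - l - a) - 2 * σ with hρ
    set ρ' := lam * ((n : ℝ) - (l + 1 : ℕ) - a) - 2 * σ with hρ'
    have hρ'0 : 0 < ρ' := hρ₀0.trans_le (hρle _ hl)
    -- One derivative costs exactly the rate `lam`, while the scale shrinks at rate `lam (1 + σ)`.
    -- The error is negligible against the scale since `lam σ < ρ'`.
    have hρρ : ρ = ρ' + lam := by
      rw [hρ, hρ']
      push_cast
      ring
    have hρ'1 := hρle _ hl
    refine hasDerivWithinAt_of_floor h.tower (hv l hl').2.1 (hv _ hl).2.1 (hjet.cont l hl')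
      (hjet.deriv l hl) hμlim hμ0 h.le_len (hv l hl').2.2.2 (hv _ hl).2.2.2 ?_ ?_ hz
    · have hlim : Tendsto (fun k : ℕ => E * P * B * Real.exp (lam * (1 + σ)) *
          Real.exp (lam * (1 + σ) - ρ) ^ k) atTop
          (𝓝 (E * P * B * Real.exp (lam * (1 + σ)) * 0)) := by
        refine (tendsto_pow_atTop_nhds_zero_of_lt_one (Real.exp_pos _).le
          (Real.exp_lt_one_iff.2 ?_)).const_mul _
        have : lam * σ < ρ₀ := by linarith
        linarith
      rw [mul_zero] at hlim
      refine hlim.congr fun k => ?_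
      simp only [hμ]
      rw [← Real.exp_nat_mul, ← Real.exp_nat_mul, div_eq_mul_inv, mul_inv, inv_inv, ← Real.exp_neg]
      rw [show -(-(lam * (1 + σ)) * ((k + 1 : ℕ) : ℝ)) = lam * (1 + σ) + lam * (1 + σ) * k by
        push_cast; ring, show (k : ℝ) * (lam * (1 + σ) - ρ) = lam * (1 + σ) * k + k * -ρ by ring,
        Real.exp_add, Real.exp_add]
      ring
    · have hlim : Tendsto (fun k : ℕ => E * P * Real.exp (-ρ') ^ k) atTop (𝓝 (E * P * 0)) :=
        (tendsto_pow_atTop_nhds_zero_of_lt_one (Real.exp_pos _).le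
          (Real.exp_lt_one_iff.2 (by linarith))).const_mul _
      rwa [mul_zero] at hlim
  · intro x hx y hy hxy
    have hpow : 0 ≤ (y - x) ^ θ := Real.rpow_nonneg (by linarith) _
    -- Distances above `μ 0 = B⁻¹` need only the sup bound of `v (n - 1)`.
    rcases le_or_gt (y - x) (μ 0) with hle | hgt
    · have hfl := hfloor (f (n - 1)) f₁ f₂ P hP (hjet.cont _ hn1) hjet.deriv_last hjet.deriv₁
        hjet.bound (fun k α y hy => by
          have := hS _ hn1 k α y hy
          rwa [hlast] at this)
      have hε := (hv _ hn1).2.2.2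
      rw [hlast] at hε
      have hmain := holder_of_floor h.tower (hv _ hn1).2.1 (ε := fun k =>
          E * P * Real.exp (-(lam * (1 - a) - 2 * σ)) ^ k)
        (H := fun k => G * P * Real.exp (σ * (2 + lam) * k)) (θ := θ) (s := τ / 2)
        (C₁ := C₁ * P) (C₂ := G * P) hμlim hμ0 h.le_len hε (fun k => by positivity) hθ0.le
        (by linarith) (fun k α i hi x hx y hy hxy => by
          have := hfl k α i hi x hx y hy hxy
          rwa [show 1 - (a + τ / 2) = θ + τ / 2 by rw [hθ]; ring] at this) ?_ ?_ hx hy hxy hle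
      · refine hmain.trans (mul_le_mul_of_nonneg_right ?_ hpow)
        calc 4 * (C₁ * P) + 2 * (G * P) = (4 * C₁ + 2 * G) * P := by ring
          _ ≤ _ := mul_le_mul_of_nonneg_right (by linarith) hP
      · intro k
        have hk : (0 : ℝ) ≤ k := Nat.cast_nonneg k
        simp only [hμ]
        rw [scale_rpow hB, ← Real.exp_nat_mul]
        have e1 : B⁻¹ ≤ B ^ (-θ) := by
          rw [Real.rpow_neg hB.le]
          exact inv_anti₀ (Real.rpow_pos_of_pos hB _) (rpow_le_self_of_one_le h.one_le hθ1)
        have e2 : Real.exp (k * -(lam * (1 - a) - 2 * σ)) ≤ Real.exp (lam * (1 + σ) * θ) *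
            Real.exp (-(lam * (1 + σ) * θ) * ((k + 1 : ℕ) : ℝ)) := by
          rw [← Real.exp_add, Real.exp_le_exp]
          have : lam * (1 + σ) * θ ≤ lam * (1 - a) - 2 * σ := by
            have : lam * σ * θ ≤ lam * σ := mul_le_of_le_one_right hlamσ.le hθ1
            have : lam * θ = lam * (1 - a) - lam * τ := by rw [hθ]; ring
            linarith
          have := mul_le_mul_of_nonneg_left this hk
          push_cast
          linarith
        calc E * P * Real.exp (k * -(lam * (1 - a) - 2 * σ))
            ≤ E * P * (Real.exp (lam * (1 + σ) * θ) *
              Real.exp (-(lam * (1 + σ) * θ) * ((k + 1 : ℕ) : ℝ))) := by gcongr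
          _ = C₁ * P * (B⁻¹ * Real.exp (-(lam * (1 + σ) * θ) * ((k + 1 : ℕ) : ℝ))) := by
            rw [hC₁]
            field_simp
          _ ≤ _ := by gcongr
      · intro k
        have hk : (0 : ℝ) ≤ k := Nat.cast_nonneg k
        simp only [hμ]
        rw [scale_rpow hB]
        have e1 : B ^ (-(τ / 2)) ≤ 1 :=
          Real.rpow_le_one_of_one_le_of_nonpos h.one_le (by linarith)
        -- The growth on the floors is beaten by `μ k ^ (τ/2)`; this is what the hypothesis on `σ (2
        -- + lam)` is for.
        have e2 : Real.exp (σ * (2 + lam) * k) *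
            Real.exp (-(lam * (1 + σ) * (τ / 2)) * k) ≤ 1 := by
          rw [← Real.exp_add, ← add_mul]
          refine Real.exp_le_one_iff.2 (mul_nonpos_of_nonpos_of_nonneg ?_ hk)
          have : 0 ≤ lam * σ * (τ / 2) := by positivity
          linarith
        calc G * P * Real.exp (σ * (2 + lam) * k) *
              (B ^ (-(τ / 2)) * Real.exp (-(lam * (1 + σ) * (τ / 2)) * k))
            = G * P * (B ^ (-(τ / 2)) * (Real.exp (σ * (2 + lam) * k) *
              Real.exp (-(lam * (1 + σ) * (τ / 2)) * k))) := by ring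
          _ ≤ G * P * (1 * 1) := by gcongr
          _ = G * P := by ring
    · have e1 := hbound _ hn1 x hx
      have e2 := hbound _ hn1 y hy
      have e3 : 1 ≤ B * (y - x) ^ θ := by
        have : B⁻¹ ^ θ ≤ (y - x) ^ θ := by
          refine Real.rpow_le_rpow (by positivity) ?_ hθ0.le
          have := hgt.le
          simpa [hμ] using this
        rw [Real.inv_rpow hB.le] at this
        have e4 : (B ^ θ)⁻¹ ≤ (y - x) ^ θ := this
        have e5 := rpow_le_self_of_one_le h.one_le hθ1
        have e6 : 0 < B ^ θ := Real.rpow_pos_of_pos hB _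
        calc (1 : ℝ) = B ^ θ * (B ^ θ)⁻¹ := (mul_inv_cancel₀ e6.ne').symm
          _ ≤ B * (y - x) ^ θ := mul_le_mul e5 e4 (by positivity) hB.le
      have e7 : |v (n - 1) y - v (n - 1) x| ≤ 2 * (E * P) := by
        rw [abs_le] at *
        constructor <;> linarith
      calc |v (n - 1) y - v (n - 1) x| ≤ 2 * (E * P) * 1 := by rw [mul_one]; exact e7
        _ ≤ 2 * (E * P) * (B * (y - x) ^ θ) := by gcongr
        _ = 2 * E * B * P * (y - x) ^ θ := by ring
        _ ≤ _ := by
          refine mul_le_mul_of_nonneg_right (mul_le_mul_of_nonneg_right ?_ hP) hpow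
          linarith
  · intro k x hx
    refine (hbase 0 (by omega) k x hx).trans ?_
    have hle := hρle 0 (by omega)
    have he : Real.exp (-(lam * ((n : ℝ) - (0 : ℕ) - a) - 2 * σ)) ≤ Real.exp (-ρ₀) :=
      Real.exp_le_exp.2 (by linarith)
    have hEC : E ≤ E + (4 * C₁ + 2 * G) + 2 * E * B + 1 := by linarith
    gcongr

end Renorm

end IETData

/-! ### Functions with polynomial or logarithmic singularities -/

theorem ContDiffOn.iteratedDeriv_of_isOpen {f : ℝ → ℝ} {U : Set ℝ} (hU : IsOpen U) (l k : ℕ)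
    (hf : ContDiffOn ℝ ((k + l : ℕ) : WithTop ℕ∞) f U) :
    ContDiffOn ℝ (k : WithTop ℕ∞) (iteratedDeriv l f) U := by
  induction l generalizing k with
  | zero => simpa using hf
  | succ l ih =>
    have h1 := ih (k + 1) (by rwa [show k + 1 + l = k + (l + 1) by ring])
    rw [iteratedDeriv_succ]
    push_cast at h1
    exact ((contDiffOn_succ_iff_deriv_of_isOpen hU).1 h1).2.2

theorem iteratedDeriv_iteratedDeriv (k l : ℕ) (f : ℝ → ℝ) :
    iteratedDeriv k (iteratedDeriv l f) = iteratedDeriv (k + l) f := by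
  simp only [iteratedDeriv_eq_iterate, Function.iterate_add_apply]

section Singular

variable {F F' : ℝ → ℝ} {l r b M G : ℝ}

/-- The derivative is integrable at the end, and the resulting modulus of continuity gives the
Cauchy criterion. -/
theorem exists_tendsto_left_of_deriv_le (hlr : l < r) (hb : 0 ≤ b) (hb1 : b < 1) (hM : 0 ≤ M)
    (hF : ∀ s ∈ Ioo l r, HasDerivAt F (F' s) s)
    (hle : ∀ s ∈ Ioo l r, |F' s| ≤ G + M * ((s - l) ^ (-b) + (r - s) ^ (-b))) :
    ∃ y, Tendsto F (𝓝[>] l) (𝓝 y) := by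
  have h1b : 0 < 1 - b := by linarith
  refine cauchy_map_iff_exists_tendsto.1 (Metric.cauchy_iff.2 ⟨inferInstance, fun ε hε => ?_⟩)
  have hcont : Tendsto (fun s : ℝ => |G| * s + 2 * M / (1 - b) * s ^ (1 - b)) (𝓝 0) (𝓝 0) := by
    have : Continuous fun s : ℝ => |G| * s + 2 * M / (1 - b) * s ^ (1 - b) :=
      (continuous_const.mul continuous_id).add
        (continuous_const.mul (Real.continuous_rpow_const h1b.le))
    have h := this.tendsto 0
    rwa [Real.zero_rpow h1b.ne', mul_zero, mul_zero, add_zero] at h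
  obtain ⟨δ, hδ, hδε⟩ := Metric.eventually_nhds_iff.1 (hcont.eventually (gt_mem_nhds hε))
  refine ⟨F '' Ioo l (min r (l + δ)), image_mem_map (Ioo_mem_nhdsGT (lt_min hlr (by linarith))), ?_⟩
  have key : ∀ x ∈ Ioo l (min r (l + δ)), ∀ y ∈ Ioo l (min r (l + δ)), x ≤ y →
      dist (F x) (F y) < ε := by
    intro x hx y hy hxy
    have hx' : x ∈ Ioo l r := ⟨hx.1, hx.2.trans_le (min_le_left _ _)⟩
    have hy' : y ∈ Ioo l r := ⟨hy.1, hy.2.trans_le (min_le_left _ _)⟩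
    have h1 := abs_sub_le_of_deriv_le_rpow hb hb1 hM hF hle hx' hy' hxy
    have h2 : y < l + δ := hy.2.trans_le (min_le_right _ _)
    have h3 := hδε (y := y - x) (by
      rw [Real.dist_eq, sub_zero, abs_of_nonneg (by linarith)]
      linarith [hx.1])
    rw [dist_comm, Real.dist_eq]
    have h4 : G * (y - x) ≤ |G| * (y - x) :=
      mul_le_mul_of_nonneg_right (le_abs_self G) (by linarith)
    linarith
  rintro _ ⟨x, hx, rfl⟩ _ ⟨y, hy, rfl⟩
  rcases le_total x y with h | h
  · exact key x hx y hy h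
  · rw [dist_comm]
    exact key y hy x hx h

theorem exists_bound_of_deriv_le (hlr : l < r) (hb : 0 ≤ b) (hb1 : b < 1) (hM : 0 ≤ M)
    (hG : 0 ≤ G) (hF : ∀ s ∈ Ioo l r, HasDerivAt F (F' s) s)
    (hle : ∀ s ∈ Ioo l r, |F' s| ≤ G + M * ((s - l) ^ (-b) + (r - s) ^ (-b))) :
    ∃ c, 0 ≤ c ∧ ∀ s ∈ Ioo l r, |F s| ≤ c := by
  have h1b : 0 < 1 - b := by linarith
  have hmid : (l + r) / 2 ∈ Ioo l r := ⟨by linarith, by linarith⟩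
  have hbd : ∀ x ∈ Ioo l r, ∀ y ∈ Ioo l r, x ≤ y → |F y - F x| ≤
      G * (r - l) + 2 * M / (1 - b) * (r - l) ^ (1 - b) := by
    intro x hx y hy hxy
    refine (abs_sub_le_of_deriv_le_rpow hb hb1 hM hF hle hx hy hxy).trans ?_
    have h1 : y - x ≤ r - l := by linarith [hx.1, hy.2]
    have h2 : (y - x) ^ (1 - b) ≤ (r - l) ^ (1 - b) :=
      Real.rpow_le_rpow (by linarith) h1 h1b.le
    gcongr
  have hrl : 0 ≤ (r - l) ^ (1 - b) := Real.rpow_nonneg (by linarith) _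
  have hrl' : 0 ≤ r - l := by linarith
  refine ⟨|F ((l + r) / 2)| + (G * (r - l) + 2 * M / (1 - b) * (r - l) ^ (1 - b)), by positivity,
    fun s hs => ?_⟩
  have h3 : |F s - F ((l + r) / 2)| ≤ G * (r - l) + 2 * M / (1 - b) * (r - l) ^ (1 - b) := by
    rcases le_total s ((l + r) / 2) with h | h
    · rw [abs_sub_comm]
      exact hbd s hs _ hmid h
    · exact hbd _ hmid s hs h
  have := abs_sub_abs_le_abs_sub (F s) (F ((l + r) / 2))
  linarith

theorem lintegral_lt_top_of_le (hlr : l < r) (hb1 : b < 1)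
    (hle : ∀ s ∈ Ioo l r, |F s| ≤ G + M * ((s - l) ^ (-b) + (r - s) ^ (-b))) :
    ∫⁻ x in Ioo l r, ‖F x‖ₑ < ∞ := by
  have h1 : IntervalIntegrable (fun s : ℝ => (s - l) ^ (-b)) volume l r := by
    have := (intervalIntegral.intervalIntegrable_rpow' (a := l - l) (b := r - l)
      (show -1 < -b by linarith)).comp_sub_right l
    simpa using this
  have h2 : IntervalIntegrable (fun s : ℝ => (r - s) ^ (-b)) volume l r := by
    have := (intervalIntegral.intervalIntegrable_rpow' (a := r - l) (b := r - r)
      (show -1 < -b by linarith)).comp_sub_left r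
    simpa using this
  have h3 : IntervalIntegrable (fun s : ℝ => G + M * ((s - l) ^ (-b) + (r - s) ^ (-b)))
      volume l r := intervalIntegrable_const.add ((h1.add h2).const_mul M)
  rw [intervalIntegrable_iff_integrableOn_Ioo_of_le hlr.le] at h3
  refine lt_of_le_of_lt (setLIntegral_mono' measurableSet_Ioo fun s hs => ?_) h3.hasFiniteIntegral
  rw [Real.enorm_eq_ofReal_abs, Real.enorm_eq_ofReal_abs]
  exact ENNReal.ofReal_le_ofReal ((hle s hs).trans (le_abs_self _))

end Singular

namespace IETData

variable {A : Type*} [Fintype A] [DecidableEq A] {m : ℕ} {X : IETData A m}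

theorem isOpen_iUnion_Jo : IsOpen (⋃ α, Ioo (X.left α) (X.right α)) :=
  isOpen_iUnion fun _ => isOpen_Ioo

theorem MemPaG.hasDerivAt {n : ℕ} {a : ℝ} {φ : ℝ → ℝ} (h : X.MemPaG n a φ) {l : ℕ} (hl : l ≤ n)
    {α : A} {x : ℝ} (hx : x ∈ X.Jo α) :
    HasDerivAt (iteratedDeriv l φ) (iteratedDeriv (l + 1) φ x) x := by
  have hmem : x ∈ ⋃ α, Ioo (X.left α) (X.right α) := mem_iUnion.2 ⟨α, hx⟩
  have h1 : ContDiffOn ℝ ((n - l + 1 : ℕ) : WithTop ℕ∞) (iteratedDeriv l φ)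
      (⋃ α, Ioo (X.left α) (X.right α)) := by
    refine ContDiffOn.iteratedDeriv_of_isOpen isOpen_iUnion_Jo l _ ?_
    rw [show n - l + 1 + l = n + 1 by omega]
    exact h.1
  have h2 := (h1.contDiffAt (isOpen_iUnion_Jo.mem_nhds hmem)).differentiableAt
    (by simp)
  rw [iteratedDeriv_succ]
  exact h2.hasDerivAt

/-- The bound of the derivative that is contained in the seminorm `p_a`. -/
theorem abs_deriv_le_of_pa {a b P : ℝ} (hp : ∀ α, 0 < X.len α) (hab : a ≤ b)
    (hP : 0 ≤ P)
    {ψ : ℝ → ℝ} (h : X.pa a ψ ≤ ENNReal.ofReal P) {α : A} {x : ℝ} (hx : x ∈ X.Jo α) :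
    |deriv ψ x| ≤ X.total ^ (b - a) * P *
      ((x - X.left α) ^ (-1 - b) + (X.right α - x) ^ (-1 - b)) := by
  have h1 : ‖deriv ψ x‖ₑ * ENNReal.ofReal (min (x - X.left α) (X.right α - x) ^ (1 + a)) ≤
      ENNReal.ofReal P := by
    refine le_trans ?_ h
    unfold pa
    exact le_iSup_of_le α (le_iSup₂_of_le x hx le_rfl)
  set t := min (x - X.left α) (X.right α - x) with ht
  have ht0 : 0 < t := lt_min (by linarith [hx.1]) (by linarith [hx.2])
  rw [Real.enorm_eq_ofReal_abs, ← ENNReal.ofReal_mul (abs_nonneg _),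
    ENNReal.ofReal_le_ofReal_iff hP] at h1
  have htot : t ≤ X.total := by
    have := right_le_total hp α
    have := left_nonneg hp α
    exact (min_le_left _ _).trans (by linarith [hx.2])
  have htle : t ^ (-1 - b) ≤ (x - X.left α) ^ (-1 - b) + (X.right α - x) ^ (-1 - b) := by
    have p1 : 0 ≤ (x - X.left α) ^ (-1 - b) := Real.rpow_nonneg (by linarith [hx.1]) _
    have p2 : 0 ≤ (X.right α - x) ^ (-1 - b) := Real.rpow_nonneg (by linarith [hx.2]) _
    rcases min_choice (x - X.left α) (X.right α - x) with h1 | h1 <;> rw [ht, h1] <;> linarith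
  have hpow : t ^ (b - a) ≤ X.total ^ (b - a) := Real.rpow_le_rpow ht0.le htot (by linarith)
  -- Passing from the exponent `a` to a larger `b` costs `t ^ (b - a)`, bounded by a power of `|I|`.
  -- A positive exponent is needed later, also when `a = 0`.
  calc |deriv ψ x| = |deriv ψ x| * t ^ (1 + a) * (t ^ (b - a) * t ^ (-1 - b)) := by
        rw [mul_assoc, ← Real.rpow_add ht0, ← Real.rpow_add ht0]
        rw [show 1 + a + (b - a + (-1 - b)) = 0 by ring, Real.rpow_zero, mul_one]
    _ ≤ P * (X.total ^ (b - a) * ((x - X.left α) ^ (-1 - b) + (X.right α - x) ^ (-1 - b))) := by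
        refine mul_le_mul h1 (mul_le_mul hpow htle ?_ ?_) ?_ hP
        · exact Real.rpow_nonneg ht0.le _
        · exact Real.rpow_nonneg (ht0.le.trans htot) _
        · exact mul_nonneg (Real.rpow_nonneg ht0.le _) (Real.rpow_nonneg ht0.le _)
    _ = _ := by ring

/-- Downward induction on the order: integrating the singularity of `D^{n+1} φ` lowers its exponent
by one, and from order `n - 1` downwards everything is bounded. -/
theorem MemPaG.exists_bound {n : ℕ} {a : ℝ} {φ : ℝ → ℝ} (h : X.MemPaG n a φ)
    (hp : ∀ α, 0 < X.len α) {b : ℝ} (hab : a ≤ b) (hb : 0 < b) (hb1 : b < 1) (α : A) {l : ℕ}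
    (hl : l ≤ n) : ∃ G M : ℝ, 0 ≤ G ∧ 0 ≤ M ∧ ∀ x ∈ X.Jo α,
      |iteratedDeriv l φ x| ≤ G + M * ((x - X.left α) ^ (-b) + (X.right α - x) ^ (-b)) := by
  have hlr := left_lt_right hp α
  have ht : 0 ≤ X.total := (left_nonneg hp α).trans (hlr.le.trans (right_le_total hp α))
  induction hl using Nat.decreasingInduction with
  | self =>
    have h1 : X.pa a (iteratedDeriv n φ) ≤
        ENNReal.ofReal (X.pa a (iteratedDeriv n φ)).toReal := by
      rw [ENNReal.ofReal_toReal h.2.1.ne]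
    have hW : 0 ≤ X.total ^ (b - a) * (X.pa a (iteratedDeriv n φ)).toReal :=
      mul_nonneg (Real.rpow_nonneg ht _) ENNReal.toReal_nonneg
    refine ⟨|iteratedDeriv n φ ((X.left α + X.right α) / 2)|, _, abs_nonneg _, ?_, fun x hx =>
      abs_le_of_deriv_le_rpow hb hb1 hW (fun s hs => h.hasDerivAt le_rfl hs)
        (fun s hs => ?_) (by linarith) (by linarith) hx⟩
    · exact div_nonneg (mul_nonneg (by norm_num) hW) hb.le
    · rw [iteratedDeriv_succ]
      exact abs_deriv_le_of_pa hp hab ENNReal.toReal_nonneg h1 hs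
  | of_succ l hl ih =>
    obtain ⟨G, M, hG, hM, hle⟩ := ih
    obtain ⟨c, hc, hbd⟩ := exists_bound_of_deriv_le hlr hb.le hb1 hM hG
      (fun s hs => h.hasDerivAt (le_of_lt hl) hs) hle
    exact ⟨c, 0, hc, le_rfl, fun x hx => by simpa using hbd x hx⟩

theorem MemPaG.exists_tendsto {n : ℕ} {a : ℝ} {φ : ℝ → ℝ} (h : X.MemPaG n a φ)
    (hp : ∀ α, 0 < X.len α) (ha : 0 ≤ a) (ha1 : a < 1) (α : A) {l : ℕ} (hl : l < n) :
    ∃ y, Tendsto (iteratedDeriv l φ) (𝓝[>] X.left α) (𝓝 y) := by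
  obtain ⟨G, M, -, hM, hle⟩ := h.exists_bound hp (b := (1 + a) / 2) (by linarith) (by linarith)
    (by linarith) α (Nat.succ_le_of_lt hl)
  exact exists_tendsto_left_of_deriv_le (left_lt_right hp α) (by linarith) (by linarith) hM
    (fun s hs => h.hasDerivAt hl.le hs) hle

theorem MemPaG.paNorm_lt_top {n : ℕ} {a : ℝ} {φ : ℝ → ℝ} (h : X.MemPaG n a φ)
    (hp : ∀ α, 0 < X.len α) (ha : 0 ≤ a) (ha1 : a < 1) : X.paNorm n a φ < ∞ := by
  unfold paNorm
  refine ENNReal.add_lt_top.2 ⟨ENNReal.sum_lt_top.2 fun l hl => ?_, h.2.1⟩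
  have hl' : l ≤ n := Nat.lt_succ_iff.1 (Finset.mem_range.1 hl)
  have hsub : Ico 0 X.total ⊆ ⋃ α, X.J α := fun x hx => mem_iUnion.2 (exists_mem_J hx)
  refine lt_of_le_of_lt (lintegral_mono_set hsub) (lt_of_le_of_lt (lintegral_iUnion_le _ _) ?_)
  rw [tsum_fintype]
  refine ENNReal.sum_lt_top.2 fun α _ => ?_
  obtain ⟨G, M, -, -, hle⟩ := h.exists_bound hp (b := (1 + a) / 2) (by linarith) (by linarith)
    (by linarith) α hl'
  have := lintegral_lt_top_of_le (left_lt_right hp α) (by linarith) hle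
  rwa [setLIntegral_congr Ioo_ae_eq_Ico] at this

/-- The left side is a tail of the sum on the right. All hypotheses can therefore be expressed with
the norm of `φ` alone. -/
theorem paNorm_iteratedDeriv_le {n l : ℕ} (hl : l ≤ n) (a : ℝ) (φ : ℝ → ℝ) :
    X.paNorm (n - l) a (iteratedDeriv l φ) ≤ X.paNorm n a φ := by
  unfold paNorm
  simp only [iteratedDeriv_iteratedDeriv, Nat.sub_add_cancel hl]
  refine add_le_add ?_ le_rfl
  have h1 := Finset.sum_range_add (fun k => ∫⁻ x in Ico 0 X.total, ‖iteratedDeriv k φ x‖ₑ) l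
    (n - l + 1)
  rw [show l + (n - l + 1) = n + 1 by omega] at h1
  rw [h1]
  simp only [add_comm l]
  exact le_add_self

/-! ### Special Birkhoff sums -/

theorem S_eq {N : ℕ → ℕ} {k : ℕ} (hp : ∀ α, 0 < (X.accel N k).len α) (ψ : ℝ → ℝ) {α : A} {x : ℝ}
    (hx : x ∈ (X.accel N k).J α) :
    X.S N k ψ x = birkhoffSum X.T ψ (X.retTime N k α) x := by
  unfold S
  rw [Finset.sum_eq_single α]
  · rw [indicator_of_mem (show x ∈ Ico _ _ from hx)]
    rfl
  · intro β _ hβ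
    rw [indicator_of_notMem]
    intro h
    exact hβ (J_unique hp h hx)
  · simp

theorem abs_birkhoffSum_le_of_supS {N : ℕ → ℕ} {k : ℕ} (hp : ∀ α, 0 < (X.accel N k).len α)
    {ψ : ℝ → ℝ} {c : ℝ} (hc : 0 ≤ c) (h : X.supS N k ψ ≤ ENNReal.ofReal c) {α : A} {x : ℝ}
    (hx : x ∈ (X.accel N k).Jo α) : |birkhoffSum X.T ψ (X.retTime N k α) x| ≤ c := by
  have h1 : ‖X.S N k ψ x‖ₑ ≤ ENNReal.ofReal c := by
    refine le_trans ?_ h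
    unfold supS
    exact le_iSup_of_le α (le_iSup₂_of_le x hx le_rfl)
  rwa [S_eq hp ψ (Jo_subset_J α hx), Real.enorm_eq_ofReal_abs,
    ENNReal.ofReal_le_ofReal_iff hc] at h1

/-! ### The right-continuous version of a function on the open intervals -/

theorem rightLim_eq_of_mem_Jo {ψ ψ' : ℝ → ℝ} (hψ : ∀ α, ∀ x ∈ X.Jo α, HasDerivAt ψ (ψ' x) x)
    {α : A} {x : ℝ} (hx : x ∈ X.Jo α) : Function.rightLim ψ x = ψ x :=
  (hψ α x hx).continuousAt.continuousWithinAt.rightLim_eq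

theorem hasDerivAt_rightLim {ψ ψ' : ℝ → ℝ} (hψ : ∀ α, ∀ x ∈ X.Jo α, HasDerivAt ψ (ψ' x) x)
    {α : A} {x : ℝ} (hx : x ∈ X.Jo α) : HasDerivAt (Function.rightLim ψ) (ψ' x) x := by
  refine (hψ α x hx).congr_of_eventuallyEq ?_
  filter_upwards [isOpen_Ioo.mem_nhds hx] with y hy
  exact rightLim_eq_of_mem_Jo hψ hy

/-- The values at the left end points are arbitrary in the function space; replacing them by right
limits makes the tower estimates available on half-open intervals. -/
theorem continuousOn_rightLim {ψ ψ' : ℝ → ℝ} (hψ : ∀ α, ∀ x ∈ X.Jo α, HasDerivAt ψ (ψ' x) x)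
    (hlim : ∀ α, ∃ y, Tendsto ψ (𝓝[>] X.left α) (𝓝 y)) (α : A) :
    ContinuousOn (Function.rightLim ψ) (X.J α) := by
  intro x hx
  by_cases hxl : x = X.left α
  · subst hxl
    exact (continuousWithinAt_rightLim_Ici (tendsto_rightLim_of_tendsto (hlim α))).mono
      fun y hy => hy.1
  · exact (hasDerivAt_rightLim hψ (mem_Ioo_of_ne hx hxl)).continuousAt.continuousWithinAt

theorem Tower.birkhoffSum_congr {Y : IETData A m} {q : A → ℕ} (h : Tower X Y q) {f f' : ℝ → ℝ}
    (hff : ∀ α, ∀ x ∈ X.Jo α, f x = f' x) {α : A} {x : ℝ} (hx : x ∈ Y.Jo α) :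
    birkhoffSum X.T f (q α) x = birkhoffSum X.T f' (q α) x := by
  refine Finset.sum_congr rfl fun i hi => ?_
  obtain ⟨β, c, hc, h1, h2⟩ := h.floor_interval (Finset.mem_range.1 hi)
  rw [hc x (Jo_subset_J α hx)]
  exact hff β _ ⟨by linarith [hx.1], by linarith [hx.2]⟩

theorem abs_le_of_Jo {Y : IETData A m} {F : ℝ → ℝ} {α : A} (hF : ContinuousOn F (Y.J α)) {c : ℝ}
    (h : ∀ x ∈ Y.Jo α, |F x| ≤ c) {x : ℝ} (hx : x ∈ Y.J α) : |F x| ≤ c := by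
  have hlim : Tendsto F (𝓝[>] x) (𝓝 (F x)) := by
    refine (hF x hx).mono_left (nhdsWithin_le_of_mem ?_)
    exact mem_of_superset (Ioo_mem_nhdsGT hx.2) fun w hw => ⟨hx.1.trans hw.1.le, hw.2⟩
  refine le_of_tendsto hlim.abs ?_
  filter_upwards [Ioo_mem_nhdsGT hx.2] with w hw
  exact h w ⟨hx.1.trans_lt hw.1, hw.2⟩

end IETData

/-! ### Assembly: Hölder norms, uniqueness, independence of `τ` -/

namespace IETData

variable {A : Type*} [Fintype A] [DecidableEq A] {m : ℕ} {X : IETData A m}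

theorem IsOseledets.lam_one_pos {g : ℕ} {lam : ℕ → ℝ} {E : ℤ → Submodule ℝ (A → ℝ)}
    (h : X.IsOseledets g lam E) : 0 < lam 1 := by
  obtain ⟨hg, -, hlt, h0, -⟩ := h
  have key : ∀ d ≤ g, 0 ≤ lam (g + 1 - d) := by
    intro d
    induction d with
    | zero => intro _; simp [h0]
    | succ d ih =>
      intro hd
      have h1 := hlt (g + 1 - (d + 1)) (by omega) (by omega)
      rw [show g + 1 - (d + 1) + 1 = g + 1 - d by omega] at h1
      exact (ih (by omega)).trans h1.le
  have h1 := key (g - 1) (by omega)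
  rw [show g + 1 - (g - 1) = 1 + 1 by omega] at h1
  exact h1.trans_lt (hlt 1 le_rfl hg)

/-- Since `0 < a + τ < 1`, the ceiling of the exponent is `n`. -/
theorem holderInt_eq {n : ℕ} (hn : 1 ≤ n) {a τ : ℝ} (ha : 0 ≤ a) (hτ : 0 < τ) (hτa : τ < 1 - a) :
    holderInt ((n : ℝ) - a - τ) = n - 1 := by
  unfold holderInt
  congr 1
  rw [Nat.ceil_eq_iff (by omega), Nat.cast_sub hn, Nat.cast_one]
  constructor <;> linarith

theorem iteratedDerivWithin_eq_of_hasDerivWithinAt {s : Set ℝ} (hs : UniqueDiffOn ℝ s) {n : ℕ}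
    {w : ℕ → ℝ → ℝ} (hw : ∀ l, l + 1 < n → ∀ z ∈ s, HasDerivWithinAt (w l) (w (l + 1) z) s z)
    {l : ℕ} (hl : l < n) : EqOn (iteratedDerivWithin l (w 0) s) (w l) s := by
  induction l with
  | zero => intro x _; rw [iteratedDerivWithin_zero]
  | succ l ih =>
    intro x hx
    rw [iteratedDerivWithin_succ, derivWithin_congr (ih (by omega)) (ih (by omega) hx)]
    exact (hw l hl x hx).derivWithin (hs x hx)

theorem contDiffOn_of_hasDerivWithinAt {s : Set ℝ} (hs : UniqueDiffOn ℝ s) {n : ℕ}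
    (hn : 1 ≤ n) {w : ℕ → ℝ → ℝ} (hc : ∀ l < n, ContinuousOn (w l) s)
    (hw : ∀ l, l + 1 < n → ∀ z ∈ s, HasDerivWithinAt (w l) (w (l + 1) z) s z) :
    ContDiffOn ℝ ((n - 1 : ℕ) : WithTop ℕ∞) (w 0) s := by
  refine contDiffOn_of_continuousOn_differentiableOn_deriv (n := ((n - 1 : ℕ) : ℕ∞)) ?_ ?_
  · intro l hl
    have hl' : l ≤ n - 1 := by exact_mod_cast hl
    exact (hc l (by omega)).congr (iteratedDerivWithin_eq_of_hasDerivWithinAt hs hw (by omega))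
  · intro l hl z hz
    have hl' : l < n - 1 := by exact_mod_cast hl
    have heq := iteratedDerivWithin_eq_of_hasDerivWithinAt hs hw (l := l) (by omega)
    exact ((hw l (by omega) z hz).congr heq (heq hz)).differentiableWithinAt

/-- The bound of the Hölder norm in terms of pointwise estimates. -/
theorem holderNorm_le {n : ℕ} (hn : 1 ≤ n) {a τ : ℝ} (ha : 0 ≤ a) (hτ : 0 < τ) (hτa : τ < 1 - a)
    {w : ℕ → ℝ → ℝ} (hw : ∀ l, l + 1 < n → ∀ z ∈ Ico 0 X.total,
      HasDerivWithinAt (w l) (w (l + 1) z) (Ico 0 X.total) z) {D : ℝ} (hD : 0 ≤ D)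
    (hbd : ∀ l < n, ∀ x ∈ Ico 0 X.total, |w l x| ≤ D)
    (hhol : ∀ x ∈ Ico 0 X.total, ∀ y ∈ Ico 0 X.total, x < y →
      |w (n - 1) y - w (n - 1) x| ≤ D * (y - x) ^ (1 - a - τ)) :
    X.holderNorm ((n : ℝ) - a - τ) (w 0) ≤ ENNReal.ofReal ((n + 1) * D) := by
  have heq : ∀ l < n, EqOn (iteratedDerivWithin l (w 0) (Ico 0 X.total)) (w l) (Ico 0 X.total) :=
    fun l hl => iteratedDerivWithin_eq_of_hasDerivWithinAt (uniqueDiffOn_Ico _ _) hw hl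
  unfold holderNorm
  rw [holderInt_eq hn ha hτ hτa, Nat.sub_add_cancel hn, Nat.cast_sub hn, Nat.cast_one,
    show (n : ℝ) - a - τ - (n - 1) = 1 - a - τ by ring, add_mul, one_mul,
    ENNReal.ofReal_add (by positivity) hD]
  refine add_le_add ?_ ?_
  · calc ∑ j ∈ Finset.range n, ⨆ x ∈ Ico 0 X.total,
          ‖iteratedDerivWithin j (w 0) (Ico 0 X.total) x‖ₑ
        ≤ ∑ _j ∈ Finset.range n, ENNReal.ofReal D := by
          refine Finset.sum_le_sum fun j hj => iSup₂_le fun x hx => ?_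
          rw [heq j (Finset.mem_range.1 hj) hx, Real.enorm_eq_ofReal_abs]
          exact ENNReal.ofReal_le_ofReal (hbd j (Finset.mem_range.1 hj) x hx)
      _ = ENNReal.ofReal (n * D) := by
          rw [Finset.sum_const, Finset.card_range, nsmul_eq_mul,
            ENNReal.ofReal_mul (Nat.cast_nonneg n), ENNReal.ofReal_natCast]
  · refine iSup₂_le fun x hx => iSup₂_le fun y hy => ?_
    rw [heq _ (by omega) hx, heq _ (by omega) hy]
    rcases eq_or_ne x y with rfl | hne
    · simp
    refine ENNReal.div_le_of_le_mul ?_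
    have hpos : 0 < |x - y| := abs_pos.2 (sub_ne_zero.2 hne)
    rw [edist_dist, Real.dist_eq, ENNReal.ofReal_rpow_of_pos hpos, ← ENNReal.ofReal_mul hD,
      Real.enorm_eq_ofReal_abs]
    refine ENNReal.ofReal_le_ofReal ?_
    rcases lt_or_gt_of_ne hne with hlt | hlt
    · rw [abs_sub_comm, abs_sub_comm x, abs_of_pos (sub_pos.2 hlt)]
      exact hhol x hx y hy hlt
    · rw [abs_of_pos (sub_pos.2 hlt)]
      exact hhol y hy x hx hlt

/-- Solutions of the cohomological equation which tend to `0` on the bases of towers are unique. -/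
theorem eq_of_solutions {Y Y' : ℕ → IETData A m} {q q' : ℕ → A → ℕ}
    (h : ∀ k, Tower X (Y k) (q k)) (h' : ∀ k, Tower X (Y' k) (q' k)) {f v v' : ℝ → ℝ}
    (hv : ∀ x ∈ Ico 0 X.total, f x = v (X.T x) - v x)
    (hv' : ∀ x ∈ Ico 0 X.total, f x = v' (X.T x) - v' x) {η η' : ℕ → ℝ}
    (hη : Tendsto η atTop (𝓝 0)) (hη' : Tendsto η' atTop (𝓝 0))
    (hvη : ∀ k, ∀ x ∈ Ico 0 (Y k).total, |v x| ≤ η k)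
    (hvη' : ∀ k, ∀ x ∈ Ico 0 (Y' k).total, |v' x| ≤ η' k) : EqOn v v' (Ico 0 X.total) := by
  intro x hx
  -- On the shorter of the two bases both solutions are small, so their invariant difference is
  -- small there and hence everywhere.
  have hcase : ∀ k, ∃ (Z : IETData A m) (r : A → ℕ), Tower X Z r ∧ Z.total ≤ (Y k).total ∧
      Z.total ≤ (Y' k).total := by
    intro k
    rcases le_total (Y k).total (Y' k).total with hle | hle
    · exact ⟨Y k, q k, h k, le_rfl, hle⟩
    · exact ⟨Y' k, q' k, h' k, hle, le_rfl⟩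
  choose Z r hZ hZ1 hZ2 using hcase
  have hlim : Tendsto (fun k => η k + η' k) atTop (𝓝 0) := by simpa using hη.add hη'
  have := eq_zero_of_invariant hZ (w := fun x => v x - v' x) (η := fun k => η k + η' k)
    (fun x hx => by linarith [hv x hx, hv' x hx]) hlim (fun k x hx => ?_) hx
  · exact sub_eq_zero.1 this
  · have h1 := hvη k x ⟨hx.1, hx.2.trans_le (hZ1 k)⟩
    have h2 := hvη' k x ⟨hx.1, hx.2.trans_le (hZ2 k)⟩
    rw [abs_le] at *
    constructor <;> linarith

/-- The precision of the accelerating sequence needed for a loss `τ` of the Hölder exponent. -/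
def precision (lam τ : ℝ) : ℝ := lam * τ / (2 * (2 + lam))

theorem precision_pos {lam τ : ℝ} (hlam : 0 < lam) (hτ : 0 < τ) : 0 < precision lam τ := by
  unfold precision
  positivity

theorem precision_mul {lam : ℝ} (hlam : 0 < lam) (τ : ℝ) :
    precision lam τ * (2 + lam) = lam * τ / 2 := by
  unfold precision
  field_simp

/-- The jet of the right-continuous versions of the derivatives of `φ`. -/
theorem MemPaG.singularJet {n : ℕ} (hn : 1 ≤ n) {a b : ℝ} (hp : ∀ α, 0 < X.len α) (ha : 0 ≤ a)
    (ha1 : a < 1) (hab : a ≤ b) {φ : ℝ → ℝ} (h : X.MemPaG n a φ) :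
    SingularJet X n b (X.total ^ (b - a) * (X.paNorm n a φ).toReal)
      (fun l => Function.rightLim (iteratedDeriv l φ)) (iteratedDeriv n φ)
      (iteratedDeriv (n + 1) φ) where
  cont l hl α := continuousOn_rightLim (fun β x hx => h.hasDerivAt hl.le hx)
    (fun β => h.exists_tendsto hp ha ha1 β hl) α
  deriv l hl α x hx := by
    have h1 := hasDerivAt_rightLim (fun β x hx => h.hasDerivAt (l := l) (by omega) hx) hx
    rwa [← rightLim_eq_of_mem_Jo (fun β x hx => h.hasDerivAt (l := l + 1) hl.le hx) hx] at h1
  deriv_last α x hx := by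
    have h1 := hasDerivAt_rightLim (fun β x hx => h.hasDerivAt (l := n - 1) (by omega) hx) hx
    rwa [Nat.sub_add_cancel hn] at h1
  deriv₁ α x hx := h.hasDerivAt le_rfl hx
  bound α x hx := by
    rw [iteratedDeriv_succ]
    refine abs_deriv_le_of_pa hp hab ENNReal.toReal_nonneg ?_ hx
    rw [ENNReal.ofReal_toReal (h.paNorm_lt_top hp ha ha1).ne]
    exact le_add_self

/-- The solution with the Hölder estimate for a single `τ`. -/
theorem exists_holder_solution (hm : 1 ≤ m) (hX : X.IsIET) (hK : X.Keane) {g : ℕ} {lam : ℕ → ℝ}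
    {E : ℤ → Submodule ℝ (A → ℝ)} (hlam : 0 < lam 1) {n : ℕ} (hn : 1 ≤ n) {a τ : ℝ} (ha : 0 ≤ a)
    (hτ : 0 < τ) (hτa : τ < 1 - a) {N : ℕ → ℕ}
    (hN : X.IsFFDCAccel g lam E (precision (lam 1) τ) N) (K : ℝ) :
    ∃ C : ℝ, 0 < C ∧ ∀ φ : ℝ → ℝ, X.MemPaG n a φ →
      (∀ l < n, ∀ k : ℕ, X.supS N k (iteratedDeriv l φ) ≤
        ENNReal.ofReal (K * Real.exp ((-lam 1 * ((n : ℝ) - l - a) + precision (lam 1) τ) * k)) *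
          X.paNorm (n - l) a (iteratedDeriv l φ)) →
      ∃ v : ℝ → ℝ, (∀ x ∉ Ico 0 X.total, v x = 0) ∧
        ContDiffOn ℝ ((n - 1 : ℕ) : WithTop ℕ∞) v (Ico 0 X.total) ∧ v 0 = 0 ∧
        (∀ x ∈ Ico 0 X.total, Function.rightLim φ x = v (X.T x) - v x) ∧
        X.holderNorm ((n : ℝ) - a - τ) v ≤ ENNReal.ofReal C * X.paNorm n a φ ∧
        ∃ (Y : ℕ → IETData A m) (q : ℕ → A → ℕ) (η : ℕ → ℝ), (∀ k, Tower X (Y k) (q k)) ∧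
          Tendsto η atTop (𝓝 0) ∧ ∀ k, ∀ x ∈ Ico 0 (Y k).total, |v x| ≤ η k := by
  have hne : Nonempty A := ⟨X.top.symm 0⟩
  have hp := hX.1
  have hσ := precision_pos hlam hτ
  set σ := precision (lam 1) τ with hσdef
  have hσ2 : σ * (2 + lam 1) = lam 1 * τ / 2 := precision_mul hlam τ
  obtain ⟨B, hB⟩ := exists_renorm hp hm hK hN
  obtain ⟨C, hC, hmain⟩ := hB.exists_smooth_solution hm hX hK hlam hσ hn ha hτ hτa hσ2.le
    -- `K` may be negative, and `W` is the cost of weakening the singularity exponent from `a` to `a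
    -- + τ/2`.
    (K₀ := max K 0) (W := X.total ^ (a + τ / 2 - a)) (le_max_right _ _)
    (Real.rpow_nonneg (total_pos hp).le _)
  refine ⟨(n + 1) * C, by positivity, fun φ hφ hS => ?_⟩
  have hfin := hφ.paNorm_lt_top hp ha (by linarith)
  set P := (X.paNorm n a φ).toReal with hP
  have hP0 : 0 ≤ P := ENNReal.toReal_nonneg
  have hPof : X.paNorm n a φ = ENNReal.ofReal P := (ENNReal.ofReal_toReal hfin.ne).symm
  have hjet := hφ.singularJet hn hp ha (by linarith) (show a ≤ a + τ / 2 by linarith)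
  obtain ⟨v, hv, hvd, hvh, hvb⟩ := hmain _ _ _ P hP0 hjet (fun l hl k α y hy => by
    have htow := hB.tower k
    refine abs_le_of_Jo (htow.continuousOn_birkhoffSum (hjet.cont l hl) le_rfl)
      (fun x hx => ?_) hy
    rw [htow.birkhoffSum_congr (fun β x hx => rightLim_eq_of_mem_Jo
      (fun β x hx => hφ.hasDerivAt hl.le hx) hx) hx]
    refine abs_birkhoffSum_le_of_supS htow.pos (by positivity) ((hS l hl k).trans ?_) hx
    refine (mul_le_mul' (ENNReal.ofReal_le_ofReal (mul_le_mul_of_nonneg_right (le_max_left K 0)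
      (Real.exp_pos _).le)) ((paNorm_iteratedDeriv_le hl.le a φ).trans hPof.le)).trans
      (le_of_eq ?_)
    rw [← ENNReal.ofReal_mul (by positivity), mul_right_comm]
    congr 4
    ring)
  set I := Ico 0 X.total with hI
  -- Setting the solution to `0` off `I` makes solutions for different `τ` equal as functions on the
  -- line.
  set w : ℕ → ℝ → ℝ := fun l => I.indicator (v l) with hw
  have hwv : ∀ l, EqOn (w l) (v l) I := fun l x hx => indicator_of_mem hx _
  have h0I : (0 : ℝ) ∈ I := ⟨le_rfl, total_pos hp⟩
  have hwd : ∀ l, l + 1 < n → ∀ z ∈ I, HasDerivWithinAt (w l) (w (l + 1) z) I z := by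
    intro l hl z hz
    rw [hwv _ hz]
    exact (hvd l hl z hz).congr (hwv l) (hwv l hz)
  have hn0 : 0 < n := by omega
  refine ⟨w 0, fun x hx => indicator_of_notMem hx _, ?_, ?_, ?_, ?_,
    X.accel N, X.retTime N, fun k => C * P * Real.exp (-(lam 1 * (1 - a) - 2 * σ)) ^ k,
    hB.tower, ?_, ?_⟩
  · exact contDiffOn_of_hasDerivWithinAt (uniqueDiffOn_Ico _ _) hn
      (fun l hl => (hv l hl).2.1.congr (hwv l)) hwd
  · rw [hwv 0 h0I, (hv 0 hn0).1]
  · intro x hx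
    rw [hwv 0 hx, hwv 0 (T_mem hp hx)]
    have := (hv 0 hn0).2.2.1 x hx
    rwa [iteratedDeriv_zero] at this
  · refine (holderNorm_le hn ha hτ hτa hwd (D := C * P) (by positivity) (fun l hl x hx => ?_)
      (fun x hx y hy hxy => ?_)).trans (le_of_eq ?_)
    · rw [hwv l hx]
      exact (hv l hl).2.2.2 x hx
    · rw [hwv _ hx, hwv _ hy]
      exact hvh x hx y hy hxy
    · rw [hPof, ← ENNReal.ofReal_mul (by positivity), mul_assoc]
  · have hlim : Tendsto (fun k : ℕ => C * P * Real.exp (-(lam 1 * (1 - a) - 2 * σ)) ^ k) atTop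
        (𝓝 (C * P * 0)) := by
      refine (tendsto_pow_atTop_nhds_zero_of_lt_one (Real.exp_pos _).le
        (Real.exp_lt_one_iff.2 ?_)).const_mul _
      have h1 : lam 1 * τ < lam 1 * (1 - a) := mul_lt_mul_of_pos_left hτa hlam
      have h2 : 0 < lam 1 * τ := mul_pos hlam hτ
      have h3 : 0 < σ * lam 1 := mul_pos hσ hlam
      linarith
    rwa [mul_zero] at hlim
  · intro k x hx
    rw [hwv 0 ⟨hx.1, hx.2.trans_le (hB.tower k).total_le⟩]
    exact hvb k x hx

end IETData

end

theorem theorem6p4 {A : Type*} [Fintype A] [DecidableEq A] {m : ℕ} (X : IETData A m)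
    (g : ℕ) (lam : ℕ → ℝ) (E : ℤ → Submodule ℝ (A → ℝ)) (hX : X.FFDC g lam E)
    (N : ℝ → ℕ → ℕ) (hN : ∀ τ : ℝ, 0 < τ → X.IsFFDCAccel g lam E τ (N τ))
    (n : ℕ) (hn : 1 ≤ n) (a : ℝ) (ha0 : 0 ≤ a) (ha1 : a < 1) (K : ℝ → ℝ) :
    ∃ C : ℝ → ℝ, (∀ τ, 0 < C τ) ∧
      ∀ φ : ℝ → ℝ, X.MemPaG n a φ →
        (∀ τ : ℝ, 0 < τ → ∀ l : ℕ, l < n → ∀ k : ℕ,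
          X.supS (N τ) k (iteratedDeriv l φ) ≤
            ENNReal.ofReal (K τ * Real.exp ((-lam 1 * ((n : ℝ) - l - a) + τ) * k)) *
              X.paNorm (n - l) a (iteratedDeriv l φ)) →
        (∀ τ : ℝ, 0 < τ → ∀ k : ℕ,
          X.meanS (N τ) k (iteratedDeriv n φ) ≤
            ENNReal.ofReal (K τ * Real.exp ((lam 1 * a + τ) * k)) *
              X.paNorm 0 a (iteratedDeriv n φ)) →
        ∃ v : ℝ → ℝ,
          ContDiffOn ℝ ((n - 1 : ℕ) : WithTop ℕ∞) v (Ico 0 X.total) ∧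
          v 0 = 0 ∧
          (∀ α, ∀ x ∈ Ioo (X.left α) (X.right α), φ x = v (X.T x) - v x) ∧
          (∀ α, Tendsto φ (𝓝[>] X.left α) (𝓝 (v (X.T (X.left α)) - v (X.left α)))) ∧
          ∀ τ : ℝ, 0 < τ → τ < 1 - a →
            X.MemHolder ((n : ℝ) - a - τ) v ∧
            X.holderNorm ((n : ℝ) - a - τ) v ≤ ENNReal.ofReal (C τ) * X.paNorm n a φ := by
  obtain ⟨hIET, hK, hOs, -⟩ := hX
  have hm := IETData.one_le_of_finrank hOs.1 hOs.2.1
  have hlam := hOs.lam_one_pos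
  have hp := hIET.1
  have hsol := fun (τ : ℝ) (h : 0 < τ ∧ τ < 1 - a) =>
    IETData.exists_holder_solution hm hIET hK hlam hn ha0 h.1 h.2
      (hN _ (IETData.precision_pos hlam h.1)) (K (IETData.precision (lam 1) τ))
  choose! C hC hsol using hsol
  -- The value `1` only provides positivity outside the relevant range of `τ`.
  refine ⟨fun τ => if 0 < τ ∧ τ < 1 - a then C τ else 1, fun τ => ?_, fun φ hφ hS _ => ?_⟩
  · dsimp only
    split_ifs with h
    · exact hC τ h
    · exact one_pos
  -- Any admissible `τ` can define `v`; uniqueness then identifies it with the solution for every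
  -- other one.
  have hτ₀ : 0 < (1 - a) / 2 ∧ (1 - a) / 2 < 1 - a := ⟨by linarith, by linarith⟩
  have hsol' := fun (τ : ℝ) (h : 0 < τ ∧ τ < 1 - a) =>
    hsol τ h φ hφ (hS _ (IETData.precision_pos hlam h.1))
  obtain ⟨v, hv0, hvc, hv00, hvcoh, -, Y, q, η, hY, hη, hvη⟩ := hsol' _ hτ₀
  have hjo : ∀ α, ∀ x ∈ X.Jo α, HasDerivAt φ (iteratedDeriv 1 φ x) x := fun α x hx => by
    simpa using hφ.hasDerivAt (Nat.zero_le n) hx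
  refine ⟨v, hvc, hv00, fun α x hx => ?_, fun α => ?_, fun τ h1 h2 => ?_⟩
  · rw [← hvcoh x (IETData.J_subset hp α (IETData.Jo_subset_J α hx)),
      IETData.rightLim_eq_of_mem_Jo hjo hx]
  · rw [← hvcoh _ (IETData.J_subset hp α (IETData.left_mem_J hp α))]
    have := hφ.exists_tendsto hp ha0 ha1 α (show 0 < n by omega)
    rw [iteratedDeriv_zero] at this
    exact tendsto_rightLim_of_tendsto this
  · obtain ⟨v', hv0', -, -, hvcoh', hvn', Y', q', η', hY', hη', hvη'⟩ := hsol' τ ⟨h1, h2⟩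
    have hvv : v = v' := by
      funext x
      by_cases hx : x ∈ Ico 0 X.total
      · exact IETData.eq_of_solutions hY hY' hvcoh hvcoh' hη hη' hvη hvη' hx
      · rw [hv0 x hx, hv0' x hx]
    subst hvv
    dsimp only
    rw [if_pos ⟨h1, h2⟩]
    refine ⟨⟨?_, hvn'.trans_lt ?_⟩, hvn'⟩
    · rw [IETData.holderInt_eq hn ha0 h1 h2]
      exact hvc
    · exact ENNReal.mul_lt_top ENNReal.ofReal_lt_top (hφ.paNorm_lt_top hp ha0 ha1)
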